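/- For $A\in U(N)$ put $P_N(A,\theta)=\det(I-Ae^{i\theta})$, $\theta\in\mathbb R$, and call $\theta_1,\dots,\theta_N$ (counted with multiplicity, in $[-\pi,\pi)$) the eigenangles of $A$ if $e^{-i\theta_1},\dots,e^{-i\theta_N}$ are the eigenvalues of $A$, so that $P_N(A,\theta)=\prod_{j=1}^N(1-e^{i(\theta-\theta_j)})$. Write $\operatorname{Log}$ for the principal logarithm, so that $-\pi/2<\operatorname{Im}\operatorname{Log}(1-e^{ix})\le\pi/2$ for $x \notin 2\pi\mathbb Z$. The branches used are $\log P_N(A,\theta)=\sum_{j}\operatorname{Log}(1-e^{i(\theta-\theta_j)})$ and, for the $\theta$-derivative $P_N'(A,\theta_n)=-i\prod_{j\ne n}(1-e^{i(\theta_n-\theta_j)})$ at an eigenangle, $\log P_N'(A,\theta_n)=-\frac{i\pi}{2}+\sum_{j\ne n}\operatorname{Log}(1-e^{i(\theta_n-\theta_j)})$ (these are defined for Haar-almost every $A$). Let $A$ be drawn from $U(N)$, $N\ge1$, with respect to Haar probability measure and let $\theta_1$ be, given $A$, a uniformly chosen one of its $N$ eigenangles. Let $(T_j(N))_{j\ge1}$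 be the cumulants of $\operatorname{Im}\log P_N'(A,\theta_1)$ and, for a fixed $\theta\in\mathbb R$, let $(Q_j(N))_{j\ge1}$ be the cumulants of $\operatorname{Re}\log P_N(A,\theta)$ (the $j$-th cumulant of $X$ being the $j$-th derivative at $t=0$ of $\log\mathbb E[e^{tX}]$; both random variables have finite exponential moments in a neighbourhood of $t=0$). Then, for every $N\ge 1$, \[T_1(N)=-\frac{\pi}{2},\qquad T_2(N)=Q_2(N)-\frac{\pi^2}{12},\] and as $N\to\infty$, $T_2(N)\sim Q_2(N)\sim\frac12\log N$ and \[\frac{\operatorname{Im}\log P_N'(A,\theta_1)-T_1(N)}{\sqrt{T_2(N)}}\longrightarrow\mathcal N(0,1)\quad\text{in law.}\] -/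

import Mathlib

noncomputable section

namespace CUE

open MeasureTheory ProbabilityTheory

/-- The unitary group `U(N)`, with its subspace topology. -/
abbrev U (N : ℕ) : Type := Matrix.unitaryGroup (Fin N) ℂ

instance instTopGroup (N : ℕ) : IsTopologicalGroup (U N) :=
  inferInstanceAs (IsTopologicalGroup (unitary (Matrix (Fin N) (Fin N) ℂ)))

instance instCompact (N : ℕ) : CompactSpace (U N) := by
  have hb : IsCompact {M : Matrix (Fin N) (Fin N) ℂ |
      ∀ i j, M i j ∈ Metric.closedBall (0 : ℂ) 1} := by
    have h := isCompact_univ_pi (X := fun _ : Fin N => Fin N → ℂ)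
      (fun _ : Fin N => isCompact_univ_pi
        (fun _ : Fin N => isCompact_closedBall (0 : ℂ) 1))
    have he : {M : Matrix (Fin N) (Fin N) ℂ | ∀ i j, M i j ∈ Metric.closedBall (0 : ℂ) 1} =
        (Set.univ.pi fun _ : Fin N => Set.univ.pi fun _ : Fin N => Metric.closedBall (0 : ℂ) 1 :
          Set (Fin N → Fin N → ℂ)) := by
      refine Set.ext fun M => ?_
      exact ⟨fun hM i _ j _ => hM i j, fun hM i j => hM i trivial j trivial⟩
    rw [he]
    exact h
  have hc : IsClosed {M : Matrix (Fin N) (Fin N) ℂ | M ∈ Matrix.unitaryGroup (Fin N) ℂ} := by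
    simp only [Matrix.mem_unitaryGroup_iff]
    exact isClosed_eq (continuous_id.mul continuous_star) continuous_const
  have : IsCompact (Matrix.unitaryGroup (Fin N) ℂ : Set (Matrix (Fin N) (Fin N) ℂ)) := by
    refine hb.of_isClosed_subset hc fun M hM i j => ?_
    simpa using entry_norm_bound_of_unitary hM i j
  exact isCompact_iff_compactSpace.1 this

/-- The Borel σ-algebra on `U(N)`. -/
instance instMeasurableSpace (N : ℕ) : MeasurableSpace (U N) := borel _

instance instBorelSpace (N : ℕ) : BorelSpace (U N) := ⟨rfl⟩

/-- The Haar probability measure on `U(N)`. -/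
def haar (N : ℕ) : Measure (U N) := Measure.haarMeasure ⊤

instance instProbHaar (N : ℕ) : IsProbabilityMeasure (haar N) :=
  ⟨by
    have h := Measure.haarMeasure_self (K₀ := (⊤ : TopologicalSpace.PositiveCompacts (U N)))
    simpa [haar] using h⟩

/-- The joint law of a Haar unitary matrix `A` and of an independent label `n`, uniform on the `N`
labels of the eigenangles of `A`. Under this law the `n`-th eigenangle of `A` is,
conditionally on `A`, uniformly distributed on the eigenangles of `A` (with multiplicity). -/
def haarWithLabel (N : ℕ) : Measure (U N × Fin N) := (haar N).prod (uniformOn Set.univ)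

instance instProbHaarWithLabel (N : ℕ) [NeZero N] : IsProbabilityMeasure (haarWithLabel N) := by
  have : IsProbabilityMeasure (uniformOn (Set.univ : Set (Fin N))) :=
    isProbabilityMeasure_uniformOn Set.finite_univ Set.univ_nonempty
  unfold haarWithLabel
  infer_instance

/-- `P_N(A, θ) = det (I - A e^{iθ})`. -/
def P {N : ℕ} (A : U N) (θ : ℝ) : ℂ :=
  (1 - Complex.exp (Complex.I * θ) • (A : Matrix (Fin N) (Fin N) ℂ)).det

/-- The multiset of the eigenangles `θ_j ∈ [-π, π)` of `A`, with multiplicity: the `e^{-iθ_j}` are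
the eigenvalues of `A`, so that `P_N(A, θ) = ∏_j (1 - e^{i(θ - θ_j)})`, see `P_eq_prod`. -/
def eigenangles {N : ℕ} (A : U N) : Multiset ℝ :=
  (A : Matrix (Fin N) (Fin N) ℂ).charpoly.roots.map (fun z => -Complex.arg z)

theorem length_sort_eigenangles {N : ℕ} (A : U N) :
    ((eigenangles A).sort (· ≤ ·)).length = N := by
  simp [eigenangles, IsAlgClosed.card_roots_eq_natDegree, Matrix.charpoly_natDegree_eq_dim]

/-- The eigenangles `θ_1 ≤ … ≤ θ_N` of `A` in increasing order. -/
def eigenangle {N : ℕ} (A : U N) (n : Fin N) : ℝ :=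
  ((eigenangles A).sort (· ≤ ·)).get (n.cast (length_sort_eigenangles A).symm)

/-- The branch of `log P_N(A, θ)`: the sum over the eigenangles of the principal logarithms of
`1 - e^{i(θ - θ_j)}`, whose imaginary parts lie in `(-π/2, π/2]`. -/
def logP {N : ℕ} (A : U N) (θ : ℝ) : ℂ :=
  ∑ j, Complex.log (1 - Complex.exp (Complex.I * (θ - eigenangle A j)))

/-- The branch of `log P_N'(A, θ_n)`, where `P_N'` is the derivative in `θ` and `θ_n` is the
`n`-th eigenangle: `P_N'(A, θ_n) = -i ∏_{j ≠ n} (1 - e^{i(θ_n - θ_j)})`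
and every factor gets its principal logarithm, see `exp_logP'`. -/
def logP' {N : ℕ} (A : U N) (n : Fin N) : ℂ :=
  Complex.log (-Complex.I) + ∑ j ∈ Finset.univ.erase n,
    Complex.log (1 - Complex.exp (Complex.I * (eigenangle A n - eigenangle A j)))

/-- The `j`-th cumulant of a real random variable `X`: the `j`-th derivative at `0` of
`t ↦ log E[exp (t X)]`. -/
def cumulant {Ω : Type*} [MeasurableSpace Ω] (X : Ω → ℝ) (μ : Measure Ω) (j : ℕ) : ℝ :=
  iteratedDeriv j (cgf X μ) 0

/-- The random variable `Im log P_N'(A, θ_1)`, with `θ_1` a uniformly chosen eigenangle. -/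
def imLogP' (N : ℕ) (ω : U N × Fin N) : ℝ := (logP' ω.1 ω.2).im

/-- The random variable `Re log P_N(A, θ)`. -/
def reLogP (N : ℕ) (θ : ℝ) (A : U N) : ℝ := (logP A θ).re

/-- The cumulants `T_j(N)` of `Im log P_N'(A, θ_1)`. -/
def T (j N : ℕ) : ℝ := cumulant (imLogP' N) (haarWithLabel N) j

/-- The cumulants `Q_j(N)` of `Re log P_N(A, θ)`. -/
def Q (j N : ℕ) (θ : ℝ) : ℝ := cumulant (reLogP N θ) (haar N) j

theorem prod_eigenangle {N : ℕ} (A : U N) (f : ℝ → ℂ) :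
    ∏ j, f (eigenangle A j) = ((eigenangles A).map f).prod := by
  have h : (Multiset.map f (eigenangles A)) =
      ((((eigenangles A).sort (· ≤ ·)).map f : List ℂ) : Multiset ℂ) := by
    rw [← Multiset.map_coe, Multiset.sort_eq]
  rw [h, Multiset.prod_coe, ← List.prod_ofFn]
  congr 1
  apply List.ext_get
  · simp [length_sort_eigenangles A]
  · intro i h1 h2
    simp [eigenangle]

theorem exp_arg_of_mem_roots {N : ℕ} (A : U N) {z : ℂ}
    (hz : z ∈ (A : Matrix (Fin N) (Fin N) ℂ).charpoly.roots) :
    Complex.exp (Complex.I * Complex.arg z) = z := by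
  have hs : z ∈ spectrum ℂ (A : Matrix (Fin N) (Fin N) ℂ) :=
    Matrix.mem_spectrum_iff_isRoot_charpoly.2 (Polynomial.isRoot_of_mem_roots hz)
  have hn : ‖z‖ = 1 := by
    open scoped Matrix.Norms.L2Operator in
    simpa using spectrum.subset_circle_of_unitary A.2 hs
  have := Complex.norm_mul_exp_arg_mul_I z
  rw [hn] at this
  simpa [mul_comm] using this

/-- `P_N(A, θ) = ∏_j (1 - e^{i(θ - θ_j)})`. -/
theorem P_eq_prod {N : ℕ} (A : U N) (θ : ℝ) :
    P A θ = ∏ j, (1 - Complex.exp (Complex.I * (θ - eigenangle A j))) := by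
  rw [prod_eigenangle A (fun φ => 1 - Complex.exp (Complex.I * (θ - φ)))]
  set M : Matrix (Fin N) (Fin N) ℂ := (A : Matrix (Fin N) (Fin N) ℂ) with hM
  set c := Complex.exp (Complex.I * θ) with hc
  have hc0 : c ≠ 0 := Complex.exp_ne_zero _
  have h1 : (1 - c • M) = c • (Matrix.scalar (Fin N) c⁻¹ - M) := by
    ext i j
    by_cases hij : i = j
    · subst hij; simp [mul_sub, hc0]
    · simp [hij]
  have hcard : M.charpoly.roots.card = N := by
    simp [IsAlgClosed.card_roots_eq_natDegree, Matrix.charpoly_natDegree_eq_dim]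
  have h2 : P A θ = (M.charpoly.roots.map (fun z => 1 - c * z)).prod := by
    have h3 : (M.charpoly.roots.map (fun z => 1 - c * z))
        = M.charpoly.roots.map (fun z => c * (c⁻¹ - z)) := by
      refine Multiset.map_congr rfl fun z _ => ?_
      rw [mul_sub, mul_inv_cancel₀ hc0]
    rw [h3, Multiset.prod_map_mul, Multiset.map_const', Multiset.prod_replicate, hcard]
    unfold P
    rw [← hM, ← hc, h1, Matrix.det_smul, Fintype.card_fin, ← Matrix.eval_charpoly,
      (IsAlgClosed.splits M.charpoly).eval_eq_prod_roots_of_monic (Matrix.charpoly_monic M)]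
  rw [h2, eigenangles, Multiset.map_map]
  congr 1
  refine Multiset.map_congr rfl fun z hz => ?_
  have hz' := exp_arg_of_mem_roots A hz
  simp only [Function.comp]
  push_cast
  rw [sub_neg_eq_add, mul_add, Complex.exp_add, hz']

theorem eigenangle_mem_Ico {N : ℕ} (A : U N) (n : Fin N) :
    eigenangle A n ∈ Set.Ico (-Real.pi) Real.pi := by
  have h : eigenangle A n ∈ eigenangles A := by
    rw [← Multiset.mem_sort (· ≤ ·)]
    exact List.get_mem _ _
  obtain ⟨z, -, hz⟩ := Multiset.mem_map.1 h
  rw [← hz]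
  exact ⟨neg_le_neg (Complex.arg_le_pi z), neg_lt.1 (Complex.neg_pi_lt_arg z)⟩

/-- If the eigenangles of `A` are distinct, then `logP' A n` is a logarithm of the derivative of
`P_N(A, ·)` at the eigenangle `θ_n`. -/
theorem exp_logP' {N : ℕ} (A : U N) (hA : Function.Injective (eigenangle A)) (n : Fin N) :
    Complex.exp (logP' A n) = deriv (P A) (eigenangle A n) := by
  have hfac : ∀ j ∈ Finset.univ.erase n,
      1 - Complex.exp (Complex.I * (eigenangle A n - eigenangle A j)) ≠ 0 := by
    intro j hj h
    have h1 := (sub_eq_zero.1 h).symm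
    obtain ⟨k, hk⟩ := Complex.exp_eq_one_iff.1 h1
    have h2 : eigenangle A n - eigenangle A j = k * (2 * Real.pi) := by
      have h3 : ((eigenangle A n - eigenangle A j : ℝ) : ℂ) = ((k * (2 * Real.pi) : ℝ) : ℂ) := by
        apply mul_left_cancel₀ Complex.I_ne_zero
        push_cast
        rw [hk]
        ring
      exact_mod_cast h3
    have ha := eigenangle_mem_Ico A n
    have hb := eigenangle_mem_Ico A j
    have hpi := Real.pi_pos
    have hk0 : k = 0 := by
      have u1 : (k : ℝ) < 1 := by
        by_contra! hc
        nlinarith [ha.1, ha.2, hb.1, hb.2]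
      have u2 : (-1 : ℝ) < k := by
        by_contra! hc
        nlinarith [ha.1, ha.2, hb.1, hb.2]
      have u3 : k < 1 := by exact_mod_cast u1
      have u4 : -1 < k := by exact_mod_cast u2
      omega
    rw [hk0] at h2
    refine (Finset.ne_of_mem_erase hj) (hA ?_)
    simp only [Int.cast_zero, zero_mul] at h2
    linarith
  have hP : P A = fun θ : ℝ => (1 - Complex.exp (Complex.I * (θ - eigenangle A n))) *
      ∏ j ∈ Finset.univ.erase n, (1 - Complex.exp (Complex.I * (θ - eigenangle A j))) := by
    funext θ
    rw [P_eq_prod]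
    exact (Finset.mul_prod_erase Finset.univ
      (fun j => 1 - Complex.exp (Complex.I * (θ - eigenangle A j))) (Finset.mem_univ n)).symm
  have hd1 : HasDerivAt (fun θ : ℝ => 1 - Complex.exp (Complex.I * (θ - eigenangle A n)))
      (-Complex.I) (eigenangle A n) := by
    have h0 : HasDerivAt (fun θ : ℝ => Complex.I * ((θ : ℂ) - eigenangle A n)) Complex.I
        (eigenangle A n) := by
      simpa using ((Complex.ofRealCLM.hasDerivAt (x := eigenangle A n)).sub_const
        (eigenangle A n : ℂ)).const_mul Complex.I
    simpa using h0.cexp.const_sub 1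
  have hd2 : DifferentiableAt ℝ (fun θ : ℝ => ∏ j ∈ Finset.univ.erase n,
      (1 - Complex.exp (Complex.I * (θ - eigenangle A j)))) (eigenangle A n) := by
    fun_prop
  have hd := (hd1.mul hd2.hasDerivAt).deriv
  rw [hP]
  refine Eq.trans ?_ hd.symm
  unfold logP'
  rw [Complex.exp_add, Complex.exp_log (by simp), Complex.exp_sum,
    Finset.prod_congr rfl fun j hj => Complex.exp_log (hfac j hj)]
  simp

end CUE

end

open MeasureTheory ProbabilityTheory Filter Topology
open scoped Real

noncomputable section

namespace CUE

/-! For fixed `A` with simple spectrum, `φ ↦ Im log P_N(A, φ)` is a sawtooth: it rises with slope `N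
/ 2` and drops by `π` at each eigenangle, and its right limit at `θ_n` is `Im log P_N'(A, θ_n)`.
Regrouping the circle average of a test function by drops instead of by intervals shows that it is
the average over `n` of the means over `[x_n, x_n + π]`, where `x_n = Im log P_N'(A, θ_n)`. Haar
measure is invariant under scalar rotations, so `Im log P_N(A, 0)` has the law of `Im log P_N'(A,
θ_1)` plus an independent uniform variable on `[0, π]` (`integral_imLogP_eq_integral_imLogP'`). The
uniform variable has mean `π / 2` and variance `π ^ 2 / 12`, whence `T_1 = -π / 2` and `T_2 = Var Im
log P_N - π ^ 2 / 12`.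

It remains to compare with the real part. Inside the unit disc `(∑ Log (1 - z λ_j)) ^ k` is
holomorphic and vanishes at `0`, so its circle averages vanish. Letting the radius tend to `1` gives
`E log P_N = 0` and `E (log P_N) ^ 2 = 0`; the real part of the latter says that `Re log P_N` and
`Im log P_N` have equal variance (`integral_reLogP_zero_sq`), so `Q_2 = varIm N`.

The growth of the variance and the limit law come from a recursion in `N`. For Haar `M` in `U(N +
1)` with corner entry `α` and independent Haar `V` in `U(N)`, the matrix `M diag(V, 1)` is Haar, and
a Schur complement gives `det (1 - M diag(V, 1)) = (1 - α) det (1 - W V)` with `W` unitary and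
depending on `M` only. Left invariance absorbs `W`, so `log P_{N+1}` is in law an independent sum of
`Log (1 - α)` and `log P_N` (`map_logP_succ`); a homotopy shows that the branches match
(`logP_mul_emb`). Thus `Im log P_N` is a sum of independent centred bounded variables of variance `1
/ (2 (k + 1)) + O(k ^ (-3 / 2))`. Its variance is `(log N) / 2 + O(1)`, and comparing characteristic
functions factor by factor gives a central limit theorem. The uniform summand is negligible at scale
`√(log N)`, so its characteristic function can be divided out. -/

/-! ### Haar measure on `U(N)` and measurability of the eigenangles -/

instance secondCountable (N : ℕ) : SecondCountableTopology (U N) := by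
  have : SecondCountableTopology (Matrix (Fin N) (Fin N) ℂ) :=
    inferInstanceAs (SecondCountableTopology (Fin N → Fin N → ℂ))
  exact TopologicalSpace.Subtype.secondCountableTopology _

instance haar_isHaarMeasure (N : ℕ) : (haar N).IsHaarMeasure := by
  unfold haar; infer_instance

instance haar_isMulRightInvariant (N : ℕ) : (haar N).IsMulRightInvariant := by
  refine ⟨fun g => ?_⟩
  have : IsProbabilityMeasure (Measure.map (· * g) (haar N)) :=
    Measure.isProbabilityMeasure_map (by fun_prop)
  have : (Measure.map (· * g) (haar N)).IsHaarMeasure :=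
    Measure.isHaarMeasure_map_mul_right _ g
  exact Measure.isHaarMeasure_eq_of_isProbabilityMeasure _ _

instance haar_isInvInvariant (N : ℕ) : (haar N).IsInvInvariant := by
  refine ⟨?_⟩
  have : IsProbabilityMeasure (haar N).inv :=
    Measure.isProbabilityMeasure_map (by fun_prop)
  have : (haar N).inv.IsHaarMeasure := Measure.isHaarMeasure_of_isCompact_nonempty_interior _
    Set.univ isCompact_univ (by simp) (by simp) (by simp)
  exact Measure.isHaarMeasure_eq_of_isProbabilityMeasure _ _

theorem map_eigenangle {N : ℕ} (A : U N) :
    Finset.univ.val.map (eigenangle A) = eigenangles A := by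
  rw [← Multiset.sort_eq (eigenangles A) (· ≤ ·), Fin.univ_val_map, Multiset.coe_eq_coe]
  refine List.Perm.of_eq (List.ext_get ?_ fun i h1 h2 => ?_)
  · simp [length_sort_eigenangles A]
  · simp [eigenangle]

theorem monotone_eigenangle {N : ℕ} (A : U N) : Monotone (eigenangle A) := by
  intro i j hij
  have h := Multiset.pairwise_sort (eigenangles A) (· ≤ ·)
  rcases hij.eq_or_lt with rfl | hlt
  · exact le_rfl
  · exact List.pairwise_iff_get.1 h _ _ hlt

/-- The eigenvalue `e^{-iθ_j}` of `A`. -/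
def eigenvalue {N : ℕ} (A : U N) (j : Fin N) : ℂ := Complex.exp (-(Complex.I * eigenangle A j))

theorem map_eigenvalue {N : ℕ} (A : U N) : Finset.univ.val.map (eigenvalue A) =
    (A : Matrix (Fin N) (Fin N) ℂ).charpoly.roots := by
  have : eigenvalue A = (fun x : ℝ => Complex.exp (-(Complex.I * x))) ∘ eigenangle A := rfl
  rw [this, ← Multiset.map_map, map_eigenangle, eigenangles, Multiset.map_map]
  conv_rhs => rw [← Multiset.map_id (Matrix.charpoly _).roots]
  refine Multiset.map_congr rfl fun z hz => ?_
  simpa using exp_arg_of_mem_roots A hz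

theorem norm_eigenvalue {N : ℕ} (A : U N) (j : Fin N) : ‖eigenvalue A j‖ = 1 := by
  rw [eigenvalue, Complex.norm_exp]; simp

theorem charpoly_eval_eq {N : ℕ} (A : U N) (t : ℂ) :
    (A : Matrix (Fin N) (Fin N) ℂ).charpoly.eval t = ∏ j, (t - eigenvalue A j) := by
  rw [(IsAlgClosed.splits _).eval_eq_prod_roots_of_monic (Matrix.charpoly_monic _),
    ← map_eigenvalue, Multiset.map_map]
  rfl

theorem det_one_sub_smul {N : ℕ} (A : U N) (c : ℂ) :
    (1 - c • (A : Matrix (Fin N) (Fin N) ℂ)).det = ∏ j, (1 - c * eigenvalue A j) := by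
  rcases eq_or_ne c 0 with rfl | hc
  · simp
  have h1 : (1 - c • (A : Matrix (Fin N) (Fin N) ℂ)) = c • (Matrix.scalar (Fin N) c⁻¹ - A) := by
    rw [smul_sub]; congr 1
    ext i j; by_cases h : i = j
    · subst h; simp [hc]
    · simp [h]
  rw [h1, Matrix.det_smul, ← Matrix.eval_charpoly, charpoly_eval_eq, Fintype.card_fin,
    ← Fin.prod_const, ← Finset.prod_mul_distrib]
  refine Finset.prod_congr rfl fun j _ => ?_
  rw [mul_sub, mul_inv_cancel₀ hc]

theorem roots_eq_map {N : ℕ} {M : Matrix (Fin N) (Fin N) ℂ} {z : Fin N → ℂ}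
    (h : ∀ t, M.charpoly.eval t = ∏ j, (t - z j)) :
    M.charpoly.roots = Finset.univ.val.map z := by
  have : M.charpoly = ∏ j, (Polynomial.X - Polynomial.C (z j)) :=
    Polynomial.funext fun t => by rw [h, Polynomial.eval_prod]; simp
  rw [this, Finset.prod_eq_multiset_prod, ← Function.comp_def (fun a => Polynomial.X - Polynomial.C a) z,
    ← Multiset.map_map, Polynomial.roots_multiset_prod_X_sub_C]

theorem neg_arg_exp {x : ℝ} (hx : x ∈ Set.Ico (-π) π) :
    -Complex.arg (Complex.exp (-(Complex.I * x))) = x := by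
  have : -(Complex.I * (x : ℂ)) = ((-x : ℝ) : ℂ) * Complex.I := by push_cast; ring
  rw [this, Complex.arg_exp_mul_I, (toIocMod_eq_self Real.two_pi_pos).2]
  · ring
  · constructor <;> linarith [hx.1, hx.2]

/-- This form is a closed condition with a compact witness, hence the closed interval for `φ`. The
angle `π` duplicates `-π`, but as `x < π` it cannot occur among the angles at most `x`. If `θ_k >
x`, at most `k` eigenangles are `≤ x`, while the witness provides `k + 1`. -/
theorem eigenangle_le_iff {N : ℕ} (A : U N) (k : Fin N) {x : ℝ} (hx : x < π) :
    eigenangle A k ≤ x ↔ ∃ φ : Fin N → Set.Icc (-π) π, (∀ j ≤ k, (φ j : ℝ) ≤ x) ∧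
      ∀ t, (A : Matrix (Fin N) (Fin N) ℂ).charpoly.eval t =
        ∏ j, (t - Complex.exp (-(Complex.I * (φ j : ℝ)))) := by
  constructor
  · intro h
    exact ⟨fun j => ⟨eigenangle A j, Set.Ico_subset_Icc_self (eigenangle_mem_Ico A j)⟩,
      fun j hj => (monotone_eigenangle A hj).trans h, fun t => charpoly_eval_eq A t⟩
  · rintro ⟨φ, h1, h2⟩
    by_contra! hlt
    have hr := roots_eq_map h2
    have he : eigenangles A = Finset.univ.val.map
        (fun j => -Complex.arg (Complex.exp (-(Complex.I * (φ j : ℝ))))) := by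
      rw [eigenangles, hr, Multiset.map_map]; rfl
    rw [← map_eigenangle] at he
    have hc := congrArg (Multiset.countP (· ≤ x)) he
    rw [Multiset.countP_map, Multiset.countP_map] at hc
    have hc' : (Finset.univ.filter fun j => eigenangle A j ≤ x).card =
      (Finset.univ.filter fun j =>
        -Complex.arg (Complex.exp (-(Complex.I * (φ j : ℝ)))) ≤ x).card := hc
    have u1 : (Finset.univ.filter fun j => eigenangle A j ≤ x) ⊆ Finset.Iio k := by
      intro j hj
      rw [Finset.mem_filter] at hj
      rw [Finset.mem_Iio]
      by_contra! hkj
      exact absurd (hlt.trans_le (monotone_eigenangle A hkj)) (not_lt.2 hj.2)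
    have u2 : Finset.Iic k ⊆ (Finset.univ.filter fun j =>
        -Complex.arg (Complex.exp (-(Complex.I * (φ j : ℝ)))) ≤ x) := by
      intro j hj
      rw [Finset.mem_Iic] at hj
      rw [Finset.mem_filter, neg_arg_exp ⟨(φ j).2.1, (h1 j hj).trans_lt hx⟩]
      exact ⟨Finset.mem_univ _, h1 j hj⟩
    have u3 := Finset.card_le_card u1
    have u4 := Finset.card_le_card u2
    rw [Fin.card_Iio] at u3
    rw [Fin.card_Iic] at u4
    omega

@[fun_prop]
theorem continuous_coe {N : ℕ} : Continuous (fun A : U N => (A : Matrix (Fin N) (Fin N) ℂ)) :=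
  continuous_subtype_val

-- Sublevel sets below `π` are projections of closed sets along a compact factor, hence closed.
@[fun_prop]
theorem measurable_eigenangle {N : ℕ} (k : Fin N) : Measurable fun A : U N => eigenangle A k := by
  refine measurable_of_Iic fun x => ?_
  rcases lt_or_ge x π with hx | hx
  · have : IsClosed {p : U N × (Fin N → Set.Icc (-π) π) | (∀ j ≤ k, (p.2 j : ℝ) ≤ x) ∧
      ∀ t, (p.1 : Matrix (Fin N) (Fin N) ℂ).charpoly.eval t =
        ∏ j, (t - Complex.exp (-(Complex.I * (p.2 j : ℝ))))} := by
      have e : {p : U N × (Fin N → Set.Icc (-π) π) | (∀ j ≤ k, (p.2 j : ℝ) ≤ x) ∧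
          ∀ t, (p.1 : Matrix (Fin N) (Fin N) ℂ).charpoly.eval t =
            ∏ j, (t - Complex.exp (-(Complex.I * (p.2 j : ℝ))))} =
          (⋂ j, ⋂ _ : j ≤ k, {p | (p.2 j : ℝ) ≤ x}) ∩ ⋂ t : ℂ, {p | (Matrix.scalar (Fin N) t -
            (p.1 : Matrix (Fin N) (Fin N) ℂ)).det =
              ∏ j, (t - Complex.exp (-(Complex.I * (p.2 j : ℝ))))} := by
        ext p
        simp [Matrix.eval_charpoly]
      rw [e]
      refine IsClosed.inter (isClosed_iInter fun j => isClosed_iInter fun _ =>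
          isClosed_le (by fun_prop) (by fun_prop)) (isClosed_iInter fun t => ?_)
      exact isClosed_eq (Continuous.matrix_det (by fun_prop)) (by fun_prop)
    have h2 := isClosedMap_fst_of_compactSpace _ this
    convert h2.measurableSet using 1
    ext A
    simp [eigenangle_le_iff A k hx]
  · convert MeasurableSet.univ
    ext A
    simpa using ((eigenangle_mem_Ico A k).2.le.trans hx)

/-! ### Scalar rotations and measurability of the logarithms -/

theorem logP_eq_sum {N : ℕ} (A : U N) (θ : ℝ) :
    logP A θ = ∑ j, Complex.log (1 - Complex.exp (Complex.I * θ) * eigenvalue A j) := by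
  refine Finset.sum_congr rfl fun j _ => ?_
  rw [eigenvalue, ← Complex.exp_add]
  congr 4
  ring

theorem logP_eq_roots {N : ℕ} (A : U N) (θ : ℝ) :
    logP A θ = ((A : Matrix (Fin N) (Fin N) ℂ).charpoly.roots.map
      fun z => Complex.log (1 - Complex.exp (Complex.I * θ) * z)).sum := by
  rw [logP_eq_sum, ← map_eigenvalue, Multiset.map_map]
  rfl

/-- Scalar unitary matrices. -/
def rot (N : ℕ) (φ : ℝ) : U N := ⟨Complex.exp (Complex.I * φ) • 1, by
  rw [Matrix.mem_unitaryGroup_iff, star_smul, star_one, smul_mul_smul_comm, one_mul,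
    Complex.star_def, ← Complex.exp_conj, ← Complex.exp_add]
  simp⟩

theorem coe_rot_mul {N : ℕ} (φ : ℝ) (A : U N) :
    ((rot N φ * A : U N) : Matrix (Fin N) (Fin N) ℂ) =
      Complex.exp (Complex.I * φ) • (A : Matrix (Fin N) (Fin N) ℂ) := by
  simp [rot]

@[fun_prop]
theorem continuous_rot (N : ℕ) : Continuous (rot N) := by
  unfold rot
  fun_prop

theorem roots_rot_mul {N : ℕ} (φ : ℝ) (A : U N) :
    ((rot N φ * A : U N) : Matrix (Fin N) (Fin N) ℂ).charpoly.roots =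
      Finset.univ.val.map fun j => Complex.exp (Complex.I * φ) * eigenvalue A j := by
  refine roots_eq_map fun t => ?_
  set c := Complex.exp (Complex.I * φ) with hc
  have hc0 : c ≠ 0 := Complex.exp_ne_zero _
  have h1 : Matrix.scalar (Fin N) t - ((rot N φ * A : U N) : Matrix (Fin N) (Fin N) ℂ) =
      c • (Matrix.scalar (Fin N) (c⁻¹ * t) - A) := by
    rw [coe_rot_mul, smul_sub]; congr 1
    ext i j; by_cases h : i = j
    · subst h; simp [hc0]
    · simp [h]
  rw [Matrix.eval_charpoly, h1, Matrix.det_smul, ← Matrix.eval_charpoly, charpoly_eval_eq,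
    Fintype.card_fin, ← Fin.prod_const, ← Finset.prod_mul_distrib]
  refine Finset.prod_congr rfl fun j _ => ?_
  rw [mul_sub, ← mul_assoc, mul_inv_cancel₀ hc0, one_mul]

/-- Left invariance of Haar measure thereby makes the law of `logP A θ` independent of `θ`, and lets
Haar expectations be averaged over the circle. -/
theorem logP_rot_mul {N : ℕ} (φ θ : ℝ) (A : U N) : logP (rot N φ * A) θ = logP A (φ + θ) := by
  rw [logP_eq_roots, roots_rot_mul, Multiset.map_map, logP_eq_sum]
  refine Finset.sum_congr rfl fun j _ => ?_
  simp only [Function.comp]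
  rw [← mul_assoc, ← Complex.exp_add]
  congr 4
  push_cast; ring

@[fun_prop]
theorem measurable_logP {N : ℕ} : Measurable fun p : U N × ℝ => logP p.1 p.2 := by
  unfold logP
  have : ∀ j, Measurable fun p : U N × ℝ => eigenangle p.1 j :=
    fun j => (measurable_eigenangle j).comp measurable_fst
  fun_prop

theorem measurable_imLogP' {N : ℕ} : Measurable (imLogP' N) := by
  refine measurable_from_prod_countable_left fun n => ?_
  have : ∀ j, Measurable fun A : U N => Complex.log
      (1 - Complex.exp (Complex.I * (eigenangle A n - eigenangle A j))) := fun j => by fun_prop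
  exact Complex.measurable_im.comp
    ((Finset.measurable_sum (Finset.univ.erase n) fun j _ => this j).const_add _)

theorem measurable_reLogP {N : ℕ} (θ : ℝ) : Measurable (reLogP N θ) := by
  unfold reLogP logP
  fun_prop

theorem integral_rot_mul {N : ℕ} {E : Type*} [NormedAddCommGroup E] [NormedSpace ℝ E]
    (F : U N → E) (φ : ℝ) : ∫ A, F (rot N φ * A) ∂haar N = ∫ A, F A ∂haar N :=
  integral_mul_left_eq_self F _

/-! ### Block matrices and the factorization of the determinant -/

section

open Matrix

section Block

variable {m : Type*}

/-- The transfer matrix `D + c (1 - α)⁻¹ b` of a block matrix whose last diagonal entry is `α`. -/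
def transferMatrix (M : Matrix (m ⊕ Fin 1) (m ⊕ Fin 1) ℂ) : Matrix m m ℂ :=
  M.toBlocks₁₁ + (1 - M (.inr 0) (.inr 0))⁻¹ • (M.toBlocks₁₂ * M.toBlocks₂₁)

theorem toBlocks₂₂_eq_smul (M : Matrix (m ⊕ Fin 1) (m ⊕ Fin 1) ℂ) :
    M.toBlocks₂₂ = M (.inr 0) (.inr 0) • 1 := by
  ext i j
  rw [Subsingleton.elim i 0, Subsingleton.elim j 0]
  simp [toBlocks₂₂]

variable [Fintype m] [DecidableEq m]

/-- The transfer matrix feeds the last output of `M` back into its last input: if `M (x, y) = (x',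
y)`, then `y = (1 - α)⁻¹ b x` and `x'` is the transfer matrix applied to `x`. As `M` preserves
norms, `‖x'‖ = ‖x‖`. The proof is the algebraic form of this, where all corrections to `1` are
multiples of `bᴴ * b` whose coefficients cancel. -/
theorem transferMatrix_mem_unitary {M : Matrix (m ⊕ Fin 1) (m ⊕ Fin 1) ℂ}
    (hM : M ∈ unitaryGroup (m ⊕ Fin 1) ℂ) (h : M (.inr 0) (.inr 0) ≠ 1) :
    transferMatrix M ∈ unitaryGroup m ℂ := by
  rw [mem_unitaryGroup_iff'] at hM ⊢
  have hα := toBlocks₂₂_eq_smul M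
  set α := M (.inr 0) (.inr 0) with hαd
  unfold transferMatrix
  rw [← hαd]
  set D := M.toBlocks₁₁
  set c := M.toBlocks₁₂
  set b := M.toBlocks₂₁
  have hMb : M = fromBlocks D c b (α • 1) := by rw [← hα]; exact (fromBlocks_toBlocks M).symm
  rw [hMb, star_eq_conjTranspose, fromBlocks_conjTranspose, fromBlocks_multiply,
    ← fromBlocks_one, fromBlocks_inj] at hM
  obtain ⟨h1, h2, h3, h4⟩ := hM
  simp only [conjTranspose_smul, conjTranspose_one, Matrix.mul_smul, Matrix.smul_mul,
    Matrix.mul_one, Matrix.one_mul, smul_smul] at h2 h3 h4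
  have e1 : Dᴴ * D = 1 - bᴴ * b := eq_sub_of_add_eq h1
  have e2 : Dᴴ * c = -(α • bᴴ) := eq_neg_of_add_eq_zero_left h2
  have e3 : cᴴ * D = -(star α • b) := eq_neg_of_add_eq_zero_left h3
  have e4 : cᴴ * c = (1 - α * star α) • 1 := by
    rw [sub_smul, one_smul]; exact eq_sub_of_add_eq h4
  set k := (1 - α)⁻¹ with hk
  have e5 : star (D + k • (c * b)) * (D + k • (c * b)) = Dᴴ * D + k • ((Dᴴ * c) * b)
      + star k • (bᴴ * (cᴴ * D)) + (star k * k) • (bᴴ * (cᴴ * c) * b) := by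
    rw [star_eq_conjTranspose, conjTranspose_add, conjTranspose_smul, conjTranspose_mul]
    simp only [Matrix.add_mul, Matrix.mul_add, Matrix.smul_mul, Matrix.mul_smul,
      Matrix.mul_assoc]
    module
  rw [e5, e1, e2, e3, e4]
  simp only [Matrix.neg_mul, Matrix.mul_neg, Matrix.smul_mul, Matrix.mul_smul, Matrix.mul_one,
    smul_smul, smul_neg]
  have hα1 : 1 - α ≠ 0 := sub_ne_zero.2 (Ne.symm h)
  have hα2 : 1 - star α ≠ 0 := by
    rw [← star_one ℂ, ← star_sub]; exact star_ne_zero.2 hα1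
  have key : -1 - k * α - star k * star α + star k * k * (1 - α * star α) = 0 := by
    rw [hk, star_inv₀, star_sub, star_one]
    field_simp
    ring
  calc 1 - bᴴ * b + -((k * α) • (bᴴ * b)) + -((star k * star α) • (bᴴ * b)) +
        (star k * k * (1 - α * star α)) • (bᴴ * b)
      = 1 + (-1 - k * α - star k * star α + star k * k * (1 - α * star α)) • (bᴴ * b) := by
        module
    _ = 1 := by rw [key, zero_smul, add_zero]

/-- Schur complement with respect to the last diagonal entry. It is needed for `z = 1`, where the
transfer matrix appears, and for `X = 0`, where only `1 - z α` survives. -/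
theorem det_one_sub_smul_mul_fromBlocks (M : Matrix (m ⊕ Fin 1) (m ⊕ Fin 1) ℂ) (X : Matrix m m ℂ)
    (z : ℂ) (h : 1 - z * M (.inr 0) (.inr 0) ≠ 0) :
    (1 - z • (M * fromBlocks X 0 0 1)).det = (1 - z * M (.inr 0) (.inr 0)) *
      (1 - z • ((M.toBlocks₁₁ + (z * (1 - z * M (.inr 0) (.inr 0))⁻¹) •
        (M.toBlocks₁₂ * M.toBlocks₂₁)) * X)).det := by
  have hα := toBlocks₂₂_eq_smul M
  set α := M (.inr 0) (.inr 0) with hαd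
  set D := M.toBlocks₁₁
  set c := M.toBlocks₁₂
  set b := M.toBlocks₂₁
  have hMb : M = fromBlocks D c b (α • 1) := by rw [← hα]; exact (fromBlocks_toBlocks M).symm
  have e : (1 : Matrix (m ⊕ Fin 1) (m ⊕ Fin 1) ℂ) - z • (M * fromBlocks X 0 0 1) =
      fromBlocks (1 - z • (D * X)) (-(z • c)) (-(z • (b * X))) ((1 - z * α) • 1) := by
    rw [hMb, fromBlocks_multiply, ← fromBlocks_one, fromBlocks_smul, sub_eq_add_neg,
      fromBlocks_neg, fromBlocks_add]
    congr 1 <;> simp [sub_eq_add_neg, add_smul, mul_smul]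
  let i : Invertible ((1 - z * α) • (1 : Matrix (Fin 1) (Fin 1) ℂ)) :=
    ⟨(1 - z * α)⁻¹ • 1, by simp [smul_smul, h], by simp [smul_smul, h]⟩
  have hi : ⅟((1 - z * α) • (1 : Matrix (Fin 1) (Fin 1) ℂ)) = (1 - z * α)⁻¹ • 1 := rfl
  rw [e, det_fromBlocks₂₂, hi]
  congr 1
  · simp
  · congr 1
    simp only [Matrix.add_mul, Matrix.smul_mul, Matrix.mul_smul, Matrix.neg_mul, Matrix.mul_neg,
      smul_add, smul_smul, Matrix.mul_one, neg_neg, Matrix.mul_assoc, smul_neg]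
    module

end Block

/-- The matrix `M` in the block form that separates the last index. -/
def blocks {N : ℕ} (M : Matrix (Fin (N + 1)) (Fin (N + 1)) ℂ) :
    Matrix (Fin N ⊕ Fin 1) (Fin N ⊕ Fin 1) ℂ :=
  M.submatrix finSumFinEquiv finSumFinEquiv

/-- The block diagonal matrix `diag(X, 1)`. -/
def border {N : ℕ} (X : Matrix (Fin N) (Fin N) ℂ) : Matrix (Fin (N + 1)) (Fin (N + 1)) ℂ :=
  (fromBlocks X 0 0 1).submatrix finSumFinEquiv.symm finSumFinEquiv.symm

theorem blocks_border {N : ℕ} (X : Matrix (Fin N) (Fin N) ℂ) :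
    blocks (border X) = fromBlocks X 0 0 1 := by
  simp [blocks, border]

theorem blocks_mul {N : ℕ} (M M' : Matrix (Fin (N + 1)) (Fin (N + 1)) ℂ) :
    blocks (M * M') = blocks M * blocks M' := by
  simp [blocks, submatrix_mul_equiv]

theorem blocks_one {N : ℕ} : blocks (1 : Matrix (Fin (N + 1)) (Fin (N + 1)) ℂ) = 1 := by
  simp [blocks]

theorem blocks_injective {N : ℕ} : Function.Injective (blocks (N := N)) := by
  intro M M' h
  ext i j
  have := congrFun (congrFun h (finSumFinEquiv.symm i)) (finSumFinEquiv.symm j)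
  simpa [blocks] using this

theorem blocks_mem_unitary_iff {N : ℕ} {M : Matrix (Fin (N + 1)) (Fin (N + 1)) ℂ} :
    blocks M ∈ unitaryGroup (Fin N ⊕ Fin 1) ℂ ↔ M ∈ unitaryGroup (Fin (N + 1)) ℂ := by
  rw [mem_unitaryGroup_iff, mem_unitaryGroup_iff, ← blocks_one, ← blocks_injective.eq_iff,
    blocks_mul]
  rfl

theorem border_mem_unitary {N : ℕ} {X : Matrix (Fin N) (Fin N) ℂ}
    (hX : X ∈ unitaryGroup (Fin N) ℂ) : border X ∈ unitaryGroup (Fin (N + 1)) ℂ := by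
  rw [← blocks_mem_unitary_iff, blocks_border, mem_unitaryGroup_iff, star_eq_conjTranspose,
    fromBlocks_conjTranspose, fromBlocks_multiply]
  rw [mem_unitaryGroup_iff, star_eq_conjTranspose] at hX
  simp [hX]

/-- The embedding `V ↦ diag(V, 1)` of `U(N)` into `U(N + 1)`. -/
def emb {N : ℕ} (V : U N) : U (N + 1) := ⟨border V, border_mem_unitary V.2⟩

@[fun_prop]
theorem continuous_emb {N : ℕ} : Continuous (emb (N := N)) := by
  refine Continuous.subtype_mk (f := fun V : U N => border (V : Matrix (Fin N) (Fin N) ℂ)) ?_ _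
  exact Continuous.matrix_submatrix (Continuous.matrix_fromBlocks (by fun_prop) (by fun_prop)
    (by fun_prop) (by fun_prop)) _ _

/-- The corner entry of a unitary matrix. -/
def corner {N : ℕ} (M : U (N + 1)) : ℂ :=
  (M : Matrix (Fin (N + 1)) (Fin (N + 1)) ℂ) (Fin.last N) (Fin.last N)

/-- The transfer matrix of a unitary matrix, as a unitary matrix. -/
def transfer {N : ℕ} (M : U (N + 1)) (h : corner M ≠ 1) : U N :=
  ⟨transferMatrix (blocks M), transferMatrix_mem_unitary (blocks_mem_unitary_iff.2 M.2) h⟩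

theorem norm_corner_le {N : ℕ} (M : U (N + 1)) : ‖corner M‖ ≤ 1 :=
  entry_norm_bound_of_unitary M.2 _ _

theorem det_one_sub_mul_border {N : ℕ} (M : U (N + 1)) (h : corner M ≠ 1)
    (X : Matrix (Fin N) (Fin N) ℂ) :
    (1 - (M : Matrix (Fin (N + 1)) (Fin (N + 1)) ℂ) * border X).det =
      (1 - corner M) * (1 - (transfer M h : Matrix (Fin N) (Fin N) ℂ) * X).det := by
  have := det_one_sub_smul_mul_fromBlocks (blocks (M : Matrix (Fin (N + 1)) (Fin (N + 1)) ℂ)) X 1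
    (by rw [one_mul]; exact sub_ne_zero.2 (Ne.symm h))
  rw [one_mul, one_smul, one_mul, one_smul, ← blocks_border, ← blocks_mul, ← blocks_one] at this
  rw [show (1 - corner M) = 1 - blocks (M : Matrix (Fin (N + 1)) (Fin (N + 1)) ℂ) (.inr 0) (.inr 0)
    from rfl]
  refine Eq.trans ?_ this
  exact (det_submatrix_equiv_self (finSumFinEquiv : Fin N ⊕ Fin 1 ≃ Fin (N + 1)) _).symm

theorem det_one_sub_smul_mul_border_zero {N : ℕ} (M : U (N + 1)) (z : ℂ)
    (h : 1 - z * corner M ≠ 0) :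
    (1 - z • ((M : Matrix (Fin (N + 1)) (Fin (N + 1)) ℂ) * border 0)).det =
      1 - z * corner M := by
  have := det_one_sub_smul_mul_fromBlocks (blocks (M : Matrix (Fin (N + 1)) (Fin (N + 1)) ℂ)) 0 z h
  rw [Matrix.mul_zero, smul_zero, sub_zero, det_one, mul_one, ← blocks_border, ← blocks_mul,
    ← blocks_one] at this
  refine Eq.trans ?_ this
  exact (det_submatrix_equiv_self (finSumFinEquiv : Fin N ⊕ Fin 1 ≃ Fin (N + 1)) _).symm

-- For `z < 1` the matrix subtracted from `1` is a strict contraction in operator norm.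
open scoped Matrix.Norms.L2Operator in
theorem det_one_sub_smul_mul_border_ne_zero {N : ℕ} (M : U (N + 1)) (V : U N) {z r : ℝ}
    (hz : z ∈ Set.Ico (0 : ℝ) 1) (hr : r ∈ Set.Icc (0 : ℝ) 1) :
    (1 - (z : ℂ) • ((M : Matrix (Fin (N + 1)) (Fin (N + 1)) ℂ) *
      border ((r : ℂ) • (V : Matrix (Fin N) (Fin N) ℂ)))).det ≠ 0 := by
  have hu : ∀ A ∈ unitaryGroup (Fin (N + 1)) ℂ, ‖A‖ ≤ 1 := fun A hA =>
    (CStarRing.norm_of_mem_unitary hA).le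
  have hneg : -(V : Matrix (Fin N) (Fin N) ℂ) ∈ unitaryGroup (Fin N) ℂ := by
    rw [mem_unitaryGroup_iff, star_neg, neg_mul_neg]
    exact mem_unitaryGroup_iff.1 V.2
  -- `diag(r V, 1)` is a convex combination of the unitary matrices `diag(V, 1)` and `diag(-V, 1)`,
  -- so its operator norm is at most `1`.
  have hc : border ((r : ℂ) • (V : Matrix (Fin N) (Fin N) ℂ)) =
      (((1 + r) / 2 : ℝ) : ℂ) • border (V : Matrix (Fin N) (Fin N) ℂ) +
      (((1 - r) / 2 : ℝ) : ℂ) • border (-(V : Matrix (Fin N) (Fin N) ℂ)) := by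
    apply blocks_injective
    rw [show ∀ (a b : ℂ) (A B : Matrix (Fin (N + 1)) (Fin (N + 1)) ℂ), blocks (a • A + b • B) =
      a • blocks A + b • blocks B from fun _ _ _ _ => rfl, blocks_border, blocks_border,
      blocks_border, fromBlocks_smul, fromBlocks_smul, fromBlocks_add]
    congr 1
    · rw [smul_neg, ← sub_eq_add_neg, ← sub_smul]; congr 1; push_cast; ring
    · simp
    · simp
    · rw [← add_smul, ← Complex.ofReal_add]; ring_nf; simp
  have hn : ‖border ((r : ℂ) • (V : Matrix (Fin N) (Fin N) ℂ))‖ ≤ 1 := by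
    rw [hc]
    refine (norm_add_le _ _).trans ?_
    rw [norm_smul, norm_smul, Complex.norm_real, Complex.norm_real, Real.norm_of_nonneg,
      Real.norm_of_nonneg]
    · have h1 := hu _ (border_mem_unitary V.2)
      have h2 := hu _ (border_mem_unitary hneg)
      have h3 := mul_le_mul_of_nonneg_left h1 (show 0 ≤ (1 + r) / 2 by linarith [hr.1])
      have h4 := mul_le_mul_of_nonneg_left h2 (show 0 ≤ (1 - r) / 2 by linarith [hr.2])
      linarith
    · linarith [hr.2]
    · linarith [hr.1]
  have hlt : ‖(z : ℂ) • ((M : Matrix (Fin (N + 1)) (Fin (N + 1)) ℂ) *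
      border ((r : ℂ) • (V : Matrix (Fin N) (Fin N) ℂ)))‖ < 1 := by
    rw [norm_smul, Complex.norm_real, Real.norm_of_nonneg hz.1]
    have h1 := (norm_mul_le (M : Matrix (Fin (N + 1)) (Fin (N + 1)) ℂ)
      (border ((r : ℂ) • (V : Matrix (Fin N) (Fin N) ℂ)))).trans
      (mul_le_one₀ (hu _ M.2) (norm_nonneg _) hn)
    nlinarith [mul_le_mul_of_nonneg_left h1 hz.1, hz.2]
  have := isUnit_one_sub_of_norm_lt_one hlt
  rw [Matrix.isUnit_iff_isUnit_det] at this
  exact this.ne_zero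

/-! ### Matching the branches of the logarithm -/

theorem eq_of_exp_eq {f g : ℝ → ℂ} (hf : Continuous f) (hg : Continuous g)
    (h : ∀ x, Complex.exp (f x) = Complex.exp (g x)) {a : ℝ} (ha : f a = g a) (x : ℝ) :
    f x = g x :=
  congrFun (Complex.isCoveringMap_exp.eq_of_comp_eq hf hg
    (funext fun x => Subtype.ext (h x)) a ha) x

/-- Truncation of a real number to `[0, 1]`. -/
def clamp (x : ℝ) : ℝ := max 0 (min x 1)

@[fun_prop]
theorem continuous_clamp : Continuous clamp := by unfold clamp; fun_prop

theorem clamp_mem (x : ℝ) : clamp x ∈ Set.Icc (0 : ℝ) 1 :=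
  ⟨le_max_left _ _, max_le zero_le_one (min_le_right _ _)⟩

@[simp] theorem clamp_zero : clamp 0 = 0 := by simp [clamp]

@[simp] theorem clamp_one : clamp 1 = 1 := by simp [clamp]

theorem re_lt_one_of_norm_le_one {w : ℂ} (hw : ‖w‖ ≤ 1) (h : w ≠ 1) : w.re < 1 := by
  rcases lt_or_eq_of_le ((Complex.re_le_norm w).trans hw) with h1 | h1
  · exact h1
  · exfalso
    have h2 : w.re ^ 2 + w.im ^ 2 ≤ 1 := by
      have := Complex.sq_norm w
      rw [Complex.normSq_apply] at this
      nlinarith [norm_nonneg w]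
    rw [h1] at h2
    exact h (Complex.ext h1 (by simpa using show w.im = 0 by nlinarith [sq_nonneg w.im]))

theorem one_sub_ofReal_mul_re_pos {w : ℂ} (hw : ‖w‖ ≤ 1) (h : w ≠ 1) {t : ℝ}
    (ht : t ∈ Set.Icc (0 : ℝ) 1) : 0 < (1 - t * w).re := by
  have := re_lt_one_of_norm_le_one hw h
  simp only [Complex.sub_re, Complex.one_re, Complex.re_ofReal_mul]
  rcases le_or_gt w.re 0 with h1 | h1
  · nlinarith [ht.1]
  · nlinarith [ht.2]

theorem one_sub_ofReal_mul_ne_zero {w : ℂ} (hw : ‖w‖ ≤ 1) (h : w ≠ 1) {t : ℝ}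
    (ht : t ∈ Set.Icc (0 : ℝ) 1) : 1 - t * w ≠ 0 := fun h0 => by
  have := one_sub_ofReal_mul_re_pos hw h ht
  rw [h0] at this
  simp at this

theorem continuous_log_one_sub_clamp_mul {w : ℂ} (hw : ‖w‖ ≤ 1) (h : w ≠ 1) :
    Continuous fun t : ℝ => Complex.log (1 - clamp t * w) := by
  refine Continuous.clog (by fun_prop) fun t => Or.inl ?_
  exact one_sub_ofReal_mul_re_pos hw h (clamp_mem t)

theorem logP_zero_eq_sum {N : ℕ} (A : U N) :
    logP A 0 = ∑ j, Complex.log (1 - eigenvalue A j) := by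
  rw [logP_eq_sum]; simp

theorem det_one_sub_eq_prod {N : ℕ} (A : U N) :
    (1 - (A : Matrix (Fin N) (Fin N) ℂ)).det = ∏ j, (1 - eigenvalue A j) := by
  simpa using det_one_sub_smul A 1

theorem eigenvalue_ne_one {N : ℕ} {A : U N} (h : (1 - (A : Matrix (Fin N) (Fin N) ℂ)).det ≠ 0)
    (j : Fin N) : eigenvalue A j ≠ 1 := by
  rw [det_one_sub_eq_prod, Finset.prod_ne_zero_iff] at h
  exact fun h1 => h j (Finset.mem_univ _) (by rw [h1, sub_self])

theorem exp_sum_log_clamp {N : ℕ} {A : U N} (h : (1 - (A : Matrix (Fin N) (Fin N) ℂ)).det ≠ 0)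
    (t : ℝ) : Complex.exp (∑ j, Complex.log (1 - clamp t * eigenvalue A j)) =
      (1 - (clamp t : ℂ) • (A : Matrix (Fin N) (Fin N) ℂ)).det := by
  rw [Complex.exp_sum, det_one_sub_smul]
  exact Finset.prod_congr rfl fun j _ => Complex.exp_log
    (one_sub_ofReal_mul_ne_zero (norm_eigenvalue A j).le (eigenvalue_ne_one h j) (clamp_mem t))

theorem continuous_sum_log_clamp {N : ℕ} {A : U N}
    (h : (1 - (A : Matrix (Fin N) (Fin N) ℂ)).det ≠ 0) :
    Continuous fun t : ℝ => ∑ j, Complex.log (1 - clamp t * eigenvalue A j) :=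
  continuous_finsetSum _ fun j _ =>
    continuous_log_one_sub_clamp_mul (norm_eigenvalue A j).le (eigenvalue_ne_one h j)

@[fun_prop]
theorem continuous_border {N : ℕ} : Continuous (border (N := N)) :=
  Continuous.matrix_submatrix (Continuous.matrix_fromBlocks (by fun_prop) (by fun_prop)
    (by fun_prop) (by fun_prop)) _ _

/-- The determinant factorization determines the logarithms only modulo `2πi`. To fix the branch, `D
(z, r) = det (1 - z M diag(r V, 1))` is nonzero on the unit square and so has a continuous logarithm
`H` with `H (0, 0) = 0`. The path to `(1, 1)` through `(0, 1)` yields the left side. The path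
through `(1, 0)` yields `Log (1 - α)` on its first edge and adds `log P_N` on its second. Clamping
the parameters makes the domain the simply connected plane. -/
theorem logP_mul_emb {N : ℕ} (M : U (N + 1)) (h : corner M ≠ 1) (V : U N)
    (hV : (1 - ((transfer M h * V : U N) : Matrix (Fin N) (Fin N) ℂ)).det ≠ 0) :
    logP (M * emb V) 0 = Complex.log (1 - corner M) + logP (transfer M h * V) 0 := by
  set W := transfer M h * V with hW
  set D : ℝ × ℝ → ℂ := fun p => (1 - (clamp p.1 : ℂ) •
    ((M : Matrix (Fin (N + 1)) (Fin (N + 1)) ℂ) *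
      border ((clamp p.2 : ℂ) • (V : Matrix (Fin N) (Fin N) ℂ)))).det with hD
  have hcorner : ∀ t, 1 - (clamp t : ℂ) * corner M ≠ 0 := fun t =>
    one_sub_ofReal_mul_ne_zero (norm_corner_le M) h (clamp_mem t)
  have hD1 : ∀ r, D (1, r) = (1 - corner M) *
      (1 - (clamp r : ℂ) • (W : Matrix (Fin N) (Fin N) ℂ)).det := by
    intro r
    simp only [hD, clamp_one, Complex.ofReal_one, one_smul]
    rw [det_one_sub_mul_border M h, Matrix.mul_smul]
    rfl
  have hD0 : ∀ z, D (z, 0) = 1 - (clamp z : ℂ) * corner M := by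
    intro z
    simp only [hD, clamp_zero, Complex.ofReal_zero, zero_smul]
    exact det_one_sub_smul_mul_border_zero M _ (hcorner z)
  have hDz : ∀ z, D (z, 1) = (1 - (clamp z : ℂ) •
      ((M * emb V : U (N + 1)) : Matrix (Fin (N + 1)) (Fin (N + 1)) ℂ)).det := by
    intro z
    simp only [hD, clamp_one, Complex.ofReal_one, one_smul]
    rfl
  have hDr : ∀ r, D (0, r) = 1 := fun r => by simp [hD]
  have h1c : (1 - corner M) ≠ 0 := sub_ne_zero.2 (Ne.symm h)
  -- For `z < 1` this is the contraction bound. On the edge `z = 1` the determinant factors, and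
  -- `hV` excludes the eigenvalue `1` of `W`.
  have hDne : ∀ p, D p ≠ 0 := by
    rintro ⟨z, r⟩
    rcases (clamp_mem z).2.lt_or_eq with hz | hz
    · exact det_one_sub_smul_mul_border_ne_zero M V ⟨(clamp_mem z).1, hz⟩ (clamp_mem r)
    · have : D (z, r) = D (1, r) := by simp only [hD, hz, clamp_one]
      rw [this, hD1, ← exp_sum_log_clamp hV]
      exact mul_ne_zero h1c (Complex.exp_ne_zero _)
  have hDc : Continuous D := by
    refine Continuous.matrix_det ?_
    fun_prop
  obtain ⟨H0, hH0c, hH0⟩ := Complex.exists_continuousOn_eqOn_exp_comp (X := ℝ × ℝ) (U := Set.univ)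
    (show SimplyConnectedSpace (Set.univ : Set (ℝ × ℝ)) from
      have := (convex_univ (𝕜 := ℝ) (E := ℝ × ℝ)).contractibleSpace Set.univ_nonempty
      inferInstance) isOpen_univ hDc.continuousOn
    (by rintro ⟨p, -, hp⟩; exact hDne p hp)
  have hH0' : ∀ p, Complex.exp (H0 p) = D p := fun p => hH0 (Set.mem_univ p)
  have hH0c' : Continuous H0 := continuousOn_univ.1 hH0c
  obtain ⟨H, hHc, hH, hH00⟩ : ∃ H : ℝ × ℝ → ℂ, Continuous H ∧ (∀ p, Complex.exp (H p) = D p) ∧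
      H (0, 0) = 0 := by
    refine ⟨fun p => H0 p - H0 (0, 0), by fun_prop, fun p => ?_, sub_self _⟩
    rw [Complex.exp_sub, hH0', hH0', hDr, div_one]
  have hdetA : (1 - ((M * emb V : U (N + 1)) :
      Matrix (Fin (N + 1)) (Fin (N + 1)) ℂ)).det ≠ 0 := by
    have := hDz 1
    rw [clamp_one, Complex.ofReal_one, one_smul] at this
    rw [← this]
    exact hDne _
  have e1 : ∀ r, H (0, r) = 0 := eq_of_exp_eq (g := fun _ => 0) (by fun_prop) continuous_const
    (fun r => by rw [hH, hDr, Complex.exp_zero]) hH00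
  have e2 := eq_of_exp_eq (f := fun z => H (z, 1)) (by fun_prop) (continuous_sum_log_clamp hdetA)
    (fun z => by rw [hH, hDz, exp_sum_log_clamp hdetA]) (a := 0) (by simp [e1]) 1
  have e3 := eq_of_exp_eq (f := fun z => H (z, 0)) (by fun_prop)
    (continuous_log_one_sub_clamp_mul (norm_corner_le M) h)
    (fun z => by rw [hH, hD0, Complex.exp_log (hcorner z)]) (a := 0) (by simp [e1]) 1
  have e4 := eq_of_exp_eq (f := fun r => H (1, r))
    (g := fun r => Complex.log (1 - corner M) + ∑ j, Complex.log (1 - clamp r * eigenvalue W j))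
    (by fun_prop) (continuous_const.add (continuous_sum_log_clamp hV))
    (fun r => by rw [hH, hD1, Complex.exp_add, Complex.exp_log h1c, exp_sum_log_clamp hV])
    (a := 0) (by simpa using e3) 1
  simp only [clamp_one, Complex.ofReal_one, one_mul] at e2 e4
  rw [logP_zero_eq_sum, logP_zero_eq_sum, ← e2, ← e4]

/-! ### Null sets and the recursion in law -/

/-- Fubini on `[0, 1] × U(N)`: every slice in `φ` is countable, hence null, while every slice in `A`
has measure `haar N S` by invariance. -/
theorem haar_eq_zero_of_rot {N : ℕ} {S : Set (U N)} (hS : MeasurableSet S)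
    (h : ∀ A, {φ : ℝ | rot N φ * A ∈ S}.Countable) : haar N S = 0 := by
  set ν : Measure ℝ := volume.restrict (Set.Icc (0 : ℝ) 1) with hν
  have hm : MeasurableSet {p : ℝ × U N | rot N p.1 * p.2 ∈ S} := by
    have : Measurable fun p : ℝ × U N => rot N p.1 * p.2 := by
      apply Continuous.measurable; fun_prop
    exact this hS
  have h1 : ν.prod (haar N) {p : ℝ × U N | rot N p.1 * p.2 ∈ S} = 0 := by
    rw [Measure.prod_apply_symm hm, lintegral_eq_zero_iff (measurable_measure_prodMk_right hm)]
    refine Filter.Eventually.of_forall fun A => ?_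
    exact (h A).measure_zero ν
  rw [Measure.prod_apply hm] at h1
  have h2 : ∀ φ : ℝ, haar N (Prod.mk φ ⁻¹' {p : ℝ × U N | rot N p.1 * p.2 ∈ S}) = haar N S :=
    fun φ => measure_preimage_mul (haar N) (rot N φ) S
  simp_rw [h2] at h1
  simpa [hν] using h1

theorem measurableSet_det_eq_zero (N : ℕ) :
    MeasurableSet {A : U N | (1 - (A : Matrix (Fin N) (Fin N) ℂ)).det = 0} := by
  refine IsClosed.measurableSet (isClosed_eq (Continuous.matrix_det ?_) continuous_const)
  fun_prop

theorem ae_det_ne_zero (N : ℕ) :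
    ∀ᵐ A : U N ∂haar N, (1 - (A : Matrix (Fin N) (Fin N) ℂ)).det ≠ 0 := by
  have h : haar N {A : U N | (1 - (A : Matrix (Fin N) (Fin N) ℂ)).det = 0} = 0 := by
    refine haar_eq_zero_of_rot (measurableSet_det_eq_zero N) fun A => ?_
    have : {φ : ℝ | rot N φ * A ∈
        {A : U N | (1 - (A : Matrix (Fin N) (Fin N) ℂ)).det = 0}} ⊆ ⋃ j : Fin N, ⋃ k : ℤ, {eigenangle A j + k * (2 * π)} := by
      intro φ hφ
      have hφ' : (1 - ((rot N φ * A : U N) : Matrix (Fin N) (Fin N) ℂ)).det = 0 := hφ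
      rw [coe_rot_mul, det_one_sub_smul, Finset.prod_eq_zero_iff] at hφ'
      obtain ⟨j, -, hj⟩ := hφ'
      rw [eigenvalue, ← Complex.exp_add, sub_eq_zero, eq_comm, Complex.exp_eq_one_iff] at hj
      obtain ⟨k, hk⟩ := hj
      refine Set.mem_iUnion.2 ⟨j, Set.mem_iUnion.2 ⟨k, ?_⟩⟩
      have : ((φ - eigenangle A j : ℝ) : ℂ) = ((k * (2 * π) : ℝ) : ℂ) := by
        apply mul_left_cancel₀ Complex.I_ne_zero
        push_cast
        linear_combination hk
      have := Complex.ofReal_injective this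
      rw [Set.mem_singleton_iff]
      linarith
    exact (Set.countable_iUnion fun j => Set.countable_iUnion fun k =>
      Set.countable_singleton _).mono this
  simpa [ae_iff] using h

theorem measurePreserving_mul_emb (N : ℕ) :
    MeasurePreserving (fun p : U (N + 1) × U N => p.1 * emb p.2)
      ((haar (N + 1)).prod (haar N)) (haar (N + 1)) := by
  have hm : Measurable (fun p : U (N + 1) × U N => p.1 * emb p.2) := by
    apply Continuous.measurable; fun_prop
  refine ⟨hm, Measure.ext fun S hS => ?_⟩
  rw [Measure.map_apply hm hS, Measure.prod_apply_symm (hm hS)]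
  have : ∀ V : U N, haar (N + 1) ((fun M => (M, V)) ⁻¹'
      ((fun p : U (N + 1) × U N => p.1 * emb p.2) ⁻¹' S)) = haar (N + 1) S :=
    fun V => measure_preimage_mul_right (haar (N + 1)) (emb V) S
  simp [this]

theorem sum_normSq_row {N : ℕ} (M : U N) (i : Fin N) :
    ∑ j, ‖(M : Matrix (Fin N) (Fin N) ℂ) i j‖ ^ 2 = 1 := by
  have h := congrFun (congrFun (mem_unitaryGroup_iff.1 M.2) i) i
  rw [Matrix.mul_apply, Matrix.one_apply_eq] at h
  have h2 : ∀ j, (M : Matrix (Fin N) (Fin N) ℂ) i j *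
      (star (M : Matrix (Fin N) (Fin N) ℂ)) j i =
        ((‖(M : Matrix (Fin N) (Fin N) ℂ) i j‖ ^ 2 : ℝ) : ℂ) := by
    intro j
    rw [star_apply, Complex.star_def, Complex.mul_conj, Complex.normSq_eq_norm_sq]
  simp_rw [h2] at h
  exact_mod_cast h

/-- Rows have length one, so a corner entry `1` makes the last row of `1 - M` vanish, and `det (1 -
M) = 0` is a null event. -/
theorem ae_corner_ne_one (N : ℕ) : ∀ᵐ M : U (N + 1) ∂haar (N + 1), corner M ≠ 1 := by
  filter_upwards [ae_det_ne_zero (N + 1)] with M hM hc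
  refine hM (det_eq_zero_of_row_eq_zero (Fin.last N) fun j => ?_)
  rcases eq_or_ne j (Fin.last N) with rfl | hj
  · rw [Matrix.sub_apply, one_apply_eq, sub_eq_zero]; exact hc.symm
  · have h1 := sum_normSq_row M (Fin.last N)
    rw [Fin.sum_univ_castSucc, show (M : Matrix (Fin (N + 1)) (Fin (N + 1)) ℂ) (Fin.last N)
      (Fin.last N) = 1 from hc] at h1
    have h2 : ∑ i : Fin N, ‖(M : Matrix (Fin (N + 1)) (Fin (N + 1)) ℂ)
      (Fin.last N) i.castSucc‖ ^ 2 = 0 := by simpa using h1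
    rw [Finset.sum_eq_zero_iff_of_nonneg fun _ _ => sq_nonneg _] at h2
    obtain ⟨i, rfl⟩ := Fin.exists_castSucc_eq.2 hj
    have := h2 i (Finset.mem_univ _)
    rw [Matrix.sub_apply, one_apply_ne hj.symm, zero_sub, neg_eq_zero]
    simpa using this

theorem measurable_logP_zero (N : ℕ) : Measurable fun A : U N => logP A 0 := by
  unfold logP
  fun_prop

theorem measurable_corner (N : ℕ) : Measurable (corner (N := N)) := by
  exact (continuous_coe.matrix_elem _ _).measurable

/-- Applied with `T` the left multiplication by the transfer matrix of `M`: it depends on the first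
coordinate, but Haar measure in the second coordinate does not see it. Only fixed fibres are used,
so measurability of `T` in `a` is not needed. -/
theorem map_prod_eq_of_fiberwise {α β γ : Type*} [MeasurableSpace α] [MeasurableSpace β]
    [MeasurableSpace γ] {μ : Measure α} {ν : Measure β} [SFinite ν] {F G : α × β → γ}
    (hF : Measurable F) (hG : Measurable G)
    (h : ∀ᵐ a ∂μ, ∃ T : β → β, MeasurePreserving T ν ν ∧ ∀ᵐ b ∂ν, F (a, b) = G (a, T b)) :
    (μ.prod ν).map F = (μ.prod ν).map G := by
  refine Measure.ext fun S hS => ?_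
  rw [Measure.map_apply hF hS, Measure.map_apply hG hS, Measure.prod_apply (hF hS),
    Measure.prod_apply (hG hS)]
  refine lintegral_congr_ae ?_
  filter_upwards [h] with a ⟨T, hT, hab⟩
  have hm : MeasurableSet (Prod.mk a ⁻¹' (G ⁻¹' S)) := measurable_prodMk_left (hG hS)
  rw [← hT.measure_preimage hm.nullMeasurableSet]
  refine measure_congr ?_
  filter_upwards [hab] with b hb
  exact propext (iff_of_eq (congrArg (· ∈ S) hb))

/-- In law, `log P_{N+1}(A, 0)` is the sum of `Log (1 - α)`, with `α` a matrix entry of a Haar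
unitary matrix, and an independent copy of `log P_N(A, 0)`. -/
theorem map_logP_succ (N : ℕ) :
    (haar (N + 1)).map (fun A : U (N + 1) => logP A 0) = ((haar (N + 1)).prod (haar N)).map
      (fun p : U (N + 1) × U N => Complex.log (1 - corner p.1) + logP p.2 0) := by
  have hF := measurable_logP_zero (N + 1)
  have hG : Measurable fun p : U (N + 1) × U N => Complex.log (1 - corner p.1) + logP p.2 0 := by
    have h1 := measurable_logP_zero N
    have h2 := measurable_corner N
    fun_prop
  have hE := measurePreserving_mul_emb N
  conv_lhs => rw [← hE.map_eq]
  rw [Measure.map_map hF hE.measurable]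
  refine map_prod_eq_of_fiberwise (hF.comp hE.measurable) hG ?_
  filter_upwards [ae_corner_ne_one N] with M hM
  have hT := measurePreserving_mul_left (haar N) (transfer M hM)
  refine ⟨_, hT, ?_⟩
  filter_upwards [hT.quasiMeasurePreserving.ae (ae_det_ne_zero N)] with V hV
  exact logP_mul_emb M hM V hV

/-! ### Almost sure simplicity of the spectrum -/

/-- The unitary matrices having an eigenvector annihilated by the linear form `w`. -/
def eigenvectorIn {N : ℕ} (w : Fin N → ℂ) : Set (U N) :=
  {A | ∃ p : Metric.sphere (0 : Fin N → ℂ) 1 × Metric.sphere (0 : ℂ) 1,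
    (A : Matrix (Fin N) (Fin N) ℂ) *ᵥ p.1 = (p.2 : ℂ) • (p.1 : Fin N → ℂ) ∧
      w ⬝ᵥ (p.1 : Fin N → ℂ) = 0}

theorem mem_eigenvectorIn {N : ℕ} {w : Fin N → ℂ} {A : U N} {y : Fin N → ℂ} (hy : y ≠ 0) {c : ℂ}
    (hc : ‖c‖ = 1) (h : (A : Matrix (Fin N) (Fin N) ℂ) *ᵥ y = c • y) (hw : w ⬝ᵥ y = 0) :
    A ∈ eigenvectorIn w := by
  have hn : ‖y‖ ≠ 0 := norm_ne_zero_iff.2 hy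
  refine ⟨⟨⟨((‖y‖⁻¹ : ℝ) : ℂ) • y, ?_⟩, ⟨c, by simpa using hc⟩⟩, ?_, ?_⟩
  · rw [mem_sphere_zero_iff_norm, norm_smul]
    simp [hn]
  · simp only
    rw [mulVec_smul, h, smul_comm]
  · simp only
    rw [dotProduct_smul, hw, smul_zero]

theorem measurableSet_eigenvectorIn {N : ℕ} (w : Fin N → ℂ) :
    MeasurableSet (eigenvectorIn w) := by
  have : IsClosed {q : U N × (Metric.sphere (0 : Fin N → ℂ) 1 × Metric.sphere (0 : ℂ) 1) |
      (q.1 : Matrix (Fin N) (Fin N) ℂ) *ᵥ q.2.1 = (q.2.2 : ℂ) • (q.2.1 : Fin N → ℂ) ∧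
      w ⬝ᵥ (q.2.1 : Fin N → ℂ) = 0} := by
    refine IsClosed.inter (isClosed_eq ?_ (by fun_prop)) (isClosed_eq ?_ continuous_const)
    · exact Continuous.matrix_mulVec (by fun_prop) (by fun_prop)
    · exact Continuous.dotProduct (by fun_prop) (by fun_prop)
  convert (isClosedMap_fst_of_compactSpace _ this).measurableSet using 1
  ext A
  simp [eigenvectorIn]

theorem exists_unitary_col {N : ℕ} (w : Fin (N + 1) → ℂ) (hw : w ≠ 0) :
    ∃ (G : U (N + 1)) (c : ℂ), c ≠ 0 ∧
      ∀ i, w i = c * (G : Matrix (Fin (N + 1)) (Fin (N + 1)) ℂ) i (Fin.last N) := by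
  set v : EuclideanSpace ℂ (Fin (N + 1)) := WithLp.toLp 2 w with hv
  have hv0 : ‖v‖ ≠ 0 := by
    rw [norm_ne_zero_iff]
    intro h
    exact hw (by simpa [hv] using h)
  have ho : Orthonormal ℂ (({Fin.last N} : Set (Fin (N + 1))).domRestrict
      fun _ : Fin (N + 1) => ((‖v‖⁻¹ : ℝ) : ℂ) • v) := by
    refine ⟨fun i => ?_, fun i j hij => (hij (Subsingleton.elim _ _)).elim⟩
    change ‖((‖v‖⁻¹ : ℝ) : ℂ) • v‖ = 1
    rw [norm_smul, Complex.norm_real, norm_inv, norm_norm, inv_mul_cancel₀ hv0]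
  obtain ⟨b, hb⟩ := ho.exists_orthonormalBasis_extension_of_card_eq (by simp)
  refine ⟨⟨_, OrthonormalBasis.toMatrix_orthonormalBasis_mem_unitary
    (EuclideanSpace.basisFun (Fin (N + 1)) ℂ) b⟩, ((‖v‖ : ℝ) : ℂ), by exact_mod_cast hv0,
      fun i => ?_⟩
  simp only [Module.Basis.toMatrix_apply, hb (Fin.last N) rfl]
  have : w i = ((‖v‖ : ℝ) : ℂ) * (((‖v‖⁻¹ : ℝ) : ℂ) * w i) := by
    rw [← mul_assoc, ← Complex.ofReal_mul, mul_inv_cancel₀ hv0, Complex.ofReal_one, one_mul]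
  exact this

theorem exists_unitary_row {N : ℕ} (w : Fin (N + 1) → ℂ) (hw : w ≠ 0) :
    ∃ (K : U (N + 1)) (c : ℂ), c ≠ 0 ∧
      ∀ i, w i = c * (K : Matrix (Fin (N + 1)) (Fin (N + 1)) ℂ) (Fin.last N) i := by
  obtain ⟨G, c, hc, h⟩ := exists_unitary_col (star w) (star_ne_zero.2 hw)
  refine ⟨G⁻¹, star c, star_ne_zero.2 hc, fun i => ?_⟩
  have := congrArg star (h i)
  rw [Pi.star_apply, star_star, star_mul'] at this
  exact this

/-- The matrices whose last row vanishes off the diagonal form a null set. -/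
theorem ae_lastRow_ne_zero (n : ℕ) : ∀ᵐ M : U (n + 2) ∂haar (n + 2),
    (fun j : Fin (n + 1) => (M : Matrix (Fin (n + 2)) (Fin (n + 2)) ℂ)
      (Fin.last (n + 1)) j.castSucc) ≠ 0 := by
  set S : Set (U (n + 2)) := {M | ∀ j : Fin (n + 1),
    (M : Matrix (Fin (n + 2)) (Fin (n + 2)) ℂ) (Fin.last (n + 1)) j.castSucc = 0} with hS
  have hSm : MeasurableSet S := by
    rw [hS, Set.ofPred_forall]
    exact MeasurableSet.iInter fun j =>
      (isClosed_eq (continuous_coe.matrix_elem _ _) continuous_const).measurableSet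
  -- The vectors `(t, 0, …, 0, 1)` are pairwise non-proportional. The translate `F t` of `S`
  -- consists of matrices whose last row is proportional to `w t`, so these translates are
  -- infinitely many disjoint sets of equal measure in a probability space.
  set w : ℕ → Fin (n + 2) → ℂ := fun t => Fin.snoc (Pi.single 0 (t : ℂ)) 1 with hw
  have hwl : ∀ t, w t (Fin.last (n + 1)) = 1 := fun t => by simp [hw]
  have hw0 : ∀ t, w t (Fin.castSucc 0) = t := fun t => by
    simp only [hw, Fin.snoc_castSucc, Pi.single_eq_same]
  choose K c hc hK using fun t => exists_unitary_row (w t)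
    (fun h => by simpa [hwl] using congrFun h (Fin.last (n + 1)))
  set F : ℕ → Set (U (n + 2)) := fun t => (· * (K t)⁻¹) ⁻¹' S with hF
  have hFm : ∀ t, MeasurableSet (F t) := fun t => (measurable_mul_const _) hSm
  have key : ∀ t, ∀ M ∈ F t, ∃ d : ℂ, d ≠ 0 ∧ ∀ i,
      (M : Matrix (Fin (n + 2)) (Fin (n + 2)) ℂ) (Fin.last (n + 1)) i = d * w t i := by
    intro t M hM
    have hM' : ∀ j : Fin (n + 1), ((M * (K t)⁻¹ : U (n + 2)) : Matrix (Fin (n + 2))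
      (Fin (n + 2)) ℂ) (Fin.last (n + 1)) j.castSucc = 0 := hM
    have e : ∀ i, (M : Matrix (Fin (n + 2)) (Fin (n + 2)) ℂ) (Fin.last (n + 1)) i =
        corner (M * (K t)⁻¹) * (c t)⁻¹ * w t i := by
      intro i
      have : (M : Matrix (Fin (n + 2)) (Fin (n + 2)) ℂ) =
          ((M * (K t)⁻¹ : U (n + 2)) : Matrix (Fin (n + 2)) (Fin (n + 2)) ℂ) * K t := by
        rw [← Submonoid.coe_mul, inv_mul_cancel_right]
      conv_lhs => rw [this, Matrix.mul_apply, Fin.sum_univ_castSucc]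
      simp only [hM', zero_mul, Finset.sum_const_zero, zero_add]
      rw [hK t i, mul_assoc, ← mul_assoc (c t)⁻¹, inv_mul_cancel₀ (hc t), one_mul]
      rfl
    refine ⟨_, fun h0 => ?_, e⟩
    have h1 := sum_normSq_row M (Fin.last (n + 1))
    simp [e, h0] at h1
  have hdisj : Pairwise (Function.onFun Disjoint F) := by
    intro s t hst
    refine Set.disjoint_left.2 fun M h1 h2 => hst ?_
    obtain ⟨d, hd, e⟩ := key s M h1
    obtain ⟨d', hd', e'⟩ := key t M h2
    have a1 := (e (Fin.last _)).symm.trans (e' (Fin.last _))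
    rw [hwl, hwl, mul_one, mul_one] at a1
    have a2 := (e (Fin.castSucc 0)).symm.trans (e' (Fin.castSucc 0))
    rw [hw0, hw0, a1] at a2
    exact_mod_cast mul_left_cancel₀ hd' a2
  have hFS : ∀ t, haar (n + 2) (F t) = haar (n + 2) S := fun t =>
    measure_preimage_mul_right _ _ _
  have h0 : haar (n + 2) S = 0 := by
    by_contra hne
    have := Measure.finite_const_le_meas_of_disjoint_iUnion (haar (n + 2))
      (pos_iff_ne_zero.2 hne) hFm hdisj (measure_ne_top _ _)
    simp only [hFS, le_refl, Set.ofPred_true] at this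
    exact Set.infinite_univ this
  rw [ae_iff]
  convert h0 using 2
  ext M
  simp [hS, funext_iff]

/-- In blocks, an eigenvector `(y', 0)` of `M diag(V, 1)` satisfies `D V y' = c y'` and `b V y' =
0`. The feedback term of the transfer matrix `W` then vanishes, so `W V y' = c y'`; and `b V y' = c
b W⁻¹ y'`, so the form `b W⁻¹` annihilates `y'`. -/
theorem mem_eigenvectorIn_of_mul_emb {N : ℕ} (M : U (N + 1)) (h : corner M ≠ 1) (V : U N)
    (hA : M * emb V ∈ eigenvectorIn (Pi.single (Fin.last N) 1)) :
    transfer M h * V ∈ eigenvectorIn ((fun j : Fin N =>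
      (M : Matrix (Fin (N + 1)) (Fin (N + 1)) ℂ) (Fin.last N) j.castSucc) ᵥ*
        ((transfer M h)⁻¹ : U N)) := by
  obtain ⟨⟨⟨y, hy⟩, ⟨c, hc⟩⟩, h1, h2⟩ := hA
  simp only [single_one_dotProduct] at h1 h2
  rw [mem_sphere_zero_iff_norm] at hy hc
  set Mm := (M : Matrix (Fin (N + 1)) (Fin (N + 1)) ℂ)
  set Vm := (V : Matrix (Fin N) (Fin N) ℂ)
  set x : Fin N ⊕ Fin 1 → ℂ := y ∘ finSumFinEquiv with hx
  set y' : Fin N → ℂ := x ∘ Sum.inl with hy'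
  have hxr : x ∘ Sum.inr = 0 := by
    funext i
    rw [Subsingleton.elim i 0]
    exact h2
  have hy'0 : y' ≠ 0 := by
    intro h0
    have : y = 0 := by
      funext i
      obtain ⟨j, rfl⟩ := (finSumFinEquiv (m := N) (n := 1)).surjective i
      rcases j with j | j
      · exact congrFun h0 j
      · exact congrFun hxr j
    rw [this, norm_zero] at hy
    exact zero_ne_one hy
  have e0 : (blocks Mm * fromBlocks Vm 0 0 1) *ᵥ x = c • x := by
    rw [← blocks_border, ← blocks_mul]
    have := congrArg (· ∘ (finSumFinEquiv (m := N) (n := 1))) h1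
    refine Eq.trans ?_ this
    rw [blocks, submatrix_mulVec_equiv]
    simp only [hx, Function.comp_assoc, Equiv.self_comp_symm, Function.comp_id]
    rfl
  have e1 : blocks Mm *ᵥ Sum.elim (Vm *ᵥ y') 0 = c • x := by
    rw [← e0, ← mulVec_mulVec, fromBlocks_mulVec, hxr]
    simp [hy']
  rw [← fromBlocks_toBlocks (blocks Mm), fromBlocks_mulVec] at e1
  simp only [Sum.elim_comp_inl, Sum.elim_comp_inr, mulVec_zero, add_zero] at e1
  have e2 : (blocks Mm).toBlocks₁₁ *ᵥ (Vm *ᵥ y') = c • y' := by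
    have := congrArg (· ∘ Sum.inl) e1
    simp only [Sum.elim_comp_inl] at this
    exact this
  have e3 : (blocks Mm).toBlocks₂₁ *ᵥ (Vm *ᵥ y') = 0 := by
    have : (c • x) ∘ Sum.inr = 0 := by
      rw [show (c • x) ∘ Sum.inr = c • (x ∘ Sum.inr) from rfl, hxr, smul_zero]
    rw [← this, ← e1, Sum.elim_comp_inr]
  have e4 : ((transfer M h * V : U N) : Matrix (Fin N) (Fin N) ℂ) *ᵥ y' = c • y' := by
    rw [Submonoid.coe_mul, ← mulVec_mulVec]
    change transferMatrix (blocks Mm) *ᵥ (Vm *ᵥ y') = c • y'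
    rw [transferMatrix, add_mulVec, smul_mulVec, ← mulVec_mulVec, e2, e3, mulVec_zero,
      smul_zero, add_zero]
  refine mem_eigenvectorIn hy'0 hc e4 ?_
  have hc0 : c ≠ 0 := by rintro rfl; simp at hc
  refine (mul_eq_zero.1 (?_ : c * _ = 0)).resolve_left hc0
  rw [← smul_eq_mul, ← dotProduct_smul, ← e4, ← dotProduct_mulVec, mulVec_mulVec,
    ← Submonoid.coe_mul, inv_mul_cancel_left]
  exact congrFun e3 0

/-- Induction on the dimension. Conjugation by a unitary reduces `w` to the last coordinate form.
There, for almost every `M`, the fibre over `M` lies in a left translate of a set `eigenvectorIn v`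
with `v ≠ 0`, which is null in dimension one less. -/
theorem haar_eigenvectorIn {N : ℕ} (w : Fin N → ℂ) (hw : w ≠ 0) :
    haar N (eigenvectorIn w) = 0 := by
  induction N with
  | zero => exact absurd (Subsingleton.elim w 0) hw
  | succ N ih =>
    have hlast : haar (N + 1) (eigenvectorIn (Pi.single (Fin.last N) 1)) = 0 := by
      have hm := measurableSet_eigenvectorIn (Pi.single (Fin.last N) (1 : ℂ))
      have hE := measurePreserving_mul_emb N
      rw [← hE.measure_preimage hm.nullMeasurableSet]
      refine Measure.measure_prod_null_of_ae_null (hE.measurable hm) ?_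
      have hrow : ∀ᵐ M : U (N + 1) ∂haar (N + 1), N = 0 ∨
          (fun j : Fin N => (M : Matrix (Fin (N + 1)) (Fin (N + 1)) ℂ)
            (Fin.last N) j.castSucc) ≠ 0 := by
        rcases N with _ | n
        · exact Filter.Eventually.of_forall fun _ => Or.inl rfl
        · filter_upwards [ae_lastRow_ne_zero n] with M hM using Or.inr hM
      filter_upwards [ae_corner_ne_one N, hrow] with M hM hr
      set v := (fun j : Fin N => (M : Matrix (Fin (N + 1)) (Fin (N + 1)) ℂ) (Fin.last N)
        j.castSucc) ᵥ*
          (((transfer M hM)⁻¹ : U N) : Matrix (Fin N) (Fin N) ℂ) with hv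
      have hsub : Prod.mk M ⁻¹' ((fun p : U (N + 1) × U N => p.1 * emb p.2) ⁻¹'
          eigenvectorIn (Pi.single (Fin.last N) 1)) ⊆ (transfer M hM * ·) ⁻¹' eigenvectorIn v :=
        fun V hV => mem_eigenvectorIn_of_mul_emb M hM V hV
      have hv0 : haar N ((transfer M hM * ·) ⁻¹' eigenvectorIn v) = 0 := ?_
      · exact measure_mono_null hsub hv0
      rw [measure_preimage_mul]
      -- For `N = 0` the form on the fibre is zero, but there are no unit vectors and the set is
      -- empty.
      rcases hr with rfl | hr
      · refine measure_mono_null (t := ∅) ?_ measure_empty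
        rintro A ⟨⟨⟨y, hy⟩, -⟩, -⟩
        rw [Subsingleton.elim y 0, mem_sphere_zero_iff_norm, norm_zero] at hy
        exact zero_ne_one hy
      · refine ih _ fun h0 => hr ?_
        have := congrArg (· ᵥ* ((transfer M hM : U N) : Matrix (Fin N) (Fin N) ℂ)) h0
        simpa [hv, vecMul_vecMul, ← Submonoid.coe_mul] using this
    obtain ⟨K, c, hc, hK⟩ := exists_unitary_row w hw
    have hmp : MeasurePreserving (fun A => K * A * K⁻¹) (haar (N + 1)) (haar (N + 1)) :=
      (measurePreserving_mul_right (haar (N + 1)) K⁻¹).comp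
        (measurePreserving_mul_left (haar (N + 1)) K)
    refine measure_mono_null (t := (fun A => K * A * K⁻¹) ⁻¹'
      eigenvectorIn (Pi.single (Fin.last N) 1)) ?_ ?_
    · rintro A ⟨⟨⟨y, hy⟩, ⟨d, hd⟩⟩, h1, h2⟩
      rw [mem_sphere_zero_iff_norm] at hy hd
      refine mem_eigenvectorIn (y := (K : Matrix (Fin (N + 1)) (Fin (N + 1)) ℂ) *ᵥ y)
        (fun h0 => ?_) hd ?_ ?_
      · have := congrArg (((K⁻¹ : U (N + 1)) : Matrix (Fin (N + 1)) (Fin (N + 1)) ℂ) *ᵥ ·) h0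
        simp only [mulVec_mulVec, ← Submonoid.coe_mul, inv_mul_cancel, mulVec_zero] at this
        have hy0 : y = 0 := by simpa using this
        rw [hy0, norm_zero] at hy
        exact zero_ne_one hy
      · rw [mulVec_mulVec, ← Submonoid.coe_mul, inv_mul_cancel_right, Submonoid.coe_mul,
          ← mulVec_mulVec]
        simp only at h1
        rw [h1, mulVec_smul]
      · rw [single_one_dotProduct]
        refine (mul_eq_zero.1 (?_ : c * _ = 0)).resolve_left hc
        simp only at h2
        rw [← h2, mulVec, dotProduct, dotProduct, Finset.mul_sum]
        exact Finset.sum_congr rfl fun i _ => by rw [hK i, mul_assoc]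
    · rw [hmp.measure_preimage (measurableSet_eigenvectorIn _).nullMeasurableSet, hlast]

-- For normal `B`, `(Bᴴ * B)ᴴ * (Bᴴ * B) = (Bᴴ * Bᴴ) * (B * B)`, so `B * B` killing a vector forces
-- `Bᴴ * B`, and then `B`, to kill it. Powers are lowered one at a time.
open scoped ComplexOrder in
theorem mulVec_eq_of_pow_mulVec_eq_zero {n : Type*} [Fintype n] [DecidableEq n]
    {B : Matrix n n ℂ} (hB : Bᴴ * B = B * Bᴴ) {x : n → ℂ} {k : ℕ}
    (h : B ^ k *ᵥ x = 0) : B *ᵥ x = 0 := by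
  have two : ∀ z : n → ℂ, (B * B) *ᵥ z = 0 → B *ᵥ z = 0 := by
    intro z hz
    rw [← conjTranspose_mul_self_mulVec_eq_zero, ← conjTranspose_mul_self_mulVec_eq_zero]
    have : (Bᴴ * B)ᴴ * (Bᴴ * B) = (Bᴴ * Bᴴ) * (B * B) := by
      rw [conjTranspose_mul, conjTranspose_conjTranspose, Matrix.mul_assoc, ← Matrix.mul_assoc B,
        ← hB]
      simp only [Matrix.mul_assoc]
    rw [this, ← mulVec_mulVec, hz, mulVec_zero]
  induction k with
  | zero => rw [pow_zero, one_mulVec] at h; rw [h, mulVec_zero]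
  | succ k ih =>
    rcases k with _ | k
    · simpa using h
    · refine ih ?_
      rw [pow_succ', ← mulVec_mulVec]
      refine two _ ?_
      rw [mulVec_mulVec, Matrix.mul_assoc, ← pow_succ', ← pow_succ']
      exact h

/-- A repeated eigenvalue has a generalized eigenspace of dimension at least two, on which any
linear form has a nonzero kernel vector. Normality makes that vector a genuine eigenvector. -/
theorem mem_eigenvectorIn_of_not_injective {N : ℕ} (w : Fin N → ℂ) {A : U N}
    (hA : ¬ Function.Injective (eigenangle A)) : A ∈ eigenvectorIn w := by
  obtain ⟨i, j, hij, hne⟩ : ∃ i j, eigenangle A i = eigenangle A j ∧ i ≠ j := by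
    simpa [Function.Injective] using hA
  set Am := (A : Matrix (Fin N) (Fin N) ℂ) with hAm
  set c := eigenvalue A i with hc
  have hcj : eigenvalue A j = c := by rw [hc, eigenvalue, eigenvalue, hij]
  have hcount : 2 ≤ Am.charpoly.roots.count c := by
    rw [← map_eigenvalue, Multiset.count_map]
    have : ({i, j} : Finset (Fin N)) ⊆ Finset.univ.filter fun k => c = eigenvalue A k := by
      intro k hk
      rw [Finset.mem_insert, Finset.mem_singleton] at hk
      rcases hk with rfl | rfl <;> simp [hcj, hc]
    have := Finset.card_le_card this
    rw [Finset.card_pair hne] at this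
    exact this
  rw [Polynomial.count_roots, ← charpoly_toLin', ← LinearMap.finrank_maxGenEigenspace_eq] at hcount
  set E := Module.End.maxGenEigenspace (toLin' Am) c with hE
  set f : E →ₗ[ℂ] ℂ := (LinearMap.domRestrict (dotProductBilin ℂ ℂ w) E)
  have hf : LinearMap.ker f ≠ ⊥ := LinearMap.ker_ne_bot_of_finrank_lt (by
    rw [Module.finrank_self]; omega)
  obtain ⟨⟨y, hyE⟩, hyf, hy0⟩ := Submodule.exists_mem_ne_zero_of_ne_bot hf
  have hy : y ≠ 0 := fun h => hy0 (Subtype.ext h)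
  refine mem_eigenvectorIn hy (norm_eigenvalue A i) ?_ hyf
  rw [hE, Module.End.mem_maxGenEigenspace] at hyE
  obtain ⟨k, hk⟩ := hyE
  have hk' : (Am - c • 1) ^ k *ᵥ y = 0 := by
    have e : toLin' Am - c • (1 : Module.End ℂ (Fin N → ℂ)) = toLin' (Am - c • 1) := by
      simp [Module.End.one_eq_id]
    rw [e, ← toLin'_pow, toLin'_apply] at hk
    exact hk
  have hU1 : Amᴴ * Am = 1 := mem_unitaryGroup_iff'.1 A.2
  have hU2 : Am * Amᴴ = 1 := mem_unitaryGroup_iff.1 A.2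
  have hnormal : (Am - c • 1)ᴴ * (Am - c • 1) = (Am - c • 1) * (Am - c • 1)ᴴ := by
    rw [conjTranspose_sub, conjTranspose_smul, conjTranspose_one]
    simp only [Matrix.sub_mul, Matrix.mul_sub, hU1, hU2, Matrix.smul_mul, Matrix.mul_smul,
      Matrix.one_mul, Matrix.mul_one]
    module
  have := mulVec_eq_of_pow_mulVec_eq_zero hnormal hk'
  rw [sub_mulVec, smul_mulVec, one_mulVec, sub_eq_zero] at this
  exact this

theorem ae_injective_eigenangle (N : ℕ) :
    ∀ᵐ A : U N ∂haar N, Function.Injective (eigenangle A) := by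
  rcases N with _ | N
  · exact Filter.Eventually.of_forall fun A i => i.elim0
  · have h := haar_eigenvectorIn (N := N + 1) 1 one_ne_zero
    rw [ae_iff]
    exact measure_mono_null (fun A hA => mem_eigenvectorIn_of_not_injective 1 hA) h

/-! ### Moments of an entry of a Haar matrix -/

theorem integrable_of_continuous {N : ℕ} {E : Type*} [NormedAddCommGroup E]
    {F : U N → E} (hF : Continuous F) : Integrable F (haar N) :=
  hF.integrable_of_hasCompactSupport (HasCompactSupport.of_compactSpace F)

/-- The `j`-th entry of the last row. -/
def lastRow {N : ℕ} (j : Fin (N + 1)) (M : U (N + 1)) : ℂ :=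
  (M : Matrix (Fin (N + 1)) (Fin (N + 1)) ℂ) (Fin.last N) j

@[fun_prop]
theorem continuous_lastRow {N : ℕ} (j : Fin (N + 1)) : Continuous (lastRow j) :=
  continuous_coe.matrix_elem _ _

@[fun_prop]
theorem continuous_corner {N : ℕ} : Continuous (corner (N := N)) :=
  continuous_coe.matrix_elem _ _

/-- The law of the corner entry is that of `c⁻¹ ∑ w_j M_{last, j}` with `|c|` the norm of `w`. -/
theorem exists_integral_corner_eq {N : ℕ} (w : Fin (N + 1) → ℂ) (hw : w ≠ 0) :
    ∃ c : ℂ, c ≠ 0 ∧ ‖c‖ ^ 2 = ∑ i, ‖w i‖ ^ 2 ∧ ∀ F : ℂ → ℝ,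
      ∫ M, F (corner M) ∂haar (N + 1) = ∫ M, F (c⁻¹ * ∑ j, w j * lastRow j M) ∂haar (N + 1) := by
  obtain ⟨G, c, hc, h⟩ := exists_unitary_col w hw
  refine ⟨c, hc, ?_, fun F => ?_⟩
  · have := sum_normSq_row G⁻¹ (Fin.last N)
    have e : ∀ i, ‖((G⁻¹ : U (N + 1)) : Matrix (Fin (N + 1)) (Fin (N + 1)) ℂ) (Fin.last N) i‖ =
        ‖(G : Matrix (Fin (N + 1)) (Fin (N + 1)) ℂ) i (Fin.last N)‖ := fun i => norm_star _
    simp_rw [e] at this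
    simp_rw [h, norm_mul, mul_pow]
    rw [← Finset.mul_sum, this, mul_one]
  · rw [← integral_mul_right_eq_self (fun M => F (corner M)) G]
    congr 1
    funext M
    congr 1
    rw [corner, Submonoid.coe_mul, Matrix.mul_apply, Finset.mul_sum]
    refine Finset.sum_congr rfl fun j _ => ?_
    rw [h j, lastRow]
    field_simp

theorem integral_lastRow_eq {N : ℕ} (j : Fin (N + 1)) (n : ℕ) :
    ∫ M, ‖lastRow j M‖ ^ n ∂haar (N + 1) = ∫ M, ‖corner M‖ ^ n ∂haar (N + 1) := by
  obtain ⟨c, hc, hn, h⟩ := exists_integral_corner_eq (Pi.single j (1 : ℂ)) (by simp)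
  have hn1 : ‖c‖ = 1 := by
    rw [Finset.sum_eq_single j] at hn
    · simpa [pow_eq_one_iff_of_nonneg] using hn
    · intro i _ hi; simp [Pi.single_eq_of_ne hi]
    · simp
  rw [h (fun z => ‖z‖ ^ n)]
  simp [Pi.single_apply, hn1]

theorem integral_norm_corner_sq (N : ℕ) :
    ∫ M, ‖corner M‖ ^ 2 ∂haar (N + 1) = 1 / (N + 1) := by
  have h : ∫ M : U (N + 1), ∑ j, ‖lastRow j M‖ ^ 2 ∂haar (N + 1) = 1 := by
    simp_rw [lastRow, sum_normSq_row]
    simp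
  rw [integral_finsetSum _ fun j _ => integrable_of_continuous (by fun_prop)] at h
  simp_rw [integral_lastRow_eq] at h
  simp only [Finset.sum_const, Finset.card_univ, Fintype.card_fin, nsmul_eq_mul] at h
  push_cast at h
  field_simp
  linarith

/-- With `β` another entry of the last row and `|ω| = 1`, `(α + ω β) / √2` has the law of `α`.
Averaging `|α + ω β| ^ 4` over the fourth roots of unity removes the mixed terms: `16 m = 8 m + 16 E
|α|² |β|²` for `m = E |α|⁴`. -/
theorem integral_norm_corner_pow_four_eq {N : ℕ} (j : Fin (N + 1)) (hj : j ≠ Fin.last N) :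
    ∫ M, ‖corner M‖ ^ 4 ∂haar (N + 1) =
      2 * ∫ M, ‖corner M‖ ^ 2 * ‖lastRow j M‖ ^ 2 ∂haar (N + 1) := by
  have key : ∀ ω : ℂ, ‖ω‖ = 1 → 4 * ∫ M, ‖corner M‖ ^ 4 ∂haar (N + 1) =
      ∫ M, ‖corner M + ω * lastRow j M‖ ^ 4 ∂haar (N + 1) := by
    intro ω hω
    set w : Fin (N + 1) → ℂ := Pi.single (Fin.last N) 1 + Pi.single j ω with hw
    have hwl : w (Fin.last N) = 1 := by simp [hw, hj.symm]
    obtain ⟨c, hc, hn, h⟩ := exists_integral_corner_eq w (fun h0 => by simp [h0] at hwl)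
    have hn2 : ‖c‖ ^ 2 = 2 := by
      rw [hn, Finset.sum_eq_add (Fin.last N) j hj.symm]
      · simp [hw, hj, hj.symm, hω]; norm_num
      · rintro i - ⟨h1, h2⟩; simp [hw, h1, h2]
      · simp
      · simp
    have hs : ∀ M : U (N + 1), ∑ i, w i * lastRow i M = corner M + ω * lastRow j M := by
      intro M
      simp [hw, Pi.single_apply, add_mul, Finset.sum_add_distrib]
      rfl
    rw [h (fun z => ‖z‖ ^ 4), ← integral_const_mul]
    simp_rw [hs, norm_mul, mul_pow, norm_inv, inv_pow]
    rw [show ‖c‖ ^ 4 = 4 by rw [show ‖c‖ ^ 4 = (‖c‖ ^ 2) ^ 2 by ring, hn2]; norm_num]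
    congr 1
    funext M
    ring
  have id4 : ∀ x y : ℂ, ‖x + 1 * y‖ ^ 4 + ‖x + (-1) * y‖ ^ 4 + ‖x + Complex.I * y‖ ^ 4 +
      ‖x + (-Complex.I) * y‖ ^ 4 = 4 * (‖x‖ ^ 4 + ‖y‖ ^ 4 + 4 * (‖x‖ ^ 2 * ‖y‖ ^ 2)) := by
    intro x y
    have h4 : ∀ z : ℂ, ‖z‖ ^ 4 = (z.re ^ 2 + z.im ^ 2) ^ 2 := fun z => by
      rw [show ‖z‖ ^ 4 = (‖z‖ ^ 2) ^ 2 by ring, Complex.sq_norm, Complex.normSq_apply]; ring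
    have h2 : ∀ z : ℂ, ‖z‖ ^ 2 = (z.re ^ 2 + z.im ^ 2) := fun z => by
      rw [Complex.sq_norm, Complex.normSq_apply]; ring
    simp only [h4, h2, Complex.add_re, Complex.add_im, Complex.mul_re, Complex.mul_im,
      Complex.one_re, Complex.one_im, Complex.neg_re, Complex.neg_im, Complex.I_re, Complex.I_im]
    ring
  have hI : ∀ ω : ℂ, Integrable (fun M : U (N + 1) => ‖corner M + ω * lastRow j M‖ ^ 4)
      (haar (N + 1)) := fun ω => integrable_of_continuous (by fun_prop)
  have hsum : 4 * (4 * ∫ M, ‖corner M‖ ^ 4 ∂haar (N + 1)) =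
      ∫ M, 4 * (‖corner M‖ ^ 4 + ‖lastRow j M‖ ^ 4 +
        4 * (‖corner M‖ ^ 2 * ‖lastRow j M‖ ^ 2)) ∂haar (N + 1) := by
    simp_rw [← id4]
    rw [integral_add (integrable_of_continuous (by fun_prop)) (hI (-Complex.I)),
      integral_add (integrable_of_continuous (by fun_prop)) (hI Complex.I),
      integral_add (hI 1) (hI (-1)), ← key 1 (by simp), ← key (-1) (by simp), ← key Complex.I (by simp),
      ← key (-Complex.I) (by simp)]
    ring
  rw [integral_const_mul, integral_add (integrable_of_continuous (by fun_prop))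
    (integrable_of_continuous (by fun_prop)), integral_add (integrable_of_continuous (by fun_prop))
    (integrable_of_continuous (by fun_prop)), integral_const_mul, integral_lastRow_eq j 4] at hsum
  linarith

/-- Multiplying the unit length of the last row by `|α|²` gives `m + N m / 2 = 1 / (N + 1)` for `m =
E |α|⁴`. -/
theorem integral_norm_corner_pow_four (N : ℕ) :
    ∫ M, ‖corner M‖ ^ 4 ∂haar (N + 1) = 2 / ((N + 1) * (N + 2)) := by
  have h : ∫ M : U (N + 1), ∑ j, ‖corner M‖ ^ 2 * ‖lastRow j M‖ ^ 2 ∂haar (N + 1) =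
      1 / (N + 1) := by
    simp_rw [← Finset.mul_sum, lastRow, sum_normSq_row, mul_one]
    exact integral_norm_corner_sq N
  rw [integral_finsetSum _ fun j _ => integrable_of_continuous (by fun_prop),
    Fin.sum_univ_castSucc] at h
  have h1 : ∀ j : Fin N, ∫ M, ‖corner M‖ ^ 2 * ‖lastRow j.castSucc M‖ ^ 2 ∂haar (N + 1) =
      (∫ M, ‖corner M‖ ^ 4 ∂haar (N + 1)) / 2 := fun j => by
    rw [integral_norm_corner_pow_four_eq j.castSucc (Fin.castSucc_lt_last j).ne]; ring
  have h2 : ∫ M, ‖corner M‖ ^ 2 * ‖lastRow (Fin.last N) M‖ ^ 2 ∂haar (N + 1) =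
      ∫ M, ‖corner M‖ ^ 4 ∂haar (N + 1) := by
    congr 1; funext M
    rw [show lastRow (Fin.last N) M = corner M from rfl]; ring
  rw [h2, Finset.sum_congr rfl fun j _ => h1 j] at h
  simp only [Finset.sum_const, Finset.card_univ, Fintype.card_fin, nsmul_eq_mul] at h
  field_simp at h ⊢
  linarith

theorem integral_corner_im_sq (N : ℕ) :
    ∫ M, (corner M).im ^ 2 ∂haar (N + 1) = 1 / (2 * (N + 1)) := by
  have h1 : ∫ M, (corner M).im ^ 2 ∂haar (N + 1) = ∫ M, (corner M).re ^ 2 ∂haar (N + 1) := by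
    rw [← integral_rot_mul (fun M => (corner M).im ^ 2) (π / 2)]
    congr 1; funext M
    have : corner (rot (N + 1) (π / 2) * M) = Complex.I * corner M := by
      rw [corner, coe_rot_mul, Matrix.smul_apply, smul_eq_mul, mul_comm Complex.I]
      push_cast
      rw [Complex.exp_pi_div_two_mul_I]
      rfl
    rw [this]; simp
  have h2 : ∫ M, ((corner M).re ^ 2 + (corner M).im ^ 2) ∂haar (N + 1) = 1 / (N + 1) := by
    rw [← integral_norm_corner_sq N]
    congr 1; funext M
    rw [Complex.sq_norm, Complex.normSq_apply]; ring
  rw [integral_add (integrable_of_continuous (by fun_prop))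
    (integrable_of_continuous (by fun_prop)), ← h1] at h2
  field_simp at h2 ⊢
  linarith

/-! ### Mean and variance of the increments -/

/-- `Im Log (1 - α)`, with `α` the corner entry. -/
def imLogCorner {N : ℕ} (M : U (N + 1)) : ℝ := (Complex.log (1 - corner M)).im

theorem measurable_imLogCorner (N : ℕ) : Measurable (imLogCorner (N := N)) := by
  unfold imLogCorner
  have := measurable_corner N
  fun_prop

theorem abs_imLogCorner_le {N : ℕ} (M : U (N + 1)) : |imLogCorner M| ≤ π := by
  rw [imLogCorner, Complex.log_im]
  exact Complex.abs_arg_le_pi _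

theorem integrable_of_bounded {Ω E : Type*} [MeasurableSpace Ω] {μ : Measure Ω} [IsFiniteMeasure μ]
    [NormedAddCommGroup E] {F : Ω → E} (hF : AEStronglyMeasurable F μ) (C : ℝ)
    (h : ∀ ω, ‖F ω‖ ≤ C) : Integrable F μ :=
  Integrable.of_bound hF C (Filter.Eventually.of_forall h)

theorem integrable_imLogCorner_pow (N n : ℕ) :
    Integrable (fun M => imLogCorner M ^ n) (haar (N + 1)) :=
  integrable_of_bounded ((measurable_imLogCorner N).pow_const n).aestronglyMeasurable (π ^ n)
    fun M => by
      rw [norm_pow]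
      exact pow_le_pow_left₀ (norm_nonneg _) (abs_imLogCorner_le M) n

/-- The measure-preserving map `M ↦ M⁻¹` conjugates the corner entry and so changes the sign. -/
theorem integral_imLogCorner (N : ℕ) : ∫ M, imLogCorner M ∂haar (N + 1) = 0 := by
  have h : ∫ M, imLogCorner M ∂haar (N + 1) = ∫ M, -imLogCorner M ∂haar (N + 1) := by
    rw [← integral_inv_eq_self (fun M => imLogCorner M) (haar (N + 1))]
    congr 1; funext M
    have h1 : corner M⁻¹ = (starRingEnd ℂ) (corner M) := rfl
    have h2 : (1 - corner M).arg ≠ π := by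
      intro h
      rw [Complex.arg_eq_pi_iff] at h
      have := (Complex.re_le_norm (corner M)).trans (norm_corner_le M)
      simp only [Complex.sub_re, Complex.one_re] at h
      linarith [h.1]
    rw [imLogCorner, h1, ← map_one (starRingEnd ℂ), ← map_sub, Complex.log_conj _ h2,
      Complex.conj_im]
    rfl
  rw [integral_neg] at h
  linarith

theorem abs_im_log_one_sub_add_im_le {a : ℂ} (ha : ‖a‖ ≤ 1) :
    |(Complex.log (1 - a)).im + a.im| ≤ 20 * ‖a‖ ^ 2 := by
  -- Near `0` this is the quadratic Taylor remainder. For `‖a‖ > 1 / 2` the left side is at most `4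
  -- + 1`, which is the origin of the constant `20`.
  rcases le_or_gt ‖a‖ (1 / 2) with h | h
  · have h1 := Complex.norm_log_one_add_sub_self_le (z := -a) (by rw [norm_neg]; linarith)
    rw [norm_neg, sub_neg_eq_add, ← sub_eq_add_neg] at h1
    have h2 : (1 - ‖a‖)⁻¹ ≤ 2 := by
      rw [inv_le_comm₀ (by linarith) (by norm_num)]; linarith
    have h3 := Complex.abs_im_le_norm (Complex.log (1 - a) + a)
    rw [Complex.add_im] at h3
    nlinarith [sq_nonneg ‖a‖]
  · have h1 : |(Complex.log (1 - a)).im| ≤ 4 := by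
      rw [Complex.log_im]
      exact (Complex.abs_arg_le_pi _).trans Real.pi_le_four
    have h2 := (Complex.abs_im_le_norm a).trans ha
    have h3 := abs_add_le (Complex.log (1 - a)).im a.im
    nlinarith

/-- The difference of squares is bounded by `440 |α| ^ 3`. Since only the second and fourth moments
are available, the cube is split as `2 |α|³ ≤ s⁻¹ |α|² + s |α|⁴`, with `s` free. -/
theorem abs_imLogCorner_sq_sub_le {N : ℕ} (M : U (N + 1)) {s : ℝ} (hs : 0 < s) :
    |imLogCorner M ^ 2 - (corner M).im ^ 2| ≤
      220 * (s⁻¹ * ‖corner M‖ ^ 2 + s * ‖corner M‖ ^ 4) := by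
  have h1 := abs_im_log_one_sub_add_im_le (norm_corner_le M)
  have h2 := Complex.abs_im_le_norm (corner M)
  set r := ‖corner M‖
  have hr0 : 0 ≤ r := norm_nonneg _
  have hr1 : r ≤ 1 := norm_corner_le M
  set X := (Complex.log (1 - corner M)).im with hX
  set y := (corner M).im
  have h3 : |X - y| ≤ 22 * r := by
    have : X - y = (X + y) - 2 * y := by ring
    rw [this]
    refine (abs_sub _ _).trans ?_
    rw [abs_mul, abs_two]
    nlinarith
  have h4 : |imLogCorner M ^ 2 - y ^ 2| ≤ 20 * r ^ 2 * (22 * r) := by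
    rw [imLogCorner, ← hX, sq_sub_sq, abs_mul]
    exact mul_le_mul h1 h3 (abs_nonneg _) (by positivity)
  refine h4.trans ?_
  have h5 : 2 * r ≤ s⁻¹ + s * r ^ 2 := by
    have : s⁻¹ + s * r ^ 2 - 2 * r = s * (s⁻¹ - r) ^ 2 := by field_simp; ring
    nlinarith [mul_nonneg hs.le (sq_nonneg (s⁻¹ - r))]
  nlinarith [mul_le_mul_of_nonneg_left h5 (sq_nonneg r)]

/-- The variance of `Im Log (1 - α)`, with `α` an entry of a Haar matrix of `U(N + 1)`. -/
def varCorner (N : ℕ) : ℝ := ∫ M : U (N + 1), imLogCorner M ^ 2 ∂haar (N + 1)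

theorem varCorner_nonneg (N : ℕ) : 0 ≤ varCorner N := integral_nonneg fun _ => sq_nonneg _

theorem abs_varCorner_sub_le (N : ℕ) :
    |varCorner N - 1 / (2 * (N + 1))| ≤ 660 * (1 / ((N : ℝ) + 1) ^ (3 / 2 : ℝ)) := by
  -- This choice balances `s⁻¹ E |α|²` and `s E |α|⁴`, both of order `N ^ (-3 / 2)`, which is
  -- summable.
  set s : ℝ := Real.sqrt (N + 1) with hs
  have hN : (0 : ℝ) < N + 1 := by positivity
  have hs0 : 0 < s := Real.sqrt_pos.2 hN
  have hss : s ^ 2 = N + 1 := Real.sq_sqrt hN.le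
  have i1 : Integrable (fun M : U (N + 1) => (corner M).im ^ 2) (haar (N + 1)) :=
    integrable_of_continuous (by fun_prop)
  have i2 : Integrable (fun M : U (N + 1) => s⁻¹ * ‖corner M‖ ^ 2) (haar (N + 1)) :=
    integrable_of_continuous (by fun_prop)
  have i3 : Integrable (fun M : U (N + 1) => s * ‖corner M‖ ^ 4) (haar (N + 1)) :=
    integrable_of_continuous (by fun_prop)
  rw [← integral_corner_im_sq, varCorner, ← integral_sub (integrable_imLogCorner_pow N 2) i1]
  refine (abs_integral_le_integral_abs).trans ?_
  refine (integral_mono ((integrable_imLogCorner_pow N 2).sub i1).abs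
    ((i2.add i3).const_mul 220) fun M => abs_imLogCorner_sq_sub_le M hs0).trans ?_
  simp only [Pi.add_apply]
  rw [integral_const_mul, integral_add i2 i3, integral_const_mul, integral_const_mul,
    integral_norm_corner_sq, integral_norm_corner_pow_four]
  have e : ((N : ℝ) + 1) ^ (3 / 2 : ℝ) = s ^ 3 := by
    rw [hs, Real.sqrt_eq_rpow, ← Real.rpow_natCast, ← Real.rpow_mul hN.le]; norm_num
  have h2 : s * (2 / (((N : ℝ) + 1) * (N + 2))) ≤ 2 * (1 / s ^ 3) := by
    have : (2 : ℝ) / (((N : ℝ) + 1) * (N + 2)) ≤ 2 / (s ^ 2 * s ^ 2) := by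
      rw [hss]
      gcongr
      linarith
    calc s * (2 / (((N : ℝ) + 1) * (N + 2))) ≤ s * (2 / (s ^ 2 * s ^ 2)) := by gcongr
      _ = 2 * (1 / s ^ 3) := by field_simp
  have h1 : s⁻¹ * (1 / ((N : ℝ) + 1)) = 1 / s ^ 3 := by
    rw [← hss]; field_simp
  rw [e, h1]
  linarith

end

/-! ### Variance and characteristic function of `Im log P_N` -/

/-- `Im log P_N(A, 0)`. -/
def imLogP {N : ℕ} (A : U N) : ℝ := (logP A 0).im

@[fun_prop]
theorem measurable_imLogP (N : ℕ) : Measurable (imLogP (N := N)) :=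
  Complex.measurable_im.comp (measurable_logP_zero N)

theorem abs_im_sum_log_le {ι : Type*} (s : Finset ι) (z : ι → ℂ) :
    |(∑ j ∈ s, Complex.log (z j)).im| ≤ s.card * π := by
  rw [Complex.im_sum]
  refine (Finset.abs_sum_le_sum_abs _ _).trans ?_
  refine (Finset.sum_le_card_nsmul _ _ π fun j _ => ?_).trans (by rw [nsmul_eq_mul])
  rw [Complex.log_im]
  exact Complex.abs_arg_le_pi _

theorem abs_imLogP_le {N : ℕ} (A : U N) : |imLogP A| ≤ N * π := by
  rw [imLogP, logP]
  simpa using abs_im_sum_log_le (Finset.univ : Finset (Fin N)) _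

theorem integrable_imLogP_pow (N n : ℕ) :
    Integrable (fun A : U N => imLogP A ^ n) (haar N) :=
  integrable_of_bounded ((measurable_imLogP N).pow_const n).aestronglyMeasurable ((N * π) ^ n)
    fun A => by
      rw [norm_pow]
      exact pow_le_pow_left₀ (norm_nonneg _) (abs_imLogP_le A) n

theorem integrable_imLogP (N : ℕ) : Integrable (imLogP (N := N)) (haar N) := by
  simpa using integrable_imLogP_pow N 1

theorem integrable_imLogCorner (N : ℕ) : Integrable (imLogCorner (N := N)) (haar (N + 1)) := by
  simpa using integrable_imLogCorner_pow N 1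

theorem integral_imLogP_succ {E : Type*} [NormedAddCommGroup E] [NormedSpace ℝ E] (N : ℕ)
    {Φ : ℝ → E} (hΦ : StronglyMeasurable Φ) :
    ∫ A, Φ (imLogP A) ∂haar (N + 1) =
      ∫ p, Φ (imLogCorner p.1 + imLogP p.2) ∂(haar (N + 1)).prod (haar N) := by
  have hG : Measurable fun p : U (N + 1) × U N => Complex.log (1 - corner p.1) + logP p.2 0 := by
    have h1 := measurable_logP_zero N
    have h2 := measurable_corner N
    fun_prop
  have hΨ : StronglyMeasurable fun z : ℂ => Φ z.im := hΦ.comp_measurable Complex.measurable_im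
  have h1 := integral_map (μ := haar (N + 1)) (measurable_logP_zero (N + 1)).aemeasurable
    hΨ.aestronglyMeasurable
  rw [map_logP_succ, integral_map hG.aemeasurable hΨ.aestronglyMeasurable] at h1
  exact h1.symm

theorem imLogP_zero (A : U 0) : imLogP A = 0 := by simp [imLogP, logP]

theorem integral_imLogP (N : ℕ) : ∫ A, imLogP A ∂haar N = 0 := by
  induction N with
  | zero => simp [imLogP_zero]
  | succ N ih =>
    rw [integral_imLogP_succ N (Φ := fun x => x) stronglyMeasurable_id,
      integral_add ((integrable_imLogCorner N).comp_fst _) ((integrable_imLogP N).comp_snd _),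
      integral_fun_fst, integral_fun_snd, ih, integral_imLogCorner]
    simp

/-- The variance of `Im log P_N(A, 0)`. -/
def varIm (N : ℕ) : ℝ := ∫ A : U N, imLogP A ^ 2 ∂haar N

theorem varIm_zero : varIm 0 = 0 := by simp [varIm, imLogP_zero]

theorem varIm_succ (N : ℕ) : varIm (N + 1) = varIm N + varCorner N := by
  have h1 := (integrable_imLogCorner_pow N 2).comp_fst (haar N)
  have h2 := (integrable_imLogP_pow N 2).comp_snd (haar (N + 1))
  have h3 := ((integrable_imLogCorner N).mul_prod (integrable_imLogP N)).const_mul 2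
  rw [varIm, integral_imLogP_succ N (Φ := fun x => x ^ 2)
    (measurable_id.pow_const 2).stronglyMeasurable]
  have e : ∀ p : U (N + 1) × U N, (imLogCorner p.1 + imLogP p.2) ^ 2 =
      (imLogCorner p.1 ^ 2 + imLogP p.2 ^ 2) + 2 * (imLogCorner p.1 * imLogP p.2) := fun p => by
    ring
  have h12 : Integrable (fun p : U (N + 1) × U N => imLogCorner p.1 ^ 2 + imLogP p.2 ^ 2)
    ((haar (N + 1)).prod (haar N)) := h1.add h2
  simp_rw [e]
  rw [integral_add h12 h3, integral_add h1 h2, integral_const_mul,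
    integral_prod_mul (fun M => imLogCorner M) (fun A => imLogP A), integral_imLogP,
    integral_fun_fst (fun M => imLogCorner M ^ 2), integral_fun_snd (fun A => imLogP A ^ 2)]
  simp [varIm, varCorner, add_comm]

theorem varIm_eq_sum (N : ℕ) : varIm N = ∑ k ∈ Finset.range N, varCorner k := by
  induction N with
  | zero => simp [varIm_zero]
  | succ N ih => rw [varIm_succ, Finset.sum_range_succ, ih]

/-- The main terms `1 / (2 (k + 1))` of the increments add up to half the harmonic number, and the
errors are summable. -/
theorem exists_abs_varIm_sub_le :
    ∃ C, ∀ N : ℕ, 1 ≤ N → |varIm N - 1 / 2 * Real.log N| ≤ C := by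
  have hs : Summable fun k : ℕ => 660 * (1 / ((k : ℝ) + 1) ^ (3 / 2 : ℝ)) := by
    refine Summable.mul_left _ ?_
    have := (summable_nat_add_iff 1).2
      (Real.summable_one_div_nat_rpow (p := 3 / 2).2 (by norm_num))
    simpa using this
  refine ⟨∑' k : ℕ, 660 * (1 / ((k : ℝ) + 1) ^ (3 / 2 : ℝ)) + 1, fun N hN => ?_⟩
  have h1 : |varIm N - ∑ k ∈ Finset.range N, 1 / (2 * ((k : ℝ) + 1))| ≤
      ∑' k : ℕ, 660 * (1 / ((k : ℝ) + 1) ^ (3 / 2 : ℝ)) := by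
    rw [varIm_eq_sum, ← Finset.sum_sub_distrib]
    refine (Finset.abs_sum_le_sum_abs _ _).trans ?_
    refine (Finset.sum_le_sum fun k _ => abs_varCorner_sub_le k).trans ?_
    exact hs.sum_le_tsum _ fun k _ => by positivity
  have h2 : ∑ k ∈ Finset.range N, 1 / (2 * ((k : ℝ) + 1)) = 1 / 2 * (harmonic N : ℝ) := by
    rw [harmonic, Rat.cast_sum, Finset.mul_sum]
    refine Finset.sum_congr rfl fun k _ => ?_
    push_cast
    rw [one_div, mul_inv, one_div]
  have h3 := harmonic_le_one_add_log N
  have h4 : Real.log N ≤ harmonic N := (Real.log_le_log (by positivity) (by simp)).trans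
    (log_add_one_le_harmonic N)
  rw [h2] at h1
  rw [abs_le] at h1 ⊢
  constructor <;> linarith [h1.1, h1.2]

/-- The characteristic function of `Im log P_N(A, 0)`. -/
def charIm (N : ℕ) (u : ℝ) : ℂ := ∫ A : U N, Complex.exp (u * imLogP A * Complex.I) ∂haar N

/-- The characteristic function of `Im Log (1 - α)`, with `α` an entry of a Haar matrix. -/
def charCorner (N : ℕ) (u : ℝ) : ℂ :=
  ∫ M : U (N + 1), Complex.exp (u * imLogCorner M * Complex.I) ∂haar (N + 1)

theorem norm_exp_mul_I_eq_one (u x : ℝ) : ‖Complex.exp (u * x * Complex.I)‖ = 1 := by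
  rw [← Complex.ofReal_mul, Complex.norm_exp_ofReal_mul_I]

theorem charIm_zero (u : ℝ) : charIm 0 u = 1 := by simp [charIm, imLogP_zero]

theorem charIm_succ (N : ℕ) (u : ℝ) : charIm (N + 1) u = charCorner N u * charIm N u := by
  rw [charIm, integral_imLogP_succ N (Φ := fun x => Complex.exp (u * x * Complex.I))
    (by apply Continuous.stronglyMeasurable; fun_prop)]
  rw [charCorner, charIm, ← integral_prod_mul]
  congr 1; funext p
  rw [← Complex.exp_add]
  congr 1
  push_cast; ring

theorem norm_charIm_le (N : ℕ) (u : ℝ) : ‖charIm N u‖ ≤ 1 := by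
  refine (norm_integral_le_of_norm_le_const (C := 1) (Filter.Eventually.of_forall fun A => ?_)).trans
    (by simp)
  rw [norm_exp_mul_I_eq_one]

/-- Taylor expansion of a centred variable. Since `|X| ≤ π ≤ 4`, the bound on `u` gives `|u X| ≤ 1`,
and `|X| ^ 3 ≤ 4 X ^ 2` makes the error proportional to the variance, so that errors add up to the
total variance. -/
theorem norm_charCorner_sub_le (N : ℕ) {u : ℝ} (hu : |u| ≤ 1 / 4) :
    ‖charCorner N u - (1 - u ^ 2 / 2 * varCorner N : ℝ)‖ ≤ 4 * |u| ^ 3 * varCorner N := by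
  have hm := measurable_imLogCorner N
  have i0 : Integrable (fun M : U (N + 1) => Complex.exp (u * imLogCorner M * Complex.I))
      (haar (N + 1)) := integrable_of_bounded (by
        apply Measurable.aestronglyMeasurable; fun_prop) 1
      fun M => (norm_exp_mul_I_eq_one _ _).le
  have i1 : Integrable (fun M : U (N + 1) => ((1 + u * imLogCorner M * Complex.I -
      u ^ 2 / 2 * (imLogCorner M ^ 2 : ℝ) : ℂ))) (haar (N + 1)) := by
    refine ((integrable_const _).add ?_).sub ((integrable_imLogCorner_pow N 2).ofReal.const_mul _)
    exact ((integrable_imLogCorner N).ofReal.const_mul _).mul_const _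
  have e : ((1 - u ^ 2 / 2 * varCorner N : ℝ) : ℂ) = ∫ M : U (N + 1),
      ((1 + u * imLogCorner M * Complex.I -
        u ^ 2 / 2 * (imLogCorner M ^ 2 : ℝ) : ℂ)) ∂haar (N + 1) := by
    rw [integral_sub ((integrable_const _).add
      (((integrable_imLogCorner N).ofReal.const_mul _).mul_const _))
      ((integrable_imLogCorner_pow N 2).ofReal.const_mul _),
      integral_add (integrable_const _)
        (((integrable_imLogCorner N).ofReal.const_mul _).mul_const _),
      integral_mul_const, integral_const_mul, integral_const_mul]
    have e1 : ∫ M : U (N + 1), ((imLogCorner M : ℝ) : ℂ) ∂haar (N + 1) = 0 := by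
      rw [integral_complex_ofReal, integral_imLogCorner, Complex.ofReal_zero]
    have e2 : ∫ M : U (N + 1), ((imLogCorner M ^ 2 : ℝ) : ℂ) ∂haar (N + 1) = varCorner N := by
      rw [integral_complex_ofReal, varCorner]
    rw [e1, e2]
    simp
  rw [e, charCorner, ← integral_sub i0 i1, varCorner, ← integral_const_mul]
  refine (norm_integral_le_integral_norm _).trans ?_
  refine integral_mono (i0.sub i1).norm ((integrable_imLogCorner_pow N 2).const_mul _) fun M => ?_
  have hX := abs_imLogCorner_le M
  set X := imLogCorner M
  have hz : ‖(u * X * Complex.I : ℂ)‖ = |u| * |X| := by simp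
  have hpi := Real.pi_le_four
  have hz1 : ‖(u * X * Complex.I : ℂ)‖ ≤ 1 := by
    rw [hz]
    calc |u| * |X| ≤ 1 / 4 * 4 := by gcongr; exact hX.trans hpi
      _ = 1 := by norm_num
  have hb := Complex.exp_bound hz1 (n := 3) (by norm_num)
  have hsum : ∑ m ∈ Finset.range 3, (u * X * Complex.I : ℂ) ^ m / (m.factorial : ℂ) =
      1 + u * X * Complex.I - u ^ 2 / 2 * (X ^ 2 : ℝ) := by
    simp only [Finset.sum_range_succ, Finset.sum_range_zero, mul_pow, Complex.I_sq]
    simp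
    ring
  rw [hsum, hz] at hb
  refine hb.trans ?_
  simp only [Nat.factorial, Nat.succ_eq_add_one]
  norm_num
  have h3 : |X| ^ 3 ≤ 4 * X ^ 2 := by
    rw [← sq_abs X, pow_succ, mul_comm]
    gcongr
    exact hX.trans hpi
  rw [mul_pow]
  have h4 : 0 ≤ |u| ^ 3 := by positivity
  nlinarith [mul_le_mul_of_nonneg_left h3 h4, mul_nonneg h4 (sq_nonneg X)]

/-- Both sides are products over the increments of factors of modulus at most `1`, so the errors of
the factors add. Each error is `4 |u|³ s` from the expansion of `charCorner`, plus `2 |u|³ s` from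
replacing `1 - y` by `exp (-y)`. -/
theorem norm_charIm_sub_le (N : ℕ) {u : ℝ} (hu : |u| ≤ 1 / 4) :
    ‖charIm N u - (Real.exp (-(u ^ 2 / 2 * varIm N)) : ℝ)‖ ≤ 6 * |u| ^ 3 * varIm N := by
  induction N with
  | zero => simp [charIm_zero, varIm_zero]
  | succ N ih =>
    set s := varCorner N
    have hs0 : 0 ≤ s := varCorner_nonneg N
    have hs1 : s ≤ 16 := by
      have : s ≤ ∫ M : U (N + 1), 16 ∂haar (N + 1) :=
        integral_mono (integrable_imLogCorner_pow N 2) (integrable_const _) fun M => by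
          have := abs_imLogCorner_le M
          have h4 := Real.pi_le_four
          have h0 := abs_nonneg (imLogCorner M)
          simp only
          rw [← sq_abs]
          nlinarith
      simpa using this
    set y := u ^ 2 / 2 * s with hy
    have hu2 : u ^ 2 ≤ 1 / 16 := by
      rw [← sq_abs]; nlinarith [abs_nonneg u]
    have hy0 : 0 ≤ y := by positivity
    have hy1 : y ≤ 1 := by nlinarith
    have hexp : |Real.exp (-y) - (1 - y)| ≤ y ^ 2 := by
      have := Real.abs_exp_sub_one_sub_id_le (x := -y) (by rw [abs_neg, abs_of_nonneg hy0]; exact hy1)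
      rw [neg_sq] at this
      convert this using 2; ring
    have hy2 : y ^ 2 ≤ 2 * |u| ^ 3 * s := by
      have e1 : y ^ 2 = |u| ^ 3 * s * (|u| * s / 4) := by
        rw [hy, ← sq_abs u]; ring
      have e2 : |u| * s / 4 ≤ 2 := by nlinarith [abs_nonneg u]
      rw [e1]
      have : 0 ≤ |u| ^ 3 * s := by positivity
      nlinarith
    have h1 : ‖charCorner N u - (Real.exp (-y) : ℝ)‖ ≤ 6 * |u| ^ 3 * s := by
      have e : charCorner N u - (Real.exp (-y) : ℝ) =
          (charCorner N u - (1 - y : ℝ)) - ((Real.exp (-y) - (1 - y) : ℝ) : ℂ) := by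
        push_cast; ring
      rw [e]
      refine (norm_sub_le _ _).trans ?_
      rw [Complex.norm_real, Real.norm_eq_abs]
      have := norm_charCorner_sub_le N hu
      linarith
    have e : charIm (N + 1) u - (Real.exp (-(u ^ 2 / 2 * varIm (N + 1))) : ℝ) =
        (charCorner N u - (Real.exp (-y) : ℝ)) * charIm N u + (Real.exp (-y) : ℝ) *
          (charIm N u - (Real.exp (-(u ^ 2 / 2 * varIm N)) : ℝ)) := by
      rw [charIm_succ, varIm_succ, mul_add, neg_add, Real.exp_add, Complex.ofReal_mul]
      ring
    rw [e, varIm_succ]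
    refine (norm_add_le _ _).trans ?_
    rw [norm_mul, norm_mul, Complex.norm_real, Real.norm_eq_abs, abs_of_pos (Real.exp_pos _)]
    have h2 := mul_le_mul h1 (norm_charIm_le N u) (norm_nonneg _) (by positivity)
    have h3 : Real.exp (-y) ≤ 1 := Real.exp_le_one_iff.2 (by linarith)
    have h4 := mul_le_mul h3 ih (norm_nonneg _) zero_le_one
    rw [mul_one] at h2
    rw [one_mul] at h4
    calc _ ≤ 6 * |u| ^ 3 * s + 6 * |u| ^ 3 * varIm N := add_le_add h2 h4
      _ = _ := by ring

/-! ### The sawtooth `φ ↦ Im log P_N(A, φ)` -/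

/-- The period `c` is chosen so that the sine is positive; the formula is then the polar form and
the argument can be read off. -/
theorem one_sub_exp_eq (x c : ℝ) (hc : Complex.exp (Complex.I * c) = 1) :
    1 - Complex.exp (Complex.I * x) =
      ((2 * Real.sin ((x - c) / 2) : ℝ) : ℂ) * Complex.exp (((x - c - π) / 2 : ℝ) * Complex.I) := by
  have e1 : Complex.exp (Complex.I * x) = Complex.exp (((x - c) / 2 : ℝ) * Complex.I) *
      Complex.exp (((x - c) / 2 : ℝ) * Complex.I) := by
    rw [← Complex.exp_add, ← mul_one (Complex.exp (_ + _)), ← hc, ← Complex.exp_add]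
    congr 1; push_cast; ring
  have e2 : Complex.exp (((x - c - π) / 2 : ℝ) * Complex.I) =
      Complex.exp (((x - c) / 2 : ℝ) * Complex.I) * (-Complex.I) := by
    rw [← Complex.exp_neg_pi_div_two_mul_I, ← Complex.exp_add]
    congr 1; push_cast; ring
  rw [e1, e2, Complex.exp_mul_I, ← Complex.ofReal_cos, ← Complex.ofReal_sin]
  have h := Real.sin_sq_add_cos_sq ((x - c) / 2)
  generalize Real.sin ((x - c) / 2) = s at *
  generalize Real.cos ((x - c) / 2) = t at *
  apply Complex.ext
  · simp [pow_two] at h ⊢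
    linarith
  · simp
    ring

theorem im_log_one_sub_exp_of_pos {x : ℝ} (h0 : 0 < x) (h1 : x < 2 * π) :
    (Complex.log (1 - Complex.exp (Complex.I * x))).im = (x - π) / 2 := by
  rw [one_sub_exp_eq x 0 (by simp), Complex.log_im, Complex.arg_real_mul, Complex.arg_exp_mul_I,
    (toIocMod_eq_self Real.two_pi_pos).2]
  · simp
  · constructor <;> linarith
  · have := Real.sin_pos_of_pos_of_lt_pi (x := (x - 0) / 2) (by linarith) (by linarith)
    linarith

theorem im_log_one_sub_exp_of_neg {x : ℝ} (h0 : x < 0) (h1 : -(2 * π) < x) :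
    (Complex.log (1 - Complex.exp (Complex.I * x))).im = (x + π) / 2 := by
  have hc : Complex.exp (Complex.I * (-(2 * π) : ℝ)) = 1 := by
    rw [Complex.exp_eq_one_iff]
    exact ⟨-1, by push_cast; ring⟩
  rw [one_sub_exp_eq x _ hc, Complex.log_im, Complex.arg_real_mul, Complex.arg_exp_mul_I,
    (toIocMod_eq_self Real.two_pi_pos).2]
  · ring
  · constructor <;> linarith
  · have := Real.sin_pos_of_pos_of_lt_pi (x := (x - -(2 * π)) / 2) (by linarith) (by linarith)
    linarith

theorem logP_im_eq_sum {N : ℕ} (A : U N) (φ : ℝ) : (logP A φ).im =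
    ∑ j, (Complex.log (1 - Complex.exp (Complex.I * (φ - eigenangle A j : ℝ)))).im := by
  rw [logP, Complex.im_sum]
  push_cast
  rfl

/-- The linear function with which `Im log P_N(A, ·)` coincides between the eigenangles of index
`k - 1` and `k`. -/
def imLine {N : ℕ} (A : U N) (k : ℕ) (φ : ℝ) : ℝ :=
  N / 2 * φ + (((N : ℝ) - 2 * k) * π - ∑ j, eigenangle A j) / 2

/-- The sequence `-π, θ_0, …, θ_{N-1}, π`. -/
def breakpoint {N : ℕ} (A : U N) : ℕ → ℝ
  | 0 => -π
  | k + 1 => if h : k < N then eigenangle A ⟨k, h⟩ else π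

theorem breakpoint_mono {N : ℕ} (A : U N) : Monotone (breakpoint A) := by
  refine monotone_nat_of_le_succ fun k => ?_
  rcases k with _ | k
  · simp only [breakpoint]
    split_ifs
    · exact (eigenangle_mem_Ico A _).1
    · linarith [Real.pi_pos]
  · simp only [breakpoint]
    split_ifs with h1 h2
    · exact monotone_eigenangle A (by simp)
    · exact (eigenangle_mem_Ico A _).2.le
    · omega
    · exact le_rfl

theorem sum_ite_lt {N k : ℕ} (hk : k ≤ N) (c : ℝ) :
    ∑ j : Fin N, (if (j : ℕ) < k then c else 0) = k * c := by
  rw [Fin.sum_univ_eq_sum_range (fun i => if i < k then c else 0), ← Finset.sum_filter,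
    Finset.sum_const, nsmul_eq_mul]
  have : (Finset.range N).filter (· < k) = Finset.range k := by
    ext i
    simp only [Finset.mem_filter, Finset.mem_range]
    omega
  rw [this, Finset.card_range]

/-- Each summand is `(φ - θ_j - π) / 2` for `θ_j < φ` and `(φ - θ_j + π) / 2` for `θ_j > φ`, and
exactly `k` eigenangles lie below `φ`. -/
theorem logP_im_eq_imLine {N : ℕ} (A : U N) {k : ℕ} (hk : k ≤ N) {φ : ℝ}
    (h1 : breakpoint A k < φ) (h2 : φ < breakpoint A (k + 1)) :
    (logP A φ).im = imLine A k φ := by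
  have hlo : -π < φ := lt_of_le_of_lt (breakpoint_mono A (Nat.zero_le k)) h1
  have hhi : φ < π := lt_of_lt_of_le h2 (by
    have := breakpoint_mono A (show k + 1 ≤ N + 1 by omega)
    simpa [breakpoint] using this)
  have hterm : ∀ j : Fin N,
      (Complex.log (1 - Complex.exp (Complex.I * (φ - eigenangle A j : ℝ)))).im =
        (φ - eigenangle A j + π) / 2 - if (j : ℕ) < k then π else 0 := by
    intro j
    have hj := eigenangle_mem_Ico A j
    split_ifs with hjk
    · have : eigenangle A j < φ := by
        refine lt_of_le_of_lt ?_ h1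
        have := breakpoint_mono A (show (j : ℕ) + 1 ≤ k by omega)
        simpa [breakpoint] using this
      rw [im_log_one_sub_exp_of_pos (by linarith) (by linarith [hj.1])]
      ring
    · have : φ < eigenangle A j := by
        refine lt_of_lt_of_le h2 ?_
        have := breakpoint_mono A (show k + 1 ≤ (j : ℕ) + 1 by omega)
        simpa [breakpoint] using this
      rw [im_log_one_sub_exp_of_neg (by linarith) (by linarith [hj.2])]
      ring
  rw [logP_im_eq_sum, Finset.sum_congr rfl fun j _ => hterm j, Finset.sum_sub_distrib,
    ← Finset.sum_div, Finset.sum_add_distrib, Finset.sum_sub_distrib]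
  rw [sum_ite_lt hk]
  simp only [Finset.sum_const, Finset.card_univ, Fintype.card_fin, nsmul_eq_mul, imLine]
  ring

/-- This is the right limit of the sawtooth at `θ_n`: the argument `-π / 2` of `-i` is the limit of
the argument of the missing factor as `φ` decreases to `θ_n`. -/
theorem imLogP'_eq {N : ℕ} {A : U N} (hA : Function.Injective (eigenangle A)) (n : Fin N) :
    imLogP' N (A, n) = imLine A n (eigenangle A n) - π := by
  have hterm : ∀ j ∈ Finset.univ.erase n,
      (Complex.log (1 - Complex.exp (Complex.I * (eigenangle A n - eigenangle A j)))).im =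
        (eigenangle A n - eigenangle A j + π) / 2 - if (j : ℕ) < n then π else 0 := by
    intro j hj
    have hne := Finset.ne_of_mem_erase hj
    have h1 := eigenangle_mem_Ico A j
    have h2 := eigenangle_mem_Ico A n
    have hs := (monotone_eigenangle A).strictMono_of_injective hA
    rw [← Complex.ofReal_sub]
    split_ifs with hjn
    · have := hs (show j < n from hjn)
      rw [im_log_one_sub_exp_of_pos (by linarith) (by linarith [h1.1, h2.2])]
      ring
    · have := hs (show n < j from lt_of_le_of_ne (not_lt.1 hjn) (Ne.symm hne))
      rw [im_log_one_sub_exp_of_neg (by linarith) (by linarith [h1.2, h2.1])]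
      ring
  have hI : (Complex.log (-Complex.I)).im = -(π / 2) := by simp [Complex.log_im]
  -- Completing the sum with the term `j = n` costs `π / 2`; together with `Log (-i)` this makes the
  -- shift `-π`.
  have hn : ∑ j ∈ Finset.univ.erase n, ((eigenangle A n - eigenangle A j + π) / 2 -
      if (j : ℕ) < n then π else 0) = ∑ j, ((eigenangle A n - eigenangle A j + π) / 2 -
      if (j : ℕ) < n then π else 0) - π / 2 := by
    rw [← Finset.add_sum_erase _ _ (Finset.mem_univ n)]
    simp
  rw [imLogP', logP', Complex.add_im, Complex.im_sum, Finset.sum_congr rfl hterm, hn, hI,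
    Finset.sum_sub_distrib, ← Finset.sum_div, Finset.sum_add_distrib, Finset.sum_sub_distrib]
  rw [sum_ite_lt n.2.le]
  simp only [Finset.sum_const, Finset.card_univ, Fintype.card_fin, nsmul_eq_mul, imLine]
  ring

theorem imLine_succ {N : ℕ} (A : U N) (k : ℕ) (φ : ℝ) :
    imLine A (k + 1) φ = imLine A k φ - π := by
  simp only [imLine]; push_cast; ring

/-- The average of a function of `Im log P_N(A, ·)` over the circle, in terms of the values of
`Im log P_N'(A, ·)` at the eigenangles. -/
theorem integral_logP_im_eq {E : Type*} [NormedAddCommGroup E] [NormedSpace ℝ E] [CompleteSpace E]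
    {N : ℕ} (hN : 1 ≤ N) {A : U N} (hA : Function.Injective (eigenangle A)) {G : ℝ → E}
    (hG : Continuous G) :
    ∫ φ in (-π)..π, G (logP A φ).im =
      (2 / N : ℝ) • ∑ n, ∫ u in (0)..π, G (imLogP' N (A, n) + u) := by
  have hN0 : (N : ℝ) / 2 ≠ 0 := by positivity
  have hline : ∀ k, Continuous (imLine A k) := fun k => by unfold imLine; fun_prop
  have heq : ∀ k < N + 1, Set.EqOn (fun φ => G (logP A φ).im) (fun φ => G (imLine A k φ))
      (Set.uIoo (breakpoint A k) (breakpoint A (k + 1))) := by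
    intro k hk φ hφ
    rw [Set.uIoo_of_le (breakpoint_mono A (Nat.le_succ k))] at hφ
    simp only
    rw [logP_im_eq_imLine A (by omega) hφ.1 hφ.2]
  have hint : ∀ k < N + 1, IntervalIntegrable (fun φ => G (logP A φ).im) volume
      (breakpoint A k) (breakpoint A (k + 1)) := fun k hk =>
    (intervalIntegrable_congr_uIoo (heq k hk)).2
      ((hG.comp (hline k)).intervalIntegrable _ _)
  have hGi : ∀ a b, IntervalIntegrable G volume a b := fun a b => hG.intervalIntegrable a b
  set Γ : ℝ → E := fun y => ∫ u in (0)..y, G u with hΓ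
  have hpiece : ∀ k ∈ Finset.range (N + 1),
      ∫ φ in (breakpoint A k)..(breakpoint A (k + 1)), G (logP A φ).im =
        (2 / N : ℝ) • (Γ (imLine A k (breakpoint A (k + 1))) -
          Γ (imLine A k (breakpoint A k))) := by
    intro k hk
    rw [Finset.mem_range] at hk
    rw [intervalIntegral.integral_congr_uIoo (heq k hk)]
    simp only [imLine]
    rw [intervalIntegral.integral_comp_mul_add G hN0,
      ← intervalIntegral.integral_interval_sub_left (hGi 0 _) (hGi 0 _), inv_div]
  have htot := intervalIntegral.sum_integral_adjacent_intervals hint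
  have hb0 : breakpoint A 0 = -π := rfl
  have hbN : breakpoint A (N + 1) = π := by simp [breakpoint]
  rw [hb0, hbN] at htot
  rw [← htot, Finset.sum_congr rfl hpiece, ← Finset.smul_sum, Finset.sum_sub_distrib,
    Finset.sum_range_succ, Finset.sum_range_succ' (fun k => Γ (imLine A k (breakpoint A k))),
    hb0, hbN]
  -- By periodicity the two end terms cancel, so the sum can be regrouped by drops. The drop at
  -- `θ_n` contributes the integral of `G` between the values of lines `n + 1` and `n` there, an
  -- interval of length `π` starting at `imLogP' N (A, n)`.
  have hend : imLine A N π = imLine A 0 (-π) := by simp only [imLine]; push_cast; ring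
  rw [hend, add_sub_add_right_eq_sub, ← Finset.sum_sub_distrib, ← Fin.sum_univ_eq_sum_range]
  congr 1
  refine Finset.sum_congr rfl fun n _ => ?_
  have hbn : breakpoint A (n + 1) = eigenangle A n := by simp [breakpoint]
  rw [hbn, imLine_succ, hΓ]
  simp only
  rw [intervalIntegral.integral_interval_sub_left (hGi 0 _) (hGi 0 _),
    intervalIntegral.integral_comp_add_left, imLogP'_eq hA, add_zero, sub_add_cancel]

/-! ### From circle averages to the laws under Haar measure -/

theorem measurePreserving_rot_skew (N : ℕ) (ν : Measure ℝ) [SFinite ν] :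
    MeasurePreserving (fun p : ℝ × U N => (p.1, rot N p.1 * p.2)) (ν.prod (haar N))
      (ν.prod (haar N)) := by
  refine (MeasurePreserving.id ν).skew_product (g := fun φ A => rot N φ * A) ?_ ?_
  · apply Continuous.measurable; fun_prop
  · exact Filter.Eventually.of_forall fun φ => (measurePreserving_mul_left (haar N) (rot N φ)).map_eq

/-- The Haar integral is the Haar integral of the averages over the circle. -/
theorem integral_eq_integral_circle {N : ℕ} {E : Type*} [NormedAddCommGroup E] [NormedSpace ℝ E]
    [CompleteSpace E] {H : U N → E} (hH : Integrable H (haar N)) :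
    ∫ A, H A ∂haar N = (2 * π)⁻¹ • ∫ A, (∫ φ in (-π)..π, H (rot N φ * A)) ∂haar N := by
  have hpi : -π ≤ π := by linarith [Real.pi_pos]
  set ν : Measure ℝ := volume.restrict (Set.Ioc (-π) π) with hν
  have h1 : Integrable (fun p : ℝ × U N => H (rot N p.1 * p.2)) (ν.prod (haar N)) :=
    (measurePreserving_rot_skew N ν).integrable_comp_of_integrable (hH.comp_snd ν)
  simp_rw [intervalIntegral.integral_of_le hpi]
  rw [← integral_integral_swap (μ := ν) (ν := haar N) (f := fun φ A => H (rot N φ * A)) h1]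
  simp_rw [integral_rot_mul]
  rw [integral_const, smul_smul]
  have : ν.real Set.univ = 2 * π := by
    simp [hν, Measure.real, Real.volume_Ioc, ENNReal.toReal_ofReal, Real.pi_pos.le]
    ring
  rw [this, inv_mul_cancel₀ (by positivity), one_smul]

theorem integrable_comp_of_bounded {Ω E : Type*} [MeasurableSpace Ω] {μ : Measure Ω}
    [IsFiniteMeasure μ] [NormedAddCommGroup E] {X : Ω → ℝ} (hX : Measurable X) {C : ℝ}
    (hC : ∀ ω, |X ω| ≤ C) {K : ℝ → E} (hK : Continuous K) : Integrable (fun ω => K (X ω)) μ := by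
  obtain ⟨B, hB⟩ := (isCompact_Icc (a := -C) (b := C)).exists_bound_of_continuousOn hK.continuousOn
  exact integrable_of_bounded (hK.stronglyMeasurable.comp_measurable hX).aestronglyMeasurable B
    fun ω => hB _ (abs_le.1 (hC ω))

theorem abs_imLogP'_le {N : ℕ} (ω : U N × Fin N) : |imLogP' N ω| ≤ (N + 1) * π := by
  rw [imLogP', logP', Complex.add_im]
  refine (abs_add_le _ _).trans ?_
  have h1 := abs_im_sum_log_le (Finset.univ.erase ω.2)
    fun j => 1 - Complex.exp (Complex.I * (eigenangle ω.1 ω.2 - eigenangle ω.1 j))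
  have h2 : |(Complex.log (-Complex.I)).im| ≤ π := by
    rw [Complex.log_im]; exact Complex.abs_arg_le_pi _
  have h3 : ((Finset.univ.erase ω.2).card : ℝ) ≤ N := by
    have := Finset.card_erase_le (s := Finset.univ) (a := ω.2)
    rw [Finset.card_univ, Fintype.card_fin] at this
    exact_mod_cast this
  have := mul_le_mul_of_nonneg_right h3 Real.pi_pos.le
  linarith

theorem integral_uniformOn_univ {N : ℕ} {E : Type*} [NormedAddCommGroup E]
    [NormedSpace ℝ E] [CompleteSpace E] (f : Fin N → E) :
    ∫ n, f n ∂uniformOn (Set.univ : Set (Fin N)) = (N : ℝ)⁻¹ • ∑ n, f n := by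
  rcases N with _ | N
  · simp [Measure.eq_zero_of_isEmpty]
  have : IsProbabilityMeasure (uniformOn (Set.univ : Set (Fin (N + 1)))) :=
    isProbabilityMeasure_uniformOn Set.finite_univ Set.univ_nonempty
  rw [integral_fintype .of_finite, Finset.smul_sum]
  refine Finset.sum_congr rfl fun n _ => ?_
  rw [Measure.real, uniformOn_univ, Measure.count_singleton, Fintype.card_fin, ENNReal.toReal_div,
    ENNReal.toReal_natCast, ENNReal.toReal_one, one_div]

/-- In law, `Im log P_N` is `Im log P_N'` at a random eigenangle plus an independent uniform
variable on `[0, π]`. The factors `(2π)⁻¹` of the circle and `2 / N` of the slope combine to `π⁻¹`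
for the uniform variable and `N⁻¹` for the label. General `E` serves real moments and complex
characteristic functions at once. -/
theorem integral_imLogP_eq_integral_imLogP' {E : Type*} [NormedAddCommGroup E] [NormedSpace ℝ E]
    [CompleteSpace E] {N : ℕ} (hN : 1 ≤ N) {G : ℝ → E} (hG : Continuous G) :
    ∫ A, G (imLogP A) ∂haar N =
      ∫ ω, (π⁻¹ • ∫ u in (0)..π, G (imLogP' N ω + u)) ∂haarWithLabel N := by
  have : NeZero N := ⟨by omega⟩
  have hprob : IsProbabilityMeasure (uniformOn (Set.univ : Set (Fin N))) :=
    isProbabilityMeasure_uniformOn Set.finite_univ Set.univ_nonempty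
  set K : ℝ → E := fun x => π⁻¹ • ∫ u in (0)..π, G (x + u) with hK
  have hKc : Continuous K := by
    refine continuous_const.smul ?_
    exact intervalIntegral.continuous_parametric_intervalIntegral_of_continuous' (by fun_prop) 0 π
  have hKi : Integrable (fun ω => K (imLogP' N ω)) (haarWithLabel N) :=
    integrable_comp_of_bounded measurable_imLogP' abs_imLogP'_le hKc
  rw [integral_eq_integral_circle (integrable_comp_of_bounded (measurable_imLogP N)
    abs_imLogP_le hG)]
  change _ = ∫ ω, K (imLogP' N ω) ∂haarWithLabel N
  unfold haarWithLabel at hKi ⊢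
  rw [integral_prod _ hKi, ← integral_smul (μ := haar N)]
  refine integral_congr_ae ?_
  filter_upwards [ae_injective_eigenangle N] with A hA
  rw [integral_uniformOn_univ]
  have e : ∀ φ : ℝ, imLogP (rot N φ * A) = (logP A φ).im := fun φ => by
    rw [imLogP, logP_rot_mul, add_zero]
  simp_rw [e]
  rw [integral_logP_im_eq hN hA hG, hK, ← Finset.smul_sum, smul_smul, smul_smul]
  congr 1
  field_simp

theorem integral_imLogP' {N : ℕ} (hN : 1 ≤ N) :
    ∫ ω, imLogP' N ω ∂haarWithLabel N = -π / 2 := by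
  have : NeZero N := ⟨by omega⟩
  have h := integral_imLogP_eq_integral_imLogP' hN (G := fun x => x) continuous_id
  have e : ∀ x : ℝ, π⁻¹ • ∫ u in (0)..π, (x + u) = x + π / 2 := fun x => by
    rw [intervalIntegral.integral_add (by simp) (by simp), intervalIntegral.integral_const,
      integral_id, smul_eq_mul, smul_eq_mul]
    field_simp
    ring
  simp_rw [e] at h
  rw [integral_imLogP, integral_add (integrable_comp_of_bounded measurable_imLogP' abs_imLogP'_le
    (K := fun x => x) continuous_id) (integrable_const _)] at h
  simp at h
  linarith

theorem integral_imLogP'_sq {N : ℕ} (hN : 1 ≤ N) :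
    ∫ ω, imLogP' N ω ^ 2 ∂haarWithLabel N = varIm N + π ^ 2 / 6 := by
  have : NeZero N := ⟨by omega⟩
  have h := integral_imLogP_eq_integral_imLogP' hN (G := fun x => x ^ 2) (by fun_prop)
  have e : ∀ x : ℝ, π⁻¹ • ∫ u in (0)..π, (x + u) ^ 2 = x ^ 2 + (π * x + π ^ 2 / 3) := fun x => by
    rw [intervalIntegral.integral_comp_add_left (fun u => u ^ 2), integral_pow, smul_eq_mul]
    field_simp
    ring
  simp_rw [e] at h
  rw [← varIm, integral_add (integrable_comp_of_bounded measurable_imLogP' abs_imLogP'_le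
    (continuous_pow 2)) (integrable_comp_of_bounded (K := fun x => π * x + π ^ 2 / 3)
      measurable_imLogP' abs_imLogP'_le (by fun_prop)),
    integral_add (integrable_comp_of_bounded (K := fun x => π * x) measurable_imLogP'
      abs_imLogP'_le (by fun_prop)) (integrable_const _), integral_const_mul,
    integral_imLogP' hN] at h
  simp at h
  linarith

/-- The characteristic function of `Im log P_N'(A, θ)` at a uniformly chosen eigenangle. -/
def charIm' (N : ℕ) (u : ℝ) : ℂ :=
  ∫ ω, Complex.exp (u * imLogP' N ω * Complex.I) ∂haarWithLabel N

theorem charIm_eq {N : ℕ} (hN : 1 ≤ N) (u : ℝ) :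
    charIm N u = charIm' N u * ((π : ℂ)⁻¹ * ∫ v in (0)..π, Complex.exp (u * v * Complex.I)) := by
  rw [charIm, integral_imLogP_eq_integral_imLogP' hN
    (G := fun x => Complex.exp (u * x * Complex.I)) (by fun_prop), charIm', ← integral_mul_const]
  congr 1; funext ω
  rw [← intervalIntegral.integral_const_mul, ← intervalIntegral.integral_const_mul,
    ← intervalIntegral.integral_smul]
  congr 1; funext v
  rw [Complex.real_smul, Complex.ofReal_inv, mul_left_comm, ← Complex.exp_add]
  congr 2
  push_cast; ring

/-! ### Integrability of `log P_N` -/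

theorem norm_one_sub_exp (x : ℝ) : ‖1 - Complex.exp (Complex.I * x)‖ = 2 * |Real.sin (x / 2)| := by
  rw [norm_sub_rev, Complex.norm_exp_I_mul_ofReal_sub_one, norm_mul, Real.norm_eq_abs,
    Real.norm_eq_abs, abs_two]

/-- By Jordan's inequality the singularity is at most that of `|x| ^ (-1 / 2)`. This weight
dominates squared logarithms and small exponential moments alike. -/
theorem intervalIntegrable_norm_one_sub_exp_rpow (a b : ℝ) :
    IntervalIntegrable (fun x : ℝ => ‖1 - Complex.exp (Complex.I * x)‖ ^ (-(1 / 2) : ℝ))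
      volume a b := by
  set f : ℝ → ℝ := fun x => ‖1 - Complex.exp (Complex.I * x)‖ ^ (-(1 / 2) : ℝ) with hf
  have hper : Function.Periodic f (2 * π) := fun x => by
    simp only [hf]
    congr 3
    push_cast
    rw [mul_add, Complex.exp_add, mul_comm Complex.I (2 * π : ℂ), Complex.exp_two_pi_mul_I, mul_one]
  have habs : IntervalIntegrable (fun x : ℝ => (2 / π * |x|) ^ (-(1 / 2) : ℝ)) volume (-π) π := by
    have h1 : IntervalIntegrable (fun x : ℝ => |x| ^ (-(1 / 2) : ℝ)) volume (-π) π := by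
      refine intervalIntegrable_of_even (fun x => by rw [abs_neg]) fun x hx => ?_
      refine (intervalIntegral.intervalIntegrable_rpow' (r := -(1 / 2)) (by norm_num)).congr
        fun y hy => ?_
      rw [Set.uIoc_of_le hx.le] at hy
      rw [abs_of_pos hy.1]
    have h2 := h1.const_mul ((2 / π) ^ (-(1 / 2) : ℝ))
    refine h2.congr fun x _ => ?_
    rw [Real.mul_rpow (by positivity) (abs_nonneg _)]
  have hmain : IntervalIntegrable f volume (-π) (-π + 2 * π) := by
    have e : -π + 2 * π = π := by ring
    rw [e]
    refine habs.mono_fun (by apply Measurable.aestronglyMeasurable; fun_prop) ?_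
    refine (ae_restrict_iff' measurableSet_uIoc).2 (Filter.Eventually.of_forall fun x hx => ?_)
    rw [Set.uIoc_of_le (by linarith [Real.pi_pos])] at hx
    simp only [hf]
    rw [Real.norm_of_nonneg (by positivity), Real.norm_of_nonneg (by positivity)]
    rcases eq_or_ne x 0 with rfl | h0
    · simp
    have hx' : |x / 2| ≤ π / 2 := by
      rw [abs_div, abs_two]
      have := abs_le.2 ⟨hx.1.le, hx.2⟩
      linarith
    have hs := Real.mul_abs_le_abs_sin hx'
    rw [abs_div, abs_two] at hs
    refine Real.rpow_le_rpow_of_nonpos (by positivity) ?_ (by norm_num)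
    rw [norm_one_sub_exp]
    calc 2 / π * |x| = 2 * (2 / π * (|x| / 2)) := by ring
      _ ≤ _ := by gcongr
  have h0 := hper.intervalIntegrable Real.two_pi_pos.ne' hmain a b
  exact h0

theorem exp_abs_log_norm_le {w : ℂ} (hw : ‖w‖ ≤ 2) :
    Real.exp (|Real.log ‖w‖| / 2) ≤ 2 + ‖w‖ ^ (-(1 / 2) : ℝ) := by
  -- At `w = 0` both `Real.log 0` and `0 ^ (-1 / 2)` are `0` by convention, and the claim is `1 ≤
  -- 2`.
  rcases eq_or_ne w 0 with rfl | h0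
  · simp
  have hp : 0 < ‖w‖ := norm_pos_iff.2 h0
  have hq : 0 ≤ ‖w‖ ^ (-(1 / 2) : ℝ) := by positivity
  rcases abs_cases (Real.log ‖w‖) with ⟨h, _⟩ | ⟨h, _⟩
  · have : Real.exp (|Real.log ‖w‖| / 2) ≤ 2 := by
      rw [h]
      have h3 : Real.log ‖w‖ / 2 ≤ Real.log 2 := by
        have := Real.log_le_log hp hw
        have := Real.log_nonneg (x := 2) (by norm_num)
        linarith
      calc _ ≤ Real.exp (Real.log 2) := Real.exp_le_exp.2 h3
        _ = 2 := Real.exp_log (by norm_num)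
    linarith
  · rw [h, Real.rpow_def_of_pos hp]
    have : -Real.log ‖w‖ / 2 = Real.log ‖w‖ * -(1 / 2) := by ring
    rw [this]
    linarith

theorem norm_log_sq_le {w : ℂ} (hw : ‖w‖ ≤ 2) :
    ‖Complex.log w‖ ^ 2 ≤ 24 * (2 + ‖w‖ ^ (-(1 / 2) : ℝ)) := by
  refine le_trans ?_ (mul_le_mul_of_nonneg_left (exp_abs_log_norm_le hw) (by norm_num))
  set y := |Real.log ‖w‖| with hy
  have hy0 : 0 ≤ y := abs_nonneg _
  -- This gives `y ^ 2 ≤ 8 exp (y / 2)`; the squared argument adds at most `16`, whence `24`.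
  have h1 := Real.quadratic_le_exp_of_nonneg (x := y / 2) (by positivity)
  have h2 : (Complex.log w).re ^ 2 = y ^ 2 := by rw [Complex.log_re, hy, sq_abs]
  have h3 : (Complex.log w).im ^ 2 ≤ 16 := by
    have h4 : |(Complex.log w).im| ≤ 4 := by
      rw [Complex.log_im]
      exact (Complex.abs_arg_le_pi _).trans Real.pi_le_four
    have := sq_le_sq' (neg_le_of_abs_le h4) (le_of_abs_le h4)
    linarith
  rw [Complex.sq_norm, Complex.normSq_apply]
  nlinarith

/-- Supplies a domination uniform in the radius `r`, for the limit `r → 1`. -/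
theorem half_norm_one_sub_le {w : ℂ} (hw : ‖w‖ = 1) {r : ℝ} (h1 : r ≤ 1) (h0 : 0 ≤ r) :
    1 / 2 * ‖1 - w‖ ≤ ‖1 - r * w‖ := by
  have e : 1 - w = (1 - r * w) - ((1 - r : ℝ) : ℂ) * w := by push_cast; ring
  have h2 : ‖1 - w‖ ≤ ‖1 - r * w‖ + (1 - r) := by
    rw [e]
    refine (norm_sub_le _ _).trans ?_
    rw [norm_mul, hw, mul_one, Complex.norm_real, Real.norm_of_nonneg (by linarith)]
  have h3 : 1 - r ≤ ‖1 - r * w‖ := by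
    have := norm_sub_norm_le (1 : ℂ) (r * w)
    rw [norm_mul, hw, norm_one, mul_one, Complex.norm_real, Real.norm_of_nonneg h0] at this
    exact this
  linarith

theorem norm_log_one_sub_mul_sq_le {w : ℂ} (hw : ‖w‖ = 1) (hw1 : w ≠ 1) {r : ℝ} (h1 : r ≤ 1)
    (h0 : 0 ≤ r) :
    ‖Complex.log (1 - r * w)‖ ^ 2 ≤ 48 * (1 + ‖1 - w‖ ^ (-(1 / 2) : ℝ)) := by
  have hp : 0 < ‖1 - w‖ := norm_pos_iff.2 (sub_ne_zero.2 hw1.symm)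
  have h2 : ‖1 - r * w‖ ≤ 2 := by
    refine (norm_sub_le _ _).trans ?_
    rw [norm_mul, hw, norm_one, mul_one, Complex.norm_real, Real.norm_of_nonneg h0]
    linarith
  refine (norm_log_sq_le h2).trans ?_
  have h3 : ‖1 - r * w‖ ^ (-(1 / 2) : ℝ) ≤ 2 * ‖1 - w‖ ^ (-(1 / 2) : ℝ) := by
    refine (Real.rpow_le_rpow_of_nonpos (by positivity) (half_norm_one_sub_le hw h1 h0)
      (by norm_num)).trans ?_
    rw [Real.mul_rpow (by norm_num) (norm_nonneg _)]
    gcongr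
    rw [one_div, Real.inv_rpow (by norm_num), ← Real.rpow_neg (by norm_num), neg_neg]
    calc (2 : ℝ) ^ (2⁻¹ : ℝ) ≤ 2 ^ (1 : ℝ) :=
        Real.rpow_le_rpow_of_exponent_le (by norm_num) (by norm_num)
      _ = 2 := by simp
  linarith

theorem sq_norm_sum_le {ι : Type*} (s : Finset ι) (f : ι → ℂ) :
    ‖∑ j ∈ s, f j‖ ^ 2 ≤ s.card * ∑ j ∈ s, ‖f j‖ ^ 2 :=
  (pow_le_pow_left₀ (norm_nonneg _) (norm_sum_le _ _) 2).trans sq_sum_le_card_mul_sum_sq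

/-- `e^{iφ}` times the `j`-th eigenvalue. -/
theorem exp_mul_eigenvalue {N : ℕ} (A : U N) (j : Fin N) (φ : ℝ) :
    Complex.exp (Complex.I * φ) * eigenvalue A j =
      Complex.exp (Complex.I * (φ - eigenangle A j : ℝ)) := by
  rw [eigenvalue, ← Complex.exp_add]
  congr 1; push_cast; ring

theorem norm_exp_mul_eigenvalue {N : ℕ} (A : U N) (j : Fin N) (φ : ℝ) :
    ‖Complex.exp (Complex.I * φ) * eigenvalue A j‖ = 1 := by
  rw [exp_mul_eigenvalue, mul_comm, Complex.norm_exp_ofReal_mul_I]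

/-- `∑_j |1 - λ_j|^{-1/2}` over the eigenvalues `λ_j`. -/
def singularWeight {N : ℕ} (A : U N) : ℝ := ∑ j, ‖1 - eigenvalue A j‖ ^ (-(1 / 2) : ℝ)

theorem singularWeight_nonneg {N : ℕ} (A : U N) : 0 ≤ singularWeight A :=
  Finset.sum_nonneg fun _ _ => by positivity

theorem singularWeight_rot_mul {N : ℕ} (φ : ℝ) (A : U N) : singularWeight (rot N φ * A) =
    ∑ j, ‖1 - Complex.exp (Complex.I * φ) * eigenvalue A j‖ ^ (-(1 / 2) : ℝ) := by
  have h : singularWeight (rot N φ * A) = ((Finset.univ.val.map (eigenvalue (rot N φ * A))).map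
      fun z : ℂ => ‖1 - z‖ ^ (-(1 / 2) : ℝ)).sum := by
    rw [Multiset.map_map]; rfl
  rw [h, map_eigenvalue, roots_rot_mul, Multiset.map_map]
  rfl

theorem measurable_singularWeight (N : ℕ) : Measurable (singularWeight (N := N)) := by
  unfold singularWeight eigenvalue
  fun_prop

theorem intervalIntegrable_norm_one_sub_mul_rpow {N : ℕ} (A : U N) (j : Fin N) (a b : ℝ) :
    IntervalIntegrable (fun φ : ℝ =>
      ‖1 - Complex.exp (Complex.I * φ) * eigenvalue A j‖ ^ (-(1 / 2) : ℝ)) volume a b := by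
  simp_rw [exp_mul_eigenvalue]
  have := (intervalIntegrable_norm_one_sub_exp_rpow (a - eigenangle A j)
    (b - eigenangle A j)).comp_sub_right (eigenangle A j)
  simpa using this

theorem intervalIntegrable_singularWeight {N : ℕ} (A : U N) (a b : ℝ) :
    IntervalIntegrable (fun φ : ℝ => singularWeight (rot N φ * A)) volume a b := by
  simp_rw [singularWeight_rot_mul]
  have := IntervalIntegrable.sum Finset.univ
    fun j _ => intervalIntegrable_norm_one_sub_mul_rpow A j a b
  refine this.congr fun φ _ => ?_
  rw [Finset.sum_apply]

theorem integral_singularWeight_circle {N : ℕ} (A : U N) :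
    ∫ φ in (-π)..π, singularWeight (rot N φ * A) =
      N * ∫ x in (-π)..π, ‖1 - Complex.exp (Complex.I * x)‖ ^ (-(1 / 2) : ℝ) := by
  simp_rw [singularWeight_rot_mul]
  rw [intervalIntegral.integral_finsetSum fun j _ =>
    intervalIntegrable_norm_one_sub_mul_rpow A j _ _]
  have : ∀ j ∈ Finset.univ, ∫ φ in (-π)..π,
      ‖1 - Complex.exp (Complex.I * φ) * eigenvalue A j‖ ^ (-(1 / 2) : ℝ) =
      ∫ x in (-π)..π, ‖1 - Complex.exp (Complex.I * x)‖ ^ (-(1 / 2) : ℝ) := by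
    intro j _
    simp_rw [exp_mul_eigenvalue]
    set f : ℝ → ℝ := fun x => ‖1 - Complex.exp (Complex.I * x)‖ ^ (-(1 / 2) : ℝ) with hf
    have hper : Function.Periodic f (2 * π) := fun x => by
      simp only [hf]
      congr 3
      push_cast
      rw [mul_add, Complex.exp_add, mul_comm Complex.I (2 * π : ℂ), Complex.exp_two_pi_mul_I,
        mul_one]
    have h1 := intervalIntegral.integral_comp_sub_right (a := -π) (b := π) f (eigenangle A j)
    have h2 := hper.intervalIntegral_add_eq (-π - eigenangle A j) (-π)
    have e1 : -π - eigenangle A j + 2 * π = π - eigenangle A j := by ring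
    have e2 : -π + 2 * π = π := by ring
    rw [e1, e2] at h2
    exact h1.trans h2
  rw [Finset.sum_congr rfl this]
  simp

/-- The integral over each rotation orbit is finite and does not depend on `A`. This gives
integrability on the product with the circle, and the measure-preserving skew rotation transports it
back. -/
theorem integrable_singularWeight (N : ℕ) : Integrable (singularWeight (N := N)) (haar N) := by
  have hpi : -π ≤ π := by linarith [Real.pi_pos]
  set ν : Measure ℝ := volume.restrict (Set.Ioc (-π) π) with hν
  have hmeas := measurable_singularWeight N
  have hmp := measurePreserving_rot_skew N ν
  have h1 : Integrable (fun p : ℝ × U N => singularWeight (rot N p.1 * p.2)) (ν.prod (haar N)) := by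
    refine (integrable_prod_iff' (f := fun p : ℝ × U N => singularWeight (rot N p.1 * p.2))
      ((hmeas.comp measurable_snd).comp hmp.measurable).aestronglyMeasurable).2 ⟨?_, ?_⟩
    · exact Filter.Eventually.of_forall fun A =>
        (intervalIntegrable_iff_integrableOn_Ioc_of_le hpi).1
          (intervalIntegrable_singularWeight A _ _)
    · have e : ∀ A : U N, ∫ φ, ‖singularWeight (rot N φ * A)‖ ∂ν =
          N * ∫ x in (-π)..π, ‖1 - Complex.exp (Complex.I * x)‖ ^ (-(1 / 2) : ℝ) := fun A => by
        rw [← integral_singularWeight_circle A, intervalIntegral.integral_of_le hpi]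
        exact integral_congr_ae (Filter.Eventually.of_forall fun φ =>
          Real.norm_of_nonneg (singularWeight_nonneg _))
      simp only [e]
      exact integrable_const _
  have h2 := (hmp.integrable_comp (g := fun p : ℝ × U N => singularWeight p.2)
    (hmeas.comp measurable_snd).aestronglyMeasurable).1 h1
  have hν0 : ν Set.univ ≠ 0 := by
    simp [hν, Real.volume_Ioc, Real.pi_pos]
  have h3 := (integrable_prod_iff (f := fun p : ℝ × U N => singularWeight p.2)
    (hmeas.comp measurable_snd).aestronglyMeasurable).1 h2
  have : NeZero ν := ⟨fun h => hν0 (by rw [h]; simp)⟩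
  exact h3.1.exists.choose_spec

theorem norm_logP_zero_sq_le {N : ℕ} (A : U N) :
    ‖logP A 0‖ ^ 2 ≤ N * (24 * (2 * N + singularWeight A)) := by
  rw [logP_zero_eq_sum]
  refine (sq_norm_sum_le _ _).trans ?_
  rw [Finset.card_univ, Fintype.card_fin]
  gcongr
  have : 24 * (2 * N + singularWeight A) =
      ∑ j, 24 * (2 + ‖1 - eigenvalue A j‖ ^ (-(1 / 2) : ℝ)) := by
    rw [← Finset.mul_sum, Finset.sum_add_distrib, singularWeight]
    simp [mul_comm]
  rw [this]
  refine Finset.sum_le_sum fun j _ => norm_log_sq_le ?_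
  refine (norm_sub_le _ _).trans ?_
  rw [norm_eigenvalue, norm_one]
  norm_num

theorem integrable_logP_sq (N : ℕ) : Integrable (fun A : U N => logP A 0 ^ 2) (haar N) := by
  refine (((integrable_const (2 * N : ℝ)).add (integrable_singularWeight N)).const_mul
    24).const_mul (N : ℝ) |>.mono' ((measurable_logP_zero N).pow_const 2).aestronglyMeasurable ?_
  refine Filter.Eventually.of_forall fun A => ?_
  rw [norm_pow]
  exact norm_logP_zero_sq_le A

theorem integrable_logP (N : ℕ) : Integrable (fun A : U N => logP A 0) (haar N) := by
  refine ((integrable_const (1 : ℝ)).add (integrable_logP_sq N).norm).mono'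
    (measurable_logP_zero N).aestronglyMeasurable (Filter.Eventually.of_forall fun A => ?_)
  simp only [Pi.add_apply, norm_pow]
  nlinarith [sq_nonneg (‖logP A 0‖ - 1), norm_nonneg (logP A 0)]

/-! ### Equality of the variances of real and imaginary parts -/

theorem ae_exp_mul_eigenvalue_ne_one {N : ℕ} (A : U N) :
    ∀ᵐ φ : ℝ, ∀ j, Complex.exp (Complex.I * φ) * eigenvalue A j ≠ 1 := by
  rw [ae_all_iff]
  intro j
  have : (Set.range fun n : ℤ => eigenangle A j + n * (2 * π)).Countable := Set.countable_range _
  filter_upwards [this.ae_notMem volume] with φ hφ h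
  rw [exp_mul_eigenvalue, Complex.exp_eq_one_iff] at h
  obtain ⟨n, hn⟩ := h
  refine hφ ⟨n, ?_⟩
  have h2 : ((φ - eigenangle A j : ℝ) : ℂ) = ((n * (2 * π) : ℝ) : ℂ) := by
    apply mul_left_cancel₀ Complex.I_ne_zero
    rw [hn]; push_cast; ring
  have h3 : φ - eigenangle A j = n * (2 * π) := by exact_mod_cast h2
  simp only
  linarith

/-- Mean value property of a function holomorphic on the closed disc of radius `r < 1` and vanishing
at the centre. -/
theorem integral_radial_pow_eq_zero {N k : ℕ} (hk : k ≠ 0) (A : U N) {r : ℝ} (h0 : 0 ≤ r)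
    (h1 : r < 1) : ∫ φ in (-π)..π, (∑ j, Complex.log
      (1 - r * (Complex.exp (Complex.I * φ) * eigenvalue A j))) ^ k = 0 := by
  set F : ℂ → ℂ := fun z => (∑ j, Complex.log (1 - z * eigenvalue A j)) ^ k with hF
  have hd : DiffContOnCl ℂ F (Metric.ball 0 |r|) := by
    refine DifferentiableOn.diffContOnCl fun z hz => ?_
    have hz1 : ‖z‖ ≤ r := by
      have := Metric.closure_ball_subset_closedBall hz
      rwa [mem_closedBall_zero_iff, abs_of_nonneg h0] at this
    refine DifferentiableAt.differentiableWithinAt ?_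
    refine DifferentiableAt.pow (DifferentiableAt.fun_sum fun j _ => ?_) k
    refine DifferentiableAt.clog (by fun_prop) (Or.inl ?_)
    have h2 : (z * eigenvalue A j).re ≤ r := by
      refine (Complex.re_le_norm _).trans ?_
      rw [norm_mul, norm_eigenvalue, mul_one]
      exact hz1
    rw [Complex.sub_re, Complex.one_re]
    linarith
  have h2 := hd.circleAverage
  have hF0 : F 0 = 0 := by simp [hF, hk]
  rw [hF0, Real.circleAverage_def, smul_eq_zero_iff_right (by positivity)] at h2
  have hper : Function.Periodic (fun φ : ℝ => F (circleMap 0 r φ)) (2 * π) := fun φ => by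
    simp only [periodic_circleMap 0 r φ]
  have h3 := hper.intervalIntegral_add_eq (-π) 0
  rw [zero_add, h2] at h3
  have e : -π + 2 * π = π := by ring
  rw [e] at h3
  rw [← h3]
  congr 1; funext φ
  simp only [hF, circleMap, zero_add]
  simp only [mul_comm (φ : ℂ) Complex.I, mul_assoc]

theorem integral_logP_pow_circle {N k : ℕ} (hk : k ≠ 0) (hk2 : k ≤ 2) (A : U N) :
    ∫ φ in (-π)..π, logP A φ ^ k = 0 := by
  set F : ℝ → ℝ → ℂ := fun r φ => (∑ j, Complex.log
      (1 - r * (Complex.exp (Complex.I * φ) * eigenvalue A j))) ^ k with hF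
  have hr : ∀ᶠ r : ℝ in 𝓝[<] 1, 0 ≤ r ∧ r < 1 := by
    filter_upwards [Ioo_mem_nhdsLT (show (0 : ℝ) < 1 by norm_num)] with r hr
    exact ⟨hr.1.le, hr.2⟩
  have hlim : Tendsto (fun r => ∫ φ in (-π)..π, F r φ) (𝓝[<] 1)
      (𝓝 (∫ φ in (-π)..π, logP A φ ^ k)) := by
    refine intervalIntegral.tendsto_integral_filter_of_dominated_convergence
      -- The second summand bounds the square of the sum of logarithms; the added `1` also covers `k
      -- = 1`, by `y ≤ 1 + y ^ 2`.
      (fun φ => 1 + N * (48 * (N + singularWeight (rot N φ * A)))) ?_ ?_ ?_ ?_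
    · refine Filter.Eventually.of_forall fun r => Measurable.aestronglyMeasurable ?_
      simp only [hF]
      fun_prop
    · filter_upwards [hr] with r hr
      filter_upwards [ae_exp_mul_eigenvalue_ne_one A] with φ hφ _
      have hb : ‖∑ j, Complex.log (1 - r * (Complex.exp (Complex.I * φ) * eigenvalue A j))‖ ^ 2 ≤
          N * (48 * (N + singularWeight (rot N φ * A))) := by
        refine (sq_norm_sum_le _ _).trans ?_
        rw [Finset.card_univ, Fintype.card_fin]
        gcongr
        have e : 48 * (N + singularWeight (rot N φ * A)) = ∑ j, 48 * (1 +
            ‖1 - Complex.exp (Complex.I * φ) * eigenvalue A j‖ ^ (-(1 / 2) : ℝ)) := by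
          rw [← Finset.mul_sum, Finset.sum_add_distrib, singularWeight_rot_mul]
          simp
        rw [e]
        exact Finset.sum_le_sum fun j _ => norm_log_one_sub_mul_sq_le
          (norm_exp_mul_eigenvalue A j φ) (hφ j) hr.2.le hr.1
      simp only [hF]
      rw [norm_pow]
      refine le_trans ?_ (add_le_add_right hb 1)
      generalize ‖∑ j, Complex.log
        (1 - r * (Complex.exp (Complex.I * φ) * eigenvalue A j))‖ = y
      interval_cases k
      · exact absurd rfl hk
      · nlinarith [sq_nonneg (y - 1)]
      · linarith
    · exact intervalIntegrable_const.add ((((intervalIntegrable_const).add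
        (intervalIntegrable_singularWeight A _ _)).const_mul _).const_mul _)
    · filter_upwards [ae_exp_mul_eigenvalue_ne_one A] with φ hφ _
      rw [logP_eq_sum]
      refine (tendsto_finsetSum _ fun j _ => ?_).pow k
      have hc : ContinuousAt (fun r : ℝ => Complex.log
          (1 - r * (Complex.exp (Complex.I * φ) * eigenvalue A j))) 1 := by
        refine ContinuousAt.clog (by fun_prop) (Or.inl ?_)
        exact one_sub_ofReal_mul_re_pos (norm_exp_mul_eigenvalue A j φ).le (hφ j)
          ⟨zero_le_one, le_rfl⟩
      have := hc.tendsto.mono_left (nhdsWithin_le_nhds (s := Set.Iio 1))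
      simpa using this
  refine tendsto_nhds_unique hlim (tendsto_const_nhds.congr' ?_)
  filter_upwards [hr] with r hr
  exact (integral_radial_pow_eq_zero hk A hr.1 hr.2).symm

theorem integral_logP_pow {N k : ℕ} (hk : k ≠ 0) (hk2 : k ≤ 2) :
    ∫ A : U N, logP A 0 ^ k ∂haar N = 0 := by
  have hi : Integrable (fun A : U N => logP A 0 ^ k) (haar N) := by
    interval_cases k
    · exact absurd rfl hk
    · simpa using integrable_logP N
    · exact integrable_logP_sq N
  rw [integral_eq_integral_circle hi]
  simp_rw [logP_rot_mul, add_zero, integral_logP_pow_circle hk hk2]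
  simp

theorem integral_reLogP_zero (N : ℕ) : ∫ A, reLogP N 0 A ∂haar N = 0 := by
  have h := integral_logP_pow (N := N) (k := 1) (by norm_num) (by norm_num)
  simp only [pow_one] at h
  have h2 := integral_re (integrable_logP N)
  exact h2.trans (by rw [h]; simp)

theorem integrable_reLogP_zero_sq (N : ℕ) :
    Integrable (fun A => reLogP N 0 A ^ 2) (haar N) := by
  refine (integrable_logP_sq N).norm.mono'
    ((measurable_reLogP 0).pow_const 2).aestronglyMeasurable (Filter.Eventually.of_forall fun A => ?_)
  rw [norm_pow, norm_pow, Real.norm_eq_abs]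
  exact pow_le_pow_left₀ (abs_nonneg _) (Complex.abs_re_le_norm _) 2

/-- The real part of `E (log P_N) ^ 2 = 0` is `E (Re log P_N) ^ 2 - E (Im log P_N) ^ 2 = 0`. -/
theorem integral_reLogP_zero_sq (N : ℕ) : ∫ A, reLogP N 0 A ^ 2 ∂haar N = varIm N := by
  have h := integral_logP_pow (N := N) (k := 2) (by norm_num) (by norm_num)
  have h2 := integral_re (integrable_logP_sq N)
  rw [h] at h2
  have e : ∀ A : U N, RCLike.re (logP A 0 ^ 2) = reLogP N 0 A ^ 2 - imLogP A ^ 2 := fun A => by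
    simp [pow_two, reLogP, imLogP]
  simp_rw [e] at h2
  rw [integral_sub (integrable_reLogP_zero_sq N) (integrable_imLogP_pow N 2)] at h2
  rw [varIm]
  simp at h2
  linarith

/-! ### Exponential moments and the cumulants -/

theorem reLogP_eq_comp (N : ℕ) (θ : ℝ) :
    reLogP N θ = reLogP N 0 ∘ fun A => rot N θ * A := by
  funext A
  simp only [reLogP, Function.comp, logP_rot_mul, add_zero]

theorem map_reLogP (N : ℕ) (θ : ℝ) : (haar N).map (reLogP N θ) = (haar N).map (reLogP N 0) := by
  have hmp := measurePreserving_mul_left (haar N) (rot N θ)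
  rw [reLogP_eq_comp, ← Measure.map_map (measurable_reLogP 0) hmp.measurable, hmp.map_eq]

/-- The sum of logarithms is at most `N` times the largest one in absolute value, so `|t| * N ≤ 1 /
2` leaves a single factor with exponent `1 / 2`, which the singular weight dominates. -/
theorem integrable_exp_mul_reLogP_zero {N : ℕ} (hN : 1 ≤ N) {t : ℝ} (ht : |t| * N ≤ 1 / 2) :
    Integrable (fun A => Real.exp (t * reLogP N 0 A)) (haar N) := by
  have : Nonempty (Fin N) := ⟨⟨0, by omega⟩⟩
  refine ((integrable_const (2 * N : ℝ)).add (integrable_singularWeight N)).mono'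
    ((measurable_reLogP 0).const_mul t).exp.aestronglyMeasurable (Filter.Eventually.of_forall fun A => ?_)
  simp only [Pi.add_apply]
  rw [Real.norm_of_nonneg (Real.exp_pos _).le]
  obtain ⟨m, -, hm⟩ := Finset.exists_max_image Finset.univ
    (fun j => |Real.log ‖1 - eigenvalue A j‖|) Finset.univ_nonempty
  have h1 : |reLogP N 0 A| ≤ N * |Real.log ‖1 - eigenvalue A m‖| := by
    rw [reLogP, logP_zero_eq_sum, Complex.re_sum]
    refine (Finset.abs_sum_le_sum_abs _ _).trans ?_
    refine (Finset.sum_le_card_nsmul _ _ _ fun j hj => ?_).trans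
      (by rw [nsmul_eq_mul, Finset.card_univ, Fintype.card_fin])
    rw [Complex.log_re]
    exact hm j hj
  have h2 : t * reLogP N 0 A ≤ |Real.log ‖1 - eigenvalue A m‖| / 2 := by
    calc t * reLogP N 0 A ≤ |t| * |reLogP N 0 A| := by rw [← abs_mul]; exact le_abs_self _
      _ ≤ |t| * (N * |Real.log ‖1 - eigenvalue A m‖|) := by gcongr
      _ = |t| * N * |Real.log ‖1 - eigenvalue A m‖| := by ring
      _ ≤ 1 / 2 * |Real.log ‖1 - eigenvalue A m‖| := by gcongr
      _ = _ := by ring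
  have h3 : ‖1 - eigenvalue A m‖ ≤ 2 := by
    refine (norm_sub_le _ _).trans ?_
    rw [norm_eigenvalue, norm_one]
    norm_num
  have h4 : 2 * N + singularWeight A = ∑ j, (2 + ‖1 - eigenvalue A j‖ ^ (-(1 / 2) : ℝ)) := by
    rw [Finset.sum_add_distrib, singularWeight]
    simp [mul_comm]
  rw [h4]
  refine ((Real.exp_le_exp.2 h2).trans (exp_abs_log_norm_le h3)).trans ?_
  exact Finset.single_le_sum (f := fun j => 2 + ‖1 - eigenvalue A j‖ ^ (-(1 / 2) : ℝ))
    (fun j _ => by positivity) (Finset.mem_univ m)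

theorem zero_mem_interior_integrableExpSet_reLogP {N : ℕ} (hN : 1 ≤ N) (θ : ℝ) :
    0 ∈ interior (integrableExpSet (reLogP N θ) (haar N)) := by
  rw [mem_interior_iff_mem_nhds]
  have hN0 : (0 : ℝ) < N := by positivity
  filter_upwards [Metric.ball_mem_nhds (0 : ℝ) (show 0 < 1 / (2 * N : ℝ) by positivity)] with t ht
  rw [mem_ball_zero_iff, Real.norm_eq_abs, lt_div_iff₀ (by positivity)] at ht
  have h := integrable_exp_mul_reLogP_zero hN (t := t) (by linarith)
  have hmp := measurePreserving_mul_left (haar N) (rot N θ)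
  have := hmp.integrable_comp_of_integrable h
  rw [integrableExpSet, Set.mem_ofPred_eq, reLogP_eq_comp]
  exact this

theorem Q_two {N : ℕ} (hN : 1 ≤ N) (θ : ℝ) : Q 2 N θ = varIm N := by
  have hmp := measurePreserving_mul_left (haar N) (rot N θ)
  have h := zero_mem_interior_integrableExpSet_reLogP hN 0
  have hc : cgf (reLogP N θ) (haar N) = cgf (reLogP N 0) (haar N) := by
    funext t
    rw [cgf, cgf, ← mgf_id_map (measurable_reLogP θ).aemeasurable, map_reLogP,
      mgf_id_map (measurable_reLogP 0).aemeasurable]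
  rw [Q, cumulant, hc, iteratedDeriv_two_cgf h, deriv_cgf_zero h, integral_reLogP_zero]
  simp [integral_reLogP_zero_sq]

theorem zero_mem_interior_integrableExpSet_imLogP' {N : ℕ} (hN : 1 ≤ N) :
    0 ∈ interior (integrableExpSet (imLogP' N) (haarWithLabel N)) := by
  have : NeZero N := ⟨by omega⟩
  have h : integrableExpSet (imLogP' N) (haarWithLabel N) = Set.univ :=
    Set.eq_univ_of_forall fun t => integrable_comp_of_bounded
      (K := fun x => Real.exp (t * x)) measurable_imLogP' abs_imLogP'_le (by fun_prop)
  rw [h, interior_univ]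
  trivial

theorem T_one {N : ℕ} (hN : 1 ≤ N) : T 1 N = -π / 2 := by
  have : NeZero N := ⟨by omega⟩
  rw [T, cumulant, iteratedDeriv_one, deriv_cgf_zero (zero_mem_interior_integrableExpSet_imLogP' hN),
    integral_imLogP' hN]
  simp

theorem T_two {N : ℕ} (hN : 1 ≤ N) : T 2 N = varIm N - π ^ 2 / 12 := by
  have : NeZero N := ⟨by omega⟩
  have h := zero_mem_interior_integrableExpSet_imLogP' hN
  rw [T, cumulant, iteratedDeriv_two_cgf h, deriv_cgf_zero h, integral_imLogP' hN]
  simp [integral_imLogP'_sq hN]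
  ring

/-! ### Asymptotics and the central limit theorem -/

theorem tendsto_half_log_atTop :
    Tendsto (fun N : ℕ => 1 / 2 * Real.log N) atTop atTop :=
  (Real.tendsto_log_atTop.comp tendsto_natCast_atTop_atTop).const_mul_atTop (by norm_num)

theorem isEquivalent_of_abs_varIm_sub_le {f : ℕ → ℝ} {D : ℝ}
    (hf : ∀ N : ℕ, 1 ≤ N → |f N - varIm N| ≤ D) :
    Asymptotics.IsEquivalent atTop f fun N : ℕ => 1 / 2 * Real.log N := by
  obtain ⟨C, hC⟩ := exists_abs_varIm_sub_le
  refine Asymptotics.IsBigO.trans_isLittleO (g := fun _ => (1 : ℝ)) ?_ ?_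
  · refine Asymptotics.IsBigO.of_bound (D + C) ?_
    filter_upwards [eventually_ge_atTop 1] with N hN
    rw [norm_one, mul_one, Real.norm_eq_abs, Pi.sub_apply]
    have e : f N - 1 / 2 * Real.log N = (f N - varIm N) + (varIm N - 1 / 2 * Real.log N) := by ring
    rw [e]
    exact (abs_add_le _ _).trans (add_le_add (hf N hN) (hC N hN))
  · rw [Asymptotics.isLittleO_const_left]
    exact Or.inr (tendsto_norm_atTop_atTop.comp tendsto_half_log_atTop)

theorem isEquivalent_T_two :
    Asymptotics.IsEquivalent atTop (T 2) fun N : ℕ => 1 / 2 * Real.log N :=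
  isEquivalent_of_abs_varIm_sub_le (D := π ^ 2 / 12) fun N hN => by
    rw [T_two hN, sub_sub_cancel_left, abs_neg, abs_of_nonneg (by positivity)]

theorem isEquivalent_Q_two (θ : ℝ) :
    Asymptotics.IsEquivalent atTop (fun N => Q 2 N θ) fun N : ℕ => 1 / 2 * Real.log N :=
  isEquivalent_of_abs_varIm_sub_le (D := 0) fun N hN => by rw [Q_two hN, sub_self, abs_zero]

theorem tendsto_T_two : Tendsto (T 2) atTop atTop :=
  isEquivalent_T_two.symm.tendsto_atTop tendsto_half_log_atTop

theorem tendsto_varIm_div_T_two : Tendsto (fun N => varIm N / T 2 N) atTop (𝓝 1) := by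
  have h : Tendsto (fun N => 1 + π ^ 2 / 12 / T 2 N) atTop (𝓝 (1 + 0)) :=
    (tendsto_T_two.const_div_atTop _).const_add 1
  rw [add_zero] at h
  refine h.congr' ?_
  filter_upwards [tendsto_T_two.eventually_gt_atTop 0, eventually_ge_atTop 1] with N h1 h2
  have := T_two h2
  field_simp
  linarith

theorem tendsto_charIm (τ : ℝ) :
    Tendsto (fun N => charIm N (τ / √(T 2 N))) atTop (𝓝 (Real.exp (-(τ ^ 2 / 2)) : ℝ)) := by
  have hs : Tendsto (fun N => √(T 2 N)) atTop atTop := Real.tendsto_sqrt_atTop.comp tendsto_T_two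
  have hu : Tendsto (fun N => τ / √(T 2 N)) atTop (𝓝 0) := hs.const_div_atTop τ
  have hsq : Tendsto (fun N => (τ / √(T 2 N)) ^ 2 * varIm N) atTop (𝓝 (τ ^ 2)) := by
    have h := tendsto_varIm_div_T_two.const_mul (τ ^ 2)
    rw [mul_one] at h
    refine h.congr' ?_
    filter_upwards [tendsto_T_two.eventually_gt_atTop 0] with N h1
    rw [div_pow, Real.sq_sqrt h1.le]
    ring
  have hexp : Tendsto (fun N => ((Real.exp (-((τ / √(T 2 N)) ^ 2 / 2 * varIm N)) : ℝ) : ℂ)) atTop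
      (𝓝 (Real.exp (-(τ ^ 2 / 2)) : ℝ)) := by
    refine (Complex.continuous_ofReal.comp Real.continuous_exp).continuousAt.tendsto.comp
      (f := fun N => -((τ / √(T 2 N)) ^ 2 / 2 * varIm N)) ?_
    refine ((hsq.div_const 2).neg).congr fun N => ?_
    ring
  -- With `u = τ / √(T 2 N)`, the error is `6 |u|` times `u ^ 2 * varIm N`, whose limit is `τ ^ 2`.
  have herr : Tendsto (fun N => 6 * |τ / √(T 2 N)| ^ 3 * varIm N) atTop (𝓝 0) := by
    have h := ((hu.abs).const_mul 6).mul hsq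
    rw [abs_zero, mul_zero, zero_mul] at h
    refine h.congr fun N => ?_
    rw [← sq_abs]
    ring
  have hdiff : Tendsto (fun N => charIm N (τ / √(T 2 N)) -
      (Real.exp (-((τ / √(T 2 N)) ^ 2 / 2 * varIm N)) : ℝ)) atTop (𝓝 0) := by
    refine squeeze_zero_norm' ?_ herr
    have h0 := hu.abs
    rw [abs_zero] at h0
    filter_upwards [h0.eventually_lt_const (show (0 : ℝ) < 1 / 4 by norm_num)] with N hN
    exact norm_charIm_sub_le N hN.le
  have := hdiff.add hexp
  simpa using this

theorem continuous_average_exp :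
    Continuous fun u : ℝ => (π : ℂ)⁻¹ * ∫ v in (0)..π, Complex.exp (u * v * Complex.I) := by
  refine continuous_const.mul ?_
  exact intervalIntegral.continuous_parametric_intervalIntegral_of_continuous' (by fun_prop) 0 π

/-- Deconvolution: the characteristic function of the uniform summand tends to `1` at the arguments
`τ / √(T 2 N)`, so it is eventually nonzero there and can be divided out. -/
theorem tendsto_charIm' (τ : ℝ) :
    Tendsto (fun N => charIm' N (τ / √(T 2 N))) atTop (𝓝 (Real.exp (-(τ ^ 2 / 2)) : ℝ)) := by
  have hs : Tendsto (fun N => √(T 2 N)) atTop atTop := Real.tendsto_sqrt_atTop.comp tendsto_T_two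
  have hu : Tendsto (fun N => τ / √(T 2 N)) atTop (𝓝 0) := hs.const_div_atTop τ
  have hden := continuous_average_exp.continuousAt.tendsto.comp hu
  have h1 : (π : ℂ)⁻¹ * ∫ v in (0)..π, Complex.exp (((0 : ℝ) : ℂ) * v * Complex.I) = 1 := by
    have : (π : ℂ) ≠ 0 := by exact_mod_cast Real.pi_ne_zero
    simp [this]
  rw [h1] at hden
  have h2 := (tendsto_charIm τ).div hden one_ne_zero
  rw [div_one] at h2
  refine h2.congr' ?_
  filter_upwards [eventually_ge_atTop 1, hden.eventually_ne one_ne_zero] with N hN hne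
  simp only [Function.comp] at hne
  simp only [Pi.div_apply, Function.comp]
  rw [charIm_eq hN, mul_div_assoc, div_self hne, mul_one]

theorem charFun_normalized {N : ℕ} (hN : 1 ≤ N) (τ : ℝ) :
    charFun ((haarWithLabel N).map fun ω => (imLogP' N ω - T 1 N) / √(T 2 N)) τ =
      Complex.exp ((τ / √(T 2 N) : ℝ) * (π / 2) * Complex.I) * charIm' N (τ / √(T 2 N)) := by
  rw [charFun_apply_real, integral_map ((measurable_imLogP'.sub_const _).div_const _).aemeasurable
    (by fun_prop), charIm', ← integral_const_mul]
  congr 1; funext ω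
  rw [← Complex.exp_add, T_one hN]
  congr 1
  push_cast; ring

/-- Lévy's continuity theorem; centring by `T 1 N = -π / 2` only contributes a phase tending to `1`.
The index is `m + 1` because for `N = 0` there are no labels and `haarWithLabel` is not a
probability measure. -/
theorem tendstoInDistribution_normalized :
    TendstoInDistribution
      (fun (m : ℕ) (ω : U (m + 1) × Fin (m + 1)) =>
        (imLogP' (m + 1) ω - T 1 (m + 1)) / √(T 2 (m + 1)))
      atTop id (fun m : ℕ => haarWithLabel (m + 1)) (gaussianReal 0 1) where
  forall_aemeasurable m := ((measurable_imLogP'.sub_const _).div_const _).aemeasurable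
  tendsto := by
    refine ProbabilityMeasure.tendsto_iff_tendsto_charFun.2 fun τ => ?_
    simp only [ProbabilityMeasure.coe_mk, Measure.map_id]
    simp_rw [charFun_normalized (Nat.le_add_left 1 _)]
    have hs : Tendsto (fun N => √(T 2 N)) atTop atTop :=
      Real.tendsto_sqrt_atTop.comp tendsto_T_two
    have hu : Tendsto (fun N => τ / √(T 2 N)) atTop (𝓝 0) := hs.const_div_atTop τ
    have hphase : Tendsto (fun N => Complex.exp ((τ / √(T 2 N) : ℝ) * (π / 2) * Complex.I)) atTop
        (𝓝 1) := by
      have hc : Continuous fun u : ℝ => Complex.exp (u * (π / 2) * Complex.I) := by fun_prop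
      have := (hc.tendsto 0).comp hu
      simpa [Function.comp_def] using this
    have h := (hphase.mul (tendsto_charIm' τ)).comp (tendsto_add_atTop_nat 1)
    have e : charFun (gaussianReal 0 1) τ = 1 * (Real.exp (-(τ ^ 2 / 2)) : ℝ) := by
      rw [charFun_gaussianReal]
      push_cast
      rw [one_mul]
      simp
    rw [e]
    exact h

end CUE

end

open MeasureTheory ProbabilityTheory Filter Asymptotics in
theorem theorem4 :
    (∀ N : ℕ, 1 ≤ N → 0 ∈ interior (integrableExpSet (CUE.imLogP' N) (CUE.haarWithLabel N))) ∧
    (∀ N : ℕ, 1 ≤ N → ∀ θ : ℝ, 0 ∈ interior (integrableExpSet (CUE.reLogP N θ) (CUE.haar N))) ∧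
    (∀ N : ℕ, 1 ≤ N → CUE.T 1 N = -Real.pi / 2) ∧
    (∀ N : ℕ, 1 ≤ N → ∀ θ : ℝ, CUE.T 2 N = CUE.Q 2 N θ - Real.pi ^ 2 / 12) ∧
    (CUE.T 2 ~[atTop] fun N : ℕ => 1 / 2 * Real.log N) ∧
    (∀ θ : ℝ, (fun N : ℕ => CUE.Q 2 N θ) ~[atTop] fun N : ℕ => 1 / 2 * Real.log N) ∧
    TendstoInDistribution
      (fun (m : ℕ) (ω : CUE.U (m + 1) × Fin (m + 1)) =>
        (CUE.imLogP' (m + 1) ω - CUE.T 1 (m + 1)) / Real.sqrt (CUE.T 2 (m + 1)))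
      atTop id (fun m : ℕ => CUE.haarWithLabel (m + 1)) (gaussianReal 0 1) := by
  refine ⟨fun N hN => CUE.zero_mem_interior_integrableExpSet_imLogP' hN,
    fun N hN θ => CUE.zero_mem_interior_integrableExpSet_reLogP hN θ,
    fun N hN => CUE.T_one hN, fun N hN θ => ?_, CUE.isEquivalent_T_two, CUE.isEquivalent_Q_two,
    CUE.tendstoInDistribution_normalized⟩
  rw [CUE.T_two hN, CUE.Q_two hN]
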